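/- Let $d\ge 1$ be an integer, $q>1$, $1\le r\le\infty$ and $s\ge 0$ with $\frac sd<\frac1q\le\frac{s+1}d$, let $\tilde q$ satisfy $\frac sd<\frac1{\tilde q}<\frac1q$, and put $\alpha=d\left(\frac1q-\frac1{\tilde q}\right)$. Notation. For $1<p<\infty$ and a measurable $f:\mathbb R^d\to\mathbb C$ let $f^*(t)=\inf\{\tau\ge 0:|\{|f|>\tau\}|\le t\}$; the Lorentz space $L^{p,r}$ is given by $\|f\|_{L^{p,r}}=\left(\int_0^\infty (t^{1/p}f^*(t))^r\frac{dt}t\right)^{1/r}<\infty$ if $r<\infty$, and by $\|f\|_{L^{p,\infty}}=\sup_{t>0}t^{1/p}f^*(t)<\infty$ if $r=\infty$. For $0\le s<d/p$ the homogeneous Sobolev–Lorentz space is $\dot H^s_{L^{p,r}}=I_s(L^{p,r})$, where $I_sg(x)=\int_{\mathbb R^d}|x-y|^{s-d}g(y)\,dy$ for $s>0$ and $I_0$ is the identity, with the norm $\|f\|_{\dot H^s_{L^{p,r}}}=\|(-\Delta)^{s/2}f\|_{L^{p,r}}$. Further, $e^{t\Delta}f=(4\pi t)^{-d/2}e^{-|\cdot|^2/4t}*f$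 for $t>0$. For $\sigma\in\mathbb R$, the homogeneous Besov space $\dot B^{\sigma,\infty}_{p}$ consists of the tempered distributions $u$ with $\|S_ju\|_{L^\infty}\to0$ as $j\to-\infty$ and $\|u\|_{\dot B^{\sigma,\infty}_p}=\sup_{j\in\mathbb Z}2^{j\sigma}\|\Delta_ju\|_{L^p}<\infty$; here $\hat u(\xi)=\int e^{-2\pi i x\cdot\xi}u(x)\,dx$, $\widehat{S_ju}=\chi(2^{-j}\cdot)\hat u$ and $\Delta_j=S_{j+1}-S_j$, where $\chi$ is any fixed smooth function that equals $1$ on the unit ball and $0$ outside the ball of radius $2$. Then the following hold. 1. There is a constant $C=C(d,s,q,\tilde q,r)$ such that for every $u_0\in\dot H^s_{L^{q,r}}$ one has $e^{t\Delta}u_0\in\dot H^s_{L^{\tilde q,1}}$ for all $t>0$, and $$\sup_{0<t<\infty}t^{\alpha/2}\,\|e^{t\Delta}u_0\|_{\dot H^s_{L^{\tilde q,1}}}\le C\,\|u_0\|_{\dot H^s_{L^{q,r}}},$$ where the left-hand side is finite. 2. If moreover $r<\infty$, then for every $u_0\in\dot H^s_{L^{q,r}}$ $$\lim_{t\to0^+}t^{\alpha/2}\,\|e^{t\Delta}u_0\|_{\dot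 H^s_{L^{\tilde q,1}}}=0 .$$ Together with part 1 this says that $e^{t\Delta}u_0$ belongs to the space $\mathcal K^{s,\tilde q}_{q,1,\infty}$ of all $u(t,x)$ with $u(t)\in\dot H^s_{L^{\tilde q,1}}$ for all $t>0$, $\sup_{t>0}t^{\alpha/2}\|u(t)\|_{\dot H^s_{L^{\tilde q,1}}}<\infty$ and $\lim_{t\to0^+}t^{\alpha/2}\|u(t)\|_{\dot H^s_{L^{\tilde q,1}}}=0$. 3. $\dot H^s_{L^{q,r}}\hookrightarrow\dot B^{s-(d/q-d/\tilde q),\infty}_{\tilde q}$: every $u_0\in\dot H^s_{L^{q,r}}$ defines a tempered distribution in this Besov space, and $\|u_0\|_{\dot B^{s-(d/q-d/\tilde q),\infty}_{\tilde q}}\le C'\|u_0\|_{\dot H^s_{L^{q,r}}}$ with a constant $C'$ that depends only on $d,s,q,\tilde q,r$ and $\chi$. -/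

import Mathlib

open MeasureTheory Filter Topology Set
open scoped ENNReal NNReal SchwartzMap FourierTransform

noncomputable section

namespace SobolevLorentz

/-- The space `ℝ^d` with its Euclidean norm and Lebesgue measure. -/
abbrev Space (d : ℕ) : Type := EuclideanSpace ℝ (Fin d)

variable {d : ℕ}

/-! ### Lorentz spaces -/

/-- The decreasing rearrangement `f^*(t) = inf {τ : |{x : |f(x)| > τ}| ≤ t}`. -/
def decreasingRearrangement (f : Space d → ℂ) (t : ℝ≥0∞) : ℝ≥0∞ :=
  sInf {τ : ℝ≥0∞ | volume {x : Space d | τ < ‖f x‖ₑ} ≤ t}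

/-- The Lorentz norm `‖f‖_{L^{q,r}}` for a finite first index `q` and `1 ≤ r ≤ ∞`. -/
def lorentzNorm (q : ℝ) (r : ℝ≥0∞) (f : Space d → ℂ) : ℝ≥0∞ :=
  if r = ∞ then
    ⨆ t ∈ Ioi (0 : ℝ),
      ENNReal.ofReal (t ^ (1 / q)) * decreasingRearrangement f (ENNReal.ofReal t)
  else
    (∫⁻ t in Ioi (0 : ℝ),
      (ENNReal.ofReal (t ^ (1 / q)) * decreasingRearrangement f (ENNReal.ofReal t)) ^ r.toReal
        * ENNReal.ofReal t⁻¹) ^ (1 / r.toReal)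

/-- Membership in the Lorentz space `L^{q,r}(ℝ^d)`. -/
def MemLorentz (q : ℝ) (r : ℝ≥0∞) (f : Space d → ℂ) : Prop :=
  AEStronglyMeasurable f volume ∧ lorentzNorm q r f < ∞

/-! ### Tempered distributions given by functions, and fractional derivatives -/

/-- The tempered distribution `u` is (integration against) the function `f`. -/
def Represents (f : Space d → ℂ) (u : 𝓢'(Space d, ℂ)) : Prop :=
  AEStronglyMeasurable f volume ∧
    ∀ φ : 𝓢(Space d, ℂ), Integrable (fun x => φ x * f x) volume ∧ u φ = ∫ x, φ x * f x

/-- `v = Λ^s u` with `Λ^s = (-Δ)^{s/2}`: the identity `v̂(ξ) = |ξ|^s û(ξ)` on `ℝ^d ∖ {0}`, tested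
against Schwartz functions `φ` that vanish near the origin, for which `ψ = |ξ|^s φ` is again a
Schwartz function. In Mathlib's normalisation of the Fourier transform the angular frequency is
`2πξ`. This determines `v` up to polynomials. -/
def IsFracLaplacian (s : ℝ) (u v : 𝓢'(Space d, ℂ)) : Prop :=
  ∀ φ ψ : 𝓢(Space d, ℂ), (0 : Space d) ∉ tsupport φ →
    (∀ ξ, ψ ξ = (((2 * Real.pi * ‖ξ‖) ^ s : ℝ) : ℂ) * φ ξ) → (𝓕 v) φ = (𝓕 u) ψ

/-! ### Sobolev-Lorentz spaces -/

/-- The Riesz potential `I_s f(x) = ∫ f(y) / |x - y|^{d - s} dy` for `s ≠ 0`; `I_0` is the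
identity. -/
def rieszPotential (s : ℝ) (f : Space d → ℂ) : Space d → ℂ :=
  if s = 0 then f else fun x => ∫ y, f y / ((‖x - y‖ ^ ((d : ℝ) - s) : ℝ) : ℂ)

/-- Membership in the homogeneous Sobolev-Lorentz space `Ḣ^s_{L^{q,r}} = I_s(L^{q,r})`
(equality of functions almost everywhere). -/
def MemSobolevLorentz (s q : ℝ) (r : ℝ≥0∞) (f : Space d → ℂ) : Prop :=
  ∃ g : Space d → ℂ, MemLorentz q r g ∧ f =ᵐ[volume] rieszPotential s g

/-- The norm `‖f‖_{Ḣ^s_{L^{q,r}}} = ‖Λ^s f‖_{L^{q,r}}`. As `Λ^s f` is determined up to polynomials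
and no nonzero polynomial is in `L^{q,r}`, at most one function (up to null sets) among all the
representatives `g` of `Λ^s f` is in `L^{q,r}`; the infimum selects the norm of that one, and is
`∞` if there is none. -/
def sobolevLorentzNorm (s q : ℝ) (r : ℝ≥0∞) (f : Space d → ℂ) : ℝ≥0∞ :=
  ⨅ (g : Space d → ℂ) (_ : MemLorentz q r g)
    (_ : ∃ u v : 𝓢'(Space d, ℂ), Represents f u ∧ Represents g v ∧ IsFracLaplacian s u v),
    lorentzNorm q r g

/-! ### The heat semigroup and the spaces of Kato type -/

/-- The heat semigroup `e^{tΔ} f = (4πt)^{-d/2} e^{-|·|²/(4t)} * f`, for `t > 0`. -/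
def heatSemigroup (t : ℝ) (f : Space d → ℂ) : Space d → ℂ := fun x =>
  ∫ y, (((4 * Real.pi * t) ^ (-(d : ℝ) / 2) * Real.exp (-‖x - y‖ ^ 2 / (4 * t)) : ℝ) : ℂ) * f y

/-- The exponent `α(q, q') = d (1/q - 1/q')`. -/
def katoExponent (d : ℕ) (q q' : ℝ) : ℝ := d * (1 / q - 1 / q')

/-- The weighted norm `t^{α/2} ‖u(t)‖_{Ḣ^s_{L^{q',r}}}`, with `α = d (1/q - 1/q')`. -/
def katoWeightedNorm (s q q' : ℝ) (r : ℝ≥0∞) (u : ℝ → Space d → ℂ) (t : ℝ) : ℝ≥0∞ :=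
  ENNReal.ofReal (t ^ (katoExponent d q q' / 2)) * sobolevLorentzNorm s q' r (u t)

/-- The norm `sup_{0 < t < T} t^{α/2} ‖u(t)‖_{Ḣ^s_{L^{q',r}}}` of the space `K^{s,q'}_{q,r,T}`,
`0 < T ≤ ∞`. -/
def katoNorm (s q q' : ℝ) (r T : ℝ≥0∞) (u : ℝ → Space d → ℂ) : ℝ≥0∞ :=
  ⨆ (t : ℝ) (_ : 0 < t) (_ : ENNReal.ofReal t < T), katoWeightedNorm s q q' r u t

/-- Membership in `K^{s,q'}_{q,r,T}` (for `q < q'`). -/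
def MemKato (s q q' : ℝ) (r T : ℝ≥0∞) (u : ℝ → Space d → ℂ) : Prop :=
  (∀ t : ℝ, 0 < t → ENNReal.ofReal t < T → MemSobolevLorentz s q' r (u t)) ∧
    katoNorm s q q' r T u < ∞ ∧
    Tendsto (katoWeightedNorm s q q' r u) (𝓝[>] 0) (𝓝 0)

/-! ### Homogeneous Besov spaces -/

/-- A Littlewood-Paley cutoff: a smooth function that is `1` on the unit ball and vanishes outside
the ball of radius `2`. -/
structure IsLittlewoodPaleyCutoff (χ : Space d → ℝ) : Prop where
  smooth : ContDiff ℝ (⊤ : ℕ∞) χ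
  eq_one : ∀ ξ, ‖ξ‖ ≤ 1 → χ ξ = 1
  eq_zero : ∀ ξ, 2 ≤ ‖ξ‖ → χ ξ = 0

/-- The low-frequency cutoff `S_j u`, with Fourier multiplier `χ(2^{-j} ξ)`. -/
def lowFrequency (χ : Space d → ℝ) (j : ℤ) (u : 𝓢'(Space d, ℂ)) : 𝓢'(Space d, ℂ) :=
  TemperedDistribution.fourierMultiplierCLM ℂ
    (fun ξ : Space d => ((χ ((2 : ℝ) ^ (-j) • ξ) : ℝ) : ℂ)) u

/-- The dyadic block `Δ_j u = S_{j+1} u - S_j u`. -/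
def dyadicBlock (χ : Space d → ℝ) (j : ℤ) (u : 𝓢'(Space d, ℂ)) : 𝓢'(Space d, ℂ) :=
  lowFrequency χ (j + 1) u - lowFrequency χ j u

/-- The `L^p` norm of a tempered distribution, `∞` if it is not a function (the function
representing it is unique up to null sets). -/
def distLpNorm (p : ℝ≥0∞) (u : 𝓢'(Space d, ℂ)) : ℝ≥0∞ :=
  ⨅ (f : Space d → ℂ) (_ : Represents f u), eLpNorm f p volume

/-- The norm `sup_j 2^{jσ} ‖Δ_j u‖_{L^p}` of the homogeneous Besov space `Ḃ^{σ,∞}_p`. -/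
def besovNorm (χ : Space d → ℝ) (σ : ℝ) (p : ℝ≥0∞) (u : 𝓢'(Space d, ℂ)) : ℝ≥0∞ :=
  ⨆ j : ℤ, ENNReal.ofReal ((2 : ℝ) ^ ((j : ℝ) * σ)) * distLpNorm p (dyadicBlock χ j u)

/-- Membership in the homogeneous Besov space `Ḃ^{σ,∞}_p`, realised as a space of tempered
distributions `u` without polynomial part: `S_j u → 0` uniformly as `j → -∞`. -/
def MemBesov (χ : Space d → ℝ) (σ : ℝ) (p : ℝ≥0∞) (u : 𝓢'(Space d, ℂ)) : Prop :=
  Tendsto (fun j : ℤ => distLpNorm ∞ (lowFrequency χ j u)) atBot (𝓝 0) ∧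
    besovNorm χ σ p u < ∞

end SobolevLorentz

end

namespace SobolevLorentz

variable {d : ℕ}

/-! Everything is reduced to weak-type information. Since `L^{q,r} ⊂ L^{q,∞}`, only the bound `|{|g|
> l}| ≤ (W/l)^q` is kept for `g = Λ^s u₀`. If a kernel satisfies `‖K‖₁ ≤ A` and `‖K‖_∞ ≤ B`, then `K
* g` is in `L^{q,∞}` with constant of order `W A`, and is bounded by a multiple of `W A^{1-1/q}
B^{1/q}`. As `L^∞ ∩ L^{q,∞}` embeds in `L^{q',1}` and in `L^{q'}` for `q < q'`, both norms are at
most a multiple of `W A^{1-θ} B^θ` with `θ = 1/q - 1/q'`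
(`exists_lorentzNorm_eLpNorm_le_of_le_lconv`).

Parts 1 and 3 are two instances. The heat kernel has `A = 1` and `B = (4πt)^{-d/2}`, which produces
`t^{-α/2}`. The block `Δ_j u₀` is the convolution of `g` with `2^{-js} 2^{jd} K(2^j ·)` for a fixed
Schwartz function `K`, which produces `2^{-j(s - dθ)}`. Both operators are Fourier multipliers, so
the heat semigroup commutes with `Λ^s`, and `Δ_j u₀` can be read off from `Λ^s u₀`.

For part 2, finiteness of `r` lets `g` be split into a bounded piece and a piece of arbitrarily
small `L^{q,∞}` size. This makes `t^{d/(2q)} ‖e^{tΔ} g‖_∞` tend to `0`, and interpolation against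
the fixed weak bound transfers the limit to `L^{q',1}`.

The space is defined through `I_s` and its norm through `Λ^s`. They are linked by `Λ^s I_s g = c g`
(`isFracLaplacian_rieszPotential`), proved by writing the powers `|x|^{s-d}` and `|ξ|^{-s}` as
superpositions of Gaussians. The weak Hardy-Littlewood-Sobolev inequality
(`exists_weakTypeBound_lconv_rieszKernel`) makes `I_s g` a tempered distribution and justifies the
exchanges of integrals. -/

/-! ### Weak-type bounds and their pairings with integrable bounded functions. -/

/-- The weak-type bound `|{F > l}| ≤ (W / l)^p` for all `l > 0`. -/
def WeakTypeBound (p W : ℝ) (F : Space d → ℝ≥0∞) : Prop :=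
  ∀ l : ℝ, 0 < l → volume {x | ENNReal.ofReal l < F x} ≤ ENNReal.ofReal ((W / l) ^ p)

namespace WeakTypeBound

variable {p W : ℝ} {F G : Space d → ℝ≥0∞}

theorem mono_ae (h : WeakTypeBound p W F) (hGF : G ≤ᵐ[volume] F) : WeakTypeBound p W G := by
  intro l hl
  refine le_trans (measure_mono_ae ?_) (h l hl)
  filter_upwards [hGF] with x hx
  intro (hx' : _ < _)
  exact lt_of_lt_of_le hx' hx

/-- The set `{F = ∞}` lies in every superlevel set, whose measure tends to `0` as `l → ∞`. -/
theorem ae_lt_top (h : WeakTypeBound p W F) (hp : 0 < p) :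
    ∀ᵐ x, F x < ∞ := by
  have key : ∀ l : ℝ, 0 < l → volume {x | ¬ F x < ∞} ≤ ENNReal.ofReal ((W / l) ^ p) := by
    intro l hl
    refine le_trans (measure_mono ?_) (h l hl)
    intro x hx
    simp only [not_lt, top_le_iff, mem_ofPred_eq] at hx ⊢
    rw [hx]; exact ENNReal.ofReal_lt_top
  have lim : Tendsto (fun l : ℝ => ENNReal.ofReal ((W / l) ^ p)) atTop (𝓝 0) := by
    rw [← ENNReal.ofReal_zero]
    refine (ENNReal.continuous_ofReal.tendsto 0).comp ?_
    have h1 : Tendsto (fun l : ℝ => W / l) atTop (𝓝 0) := tendsto_const_nhds.div_atTop tendsto_id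
    have := h1.rpow_const (p := p) (Or.inr hp.le)
    rwa [Real.zero_rpow hp.ne'] at this
  exact le_antisymm (ge_of_tendsto lim (eventually_gt_atTop 0 |>.mono key)) (zero_le)

/-- Layer cake: the integral is that of `|{F > t}|` over `t > a`, at most `∫_a^∞ (W/t)^p dt`, which
converges because `p > 1`. Truncated subtraction in `ℝ≥0∞` plays the role of the positive part. -/
theorem lintegral_sub_le (h : WeakTypeBound p W F) (hF : AEMeasurable F volume) (hp : 1 < p)
    (hW : 0 < W) {a : ℝ} (ha : 0 < a) :
    ∫⁻ x, (F x - ENNReal.ofReal a) ≤ ENNReal.ofReal (W ^ p * a ^ (1 - p) / (p - 1)) := by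
  have h1 : ∫⁻ x, (F x - ENNReal.ofReal a) =
      ∫⁻ x, ENNReal.ofReal (max ((F x).toReal - a) 0) := by
    refine lintegral_congr_ae ?_
    filter_upwards [h.ae_lt_top (by linarith)] with x hx
    have h0 : ENNReal.ofReal (max ((F x).toReal - a) 0) = ENNReal.ofReal ((F x).toReal - a) := by
      rw [ENNReal.ofReal, ENNReal.ofReal]; congr 1; ext; simp
    rw [h0, ENNReal.ofReal_sub _ ha.le, ENNReal.ofReal_toReal hx.ne]
  have h2 : ∀ t ∈ Ioi (0 : ℝ), volume {x | t < max ((F x).toReal - a) 0} ≤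
      ENNReal.ofReal ((W / (t + a)) ^ p) := by
    intro t (ht : 0 < t)
    refine le_trans (measure_mono ?_) (h (t + a) (by positivity))
    intro x hx
    have hx : t < max ((F x).toReal - a) 0 := hx
    rcases lt_max_iff.1 hx with h | h
    · change ENNReal.ofReal (t + a) < F x
      have h' : t + a < (F x).toReal := by linarith
      exact (ENNReal.ofReal_lt_iff_lt_toReal (by positivity) (by
        intro h0; rw [h0] at h'; simp at h'; linarith)).2 h'
    · exact absurd h (not_lt.2 ht.le)
  rw [h1, lintegral_eq_lintegral_meas_lt volume (f := fun x => max ((F x).toReal - a) 0)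
    (ae_of_all _ fun x => le_max_right _ _)
    ((hF.ennreal_toReal.sub_const a).max aemeasurable_const)]
  refine (setLIntegral_mono' measurableSet_Ioi h2).trans ?_
  have h3 := (measurePreserving_add_right (volume : Measure ℝ) a).setLIntegral_comp_preimage_emb
    (MeasurableEquiv.addRight a).measurableEmbedding (fun t => ENNReal.ofReal ((W / t) ^ p)) (Ioi a)
  have h4 : (fun t : ℝ => t + a) ⁻¹' Ioi a = Ioi 0 := by ext; simp
  rw [h4] at h3
  rw [h3]
  have h5 : ∫⁻ t in Ioi a, ENNReal.ofReal ((W / t) ^ p) =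
      ∫⁻ t in Ioi a, ENNReal.ofReal (W ^ p * t ^ (-p)) := by
    refine setLIntegral_congr_fun measurableSet_Ioi fun t (ht : a < t) => ?_
    rw [Real.div_rpow hW.le (ha.trans ht).le, Real.rpow_neg (ha.trans ht).le, div_eq_mul_inv]
  have hint : IntegrableOn (fun t : ℝ => W ^ p * t ^ (-p)) (Ioi a) :=
    ((integrableOn_Ioi_rpow_of_lt (by linarith) ha).const_mul _)
  rw [h5, ← ofReal_integral_eq_lintegral_ofReal hint (ae_restrict_of_forall_mem measurableSet_Ioi
    fun t (ht : a < t) => by have := ha.trans ht; positivity), integral_const_mul,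
    integral_Ioi_rpow_of_lt (by linarith) ha]
  refine ENNReal.ofReal_le_ofReal (le_of_eq ?_)
  rw [show -p + 1 = 1 - p by ring, mul_div_assoc, show (1 - p) = -(p - 1) by ring, neg_div_neg_eq]

/-- Pairing of a weak-type function with an integrable bounded one. -/
theorem lintegral_mul_le (h : WeakTypeBound p W F) (hF : AEMeasurable F volume) (hp : 1 < p)
    (hW : 0 < W) {K : Space d → ℝ≥0∞} (hK : AEMeasurable K volume) {A B : ℝ} (hA : 0 < A)
    (hB : 0 < B) (hKA : ∫⁻ x, K x ≤ ENNReal.ofReal A) (hKB : ∀ x, K x ≤ ENNReal.ofReal B) :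
    ∫⁻ x, K x * F x ≤ ENNReal.ofReal (p / (p - 1) * W * A ^ (1 - 1 / p) * B ^ (1 / p)) := by
  have hp1 : 0 < p - 1 := by linarith
  -- This height balances the two contributions: `a A` and `B W^p a^{1-p}` become equal, and the
  -- factor `1 + 1/(p-1)` is `p/(p-1)`.
  set a : ℝ := W * (B / A) ^ (1 / p) with ha_def
  have ha : 0 < a := by positivity
  have h1 : ∀ x, K x * F x ≤ ENNReal.ofReal a * K x + ENNReal.ofReal B * (F x - ENNReal.ofReal a) := by
    intro x
    calc K x * F x ≤ K x * (ENNReal.ofReal a + (F x - ENNReal.ofReal a)) := by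
          gcongr; exact le_add_tsub
      _ = ENNReal.ofReal a * K x + K x * (F x - ENNReal.ofReal a) := by ring
      _ ≤ _ := by gcongr; exact hKB x
  calc ∫⁻ x, K x * F x
      ≤ ∫⁻ x, (ENNReal.ofReal a * K x + ENNReal.ofReal B * (F x - ENNReal.ofReal a)) :=
        lintegral_mono h1
    _ = ENNReal.ofReal a * (∫⁻ x, K x) + ENNReal.ofReal B * ∫⁻ x, (F x - ENNReal.ofReal a) := by
        rw [lintegral_add_left' (hK.const_mul _), lintegral_const_mul'' _ hK,
          lintegral_const_mul'' _ (hF.sub_const _)]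
    _ ≤ ENNReal.ofReal a * ENNReal.ofReal A +
        ENNReal.ofReal B * ENNReal.ofReal (W ^ p * a ^ (1 - p) / (p - 1)) := by
        gcongr; exact h.lintegral_sub_le hF hp hW ha
    _ = ENNReal.ofReal (a * A + B * (W ^ p * a ^ (1 - p) / (p - 1))) := by
        rw [← ENNReal.ofReal_mul ha.le, ← ENNReal.ofReal_mul hB.le, ← ENNReal.ofReal_add]
        · positivity
        · positivity
    _ = _ := by
        congr 1
        have e1 : a * A = W * A ^ (1 - 1 / p) * B ^ (1 / p) := by
          rw [ha_def, Real.div_rpow hB.le hA.le, Real.rpow_sub hA, Real.rpow_one]; ring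
        have e2 : B * (W ^ p * a ^ (1 - p)) = W * A ^ (1 - 1 / p) * B ^ (1 / p) := by
          rw [ha_def]
          rw [← Real.exp_log hA, ← Real.exp_log hB, ← Real.exp_log hW]
          simp only [← Real.exp_mul, ← Real.exp_add, ← Real.exp_sub]
          congr 1
          field_simp
          ring
        rw [e1, ← mul_div_assoc, e2]
        field_simp
        ring

end WeakTypeBound

/-! ### Convolution of weak-type functions with integrable kernels. -/

/-- The convolution of two nonnegative functions. -/
noncomputable def lconv (K F : Space d → ℝ≥0∞) (x : Space d) : ℝ≥0∞ := ∫⁻ y, K (x - y) * F y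

theorem lconv_congr_ae {K F G : Space d → ℝ≥0∞} (h : F =ᵐ[volume] G) : lconv K F = lconv K G := by
  funext x
  exact lintegral_congr_ae (h.mono fun y hy => by simp only [hy])

theorem measurable_lconv {K F : Space d → ℝ≥0∞} (hK : Measurable K) (hF : AEMeasurable F volume) :
    Measurable (lconv K F) := by
  rw [lconv_congr_ae hF.ae_eq_mk]
  have : Measurable fun z : Space d × Space d => K (z.1 - z.2) * hF.mk F z.2 :=
    (hK.comp (measurable_fst.sub measurable_snd)).mul (hF.measurable_mk.comp measurable_snd)
  exact this.lintegral_prod_right'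

theorem lconv_eq_lintegral_sub {K F : Space d → ℝ≥0∞} (x : Space d) :
    lconv K F x = ∫⁻ z, K z * F (x - z) := by
  unfold lconv
  rw [← lintegral_sub_left_eq_self (fun z => K z * F (x - z)) x]
  simp

namespace WeakTypeBound

variable {p W : ℝ} {F G K : Space d → ℝ≥0∞}

theorem comp_sub_right (h : WeakTypeBound p W F) (z : Space d) :
    WeakTypeBound p W (fun x => F (x - z)) := by
  intro l hl
  refine le_of_eq_of_le ?_ (h l hl)
  simpa [sub_eq_add_neg] using measure_preimage_add_right volume (-z) {x | ENNReal.ofReal l < F x}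

theorem lconv_le (h : WeakTypeBound p W F) (hF : AEMeasurable F volume) (hp : 1 < p)
    (hW : 0 < W) (hK : Measurable K) {A B : ℝ} (hA : 0 < A)
    (hB : 0 < B) (hKA : ∫⁻ x, K x ≤ ENNReal.ofReal A) (hKB : ∀ x, K x ≤ ENNReal.ofReal B)
    (x : Space d) :
    lconv K F x ≤ ENNReal.ofReal (p / (p - 1) * W * A ^ (1 - 1 / p) * B ^ (1 / p)) := by
  refine h.lintegral_mul_le hF hp hW (K := fun y => K (x - y))
    (hK.comp (measurable_const.sub measurable_id)).aemeasurable hA hB ?_ fun y => hKB _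
  rwa [lintegral_sub_left_eq_self]

/-- A duality argument, which avoids a triangle inequality in `L^{p,∞}`: for `S` inside the
superlevel set, `l |S| ≤ ∫_S K * F = ∫ K(z) ∫_S F(x - z) dx dz`, and pairing each translate of `F`
with the indicator of `S` gives at most a multiple of `A W |S|^{1-1/p}`. Dividing by `|S|^{1-1/p}`
bounds `|S|`. -/
theorem lconv_of_measurable (h : WeakTypeBound p W F) (hF : Measurable F) (hp : 1 < p)
    (hW : 0 < W) (hK : Measurable K) {A : ℝ} (hA : 0 < A) (hKA : ∫⁻ x, K x ≤ ENNReal.ofReal A) :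
    WeakTypeBound p (p / (p - 1) * W * A) (lconv K F) := by
  intro l hl
  have hp1 : 0 < p - 1 := by linarith
  set E := {x | ENNReal.ofReal l < lconv K F x} with hE_def
  have hE : MeasurableSet E := measurableSet_lt measurable_const (measurable_lconv hK hF.aemeasurable)
  set M : ℝ := p / (p - 1) * W * A with hM_def
  have hM : 0 < M := by positivity
  -- The division is legitimate only for finite measure, which is not yet known for `E`. The bound
  -- is therefore proved for subsets of finite measure and passed to `E` by σ-finiteness.
  have key : ∀ S ⊆ E, MeasurableSet S → volume S < ∞ → volume S ≤ ENNReal.ofReal ((M / l) ^ p) := by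
    intro S hSE hS hSfin
    rcases eq_or_ne (volume S) 0 with h0 | h0
    · rw [h0]; exact zero_le
    set m := (volume S).toReal with hm_def
    have hm : 0 < m := ENNReal.toReal_pos h0 hSfin.ne
    have hSm : volume S = ENNReal.ofReal m := (ENNReal.ofReal_toReal hSfin.ne).symm
    have h1 : ENNReal.ofReal l * volume S ≤ ∫⁻ x in S, lconv K F x := by
      rw [← setLIntegral_const]
      exact setLIntegral_mono' hS fun x hx => (hSE hx : ENNReal.ofReal l < lconv K F x).le
    have h2 : ∫⁻ x in S, lconv K F x =
        ∫⁻ z, K z * ∫⁻ x, S.indicator 1 x * F (x - z) := by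
      calc ∫⁻ x in S, lconv K F x = ∫⁻ x, S.indicator 1 x * ∫⁻ z, K z * F (x - z) := by
            rw [← lintegral_indicator hS]
            refine lintegral_congr fun x => ?_
            by_cases hx : x ∈ S <;> simp [hx, lconv_eq_lintegral_sub]
        _ = ∫⁻ x, ∫⁻ z, S.indicator 1 x * (K z * F (x - z)) := by
            refine lintegral_congr fun x => ?_
            exact (lintegral_const_mul _
              (hK.mul (hF.comp (measurable_const.sub measurable_id)))).symm
        _ = ∫⁻ z, ∫⁻ x, S.indicator 1 x * (K z * F (x - z)) := by
            refine lintegral_lintegral_swap (Measurable.aemeasurable ?_)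
            exact ((measurable_one.indicator hS).comp measurable_fst).mul
              ((hK.comp measurable_snd).mul (hF.comp (measurable_fst.sub measurable_snd)))
        _ = _ := by
            refine lintegral_congr fun z => ?_
            refine Eq.trans ?_ (lintegral_const_mul _ ((measurable_one.indicator hS).mul
              (hF.comp (measurable_id.sub measurable_const))))
            refine lintegral_congr fun x => ?_
            exact mul_left_comm _ _ _
    have h3 : ∀ z, ∫⁻ x, S.indicator 1 x * F (x - z) ≤
        ENNReal.ofReal (p / (p - 1) * W * m ^ (1 - 1 / p)) := by
      intro z
      have := (h.comp_sub_right z).lintegral_mul_le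
        (hF.comp (measurable_id.sub measurable_const)).aemeasurable hp hW
        (K := S.indicator 1) (measurable_one.indicator hS).aemeasurable hm one_pos
        (by rw [lintegral_indicator_one hS, hSm]) (fun x => by
          rw [ENNReal.ofReal_one]; exact indicator_le_self' (fun _ _ => zero_le) x)
      simpa using this
    have h4 : ENNReal.ofReal (l * m) ≤ ENNReal.ofReal (M * m ^ (1 - 1 / p)) := by
      rw [ENNReal.ofReal_mul hl.le, ← hSm]
      calc _ ≤ ∫⁻ x in S, lconv K F x := h1
        _ ≤ ∫⁻ z, K z * ENNReal.ofReal (p / (p - 1) * W * m ^ (1 - 1 / p)) := by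
            rw [h2]; exact lintegral_mono fun z => by gcongr; exact h3 z
        _ ≤ ENNReal.ofReal A * ENNReal.ofReal (p / (p - 1) * W * m ^ (1 - 1 / p)) := by
            rw [lintegral_mul_const _ hK]; gcongr
        _ = _ := by rw [← ENNReal.ofReal_mul hA.le]; congr 1; rw [hM_def]; ring
    have h5 : l * m ≤ M * m ^ (1 - 1 / p) := (ENNReal.ofReal_le_ofReal_iff (by positivity)).1 h4
    have h6 : m ^ (1 / p) ≤ M / l := by
      rw [le_div_iff₀ hl]
      have e : m = m ^ (1 - 1 / p) * m ^ (1 / p) := by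
        rw [← Real.rpow_add hm]; simp
      have : m ^ (1 - 1 / p) * (m ^ (1 / p) * l) ≤ m ^ (1 - 1 / p) * M := by
        calc _ = l * m := by nth_rewrite 3 [e]; ring
          _ ≤ _ := by linarith
      exact le_of_mul_le_mul_left this (by positivity)
    rw [hSm]
    refine ENNReal.ofReal_le_ofReal ?_
    calc m = (m ^ (1 / p)) ^ p := by
          rw [← Real.rpow_mul hm.le]; field_simp; simp
      _ ≤ _ := by gcongr
  rw [← Measure.iSup_restrict_spanningSets (μ := volume) E]
  refine iSup_le fun n => ?_
  rw [Measure.restrict_apply hE]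
  exact key _ inter_subset_left (hE.inter (measurableSet_spanningSets _ _))
    ((measure_mono inter_subset_right).trans_lt (measure_spanningSets_lt_top _ _))

/-- Convolution with an integrable function preserves weak-type bounds. -/
theorem lconv (h : WeakTypeBound p W F) (hF : AEMeasurable F volume) (hp : 1 < p)
    (hW : 0 < W) (hK : Measurable K) {A : ℝ} (hA : 0 < A) (hKA : ∫⁻ x, K x ≤ ENNReal.ofReal A) :
    WeakTypeBound p (p / (p - 1) * W * A) (lconv K F) := by
  rw [lconv_congr_ae hF.ae_eq_mk]
  exact (h.mono_ae hF.ae_eq_mk.symm.le).lconv_of_measurable hF.measurable_mk hp hW hK hA hKA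

end WeakTypeBound

/-! ### From weak-type and sup bounds to `L^{q,1}` and `L^q`. -/

theorem decreasingRearrangement_le_of_weakTypeBound {p W : ℝ} {f : Space d → ℂ}
    (h : WeakTypeBound p W (fun x => ‖f x‖ₑ)) (hp : 0 < p) (hW : 0 < W) {t : ℝ} (ht : 0 < t) :
    decreasingRearrangement f (ENNReal.ofReal t) ≤ ENNReal.ofReal (W * t ^ (-(1 / p))) := by
  refine sInf_le ?_
  refine (h (W * t ^ (-(1 / p))) (by positivity)).trans (ENNReal.ofReal_le_ofReal (le_of_eq ?_))
  rw [div_mul_eq_div_div, div_self hW.ne', Real.rpow_neg ht.le, one_div, inv_inv,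
    ← Real.rpow_mul ht.le]
  field_simp
  simp

theorem decreasingRearrangement_le_of_ae_le {f : Space d → ℂ} {B t : ℝ≥0∞}
    (h : ∀ᵐ x, ‖f x‖ₑ ≤ B) : decreasingRearrangement f t ≤ B := by
  refine sInf_le ?_
  have : volume {x : Space d | B < ‖f x‖ₑ} = 0 := by
    rw [← nonpos_iff_eq_zero, ← ae_iff.1 h]
    exact measure_mono fun x hx => not_le.2 hx
  exact this.le.trans zero_le

/-- `L^∞ ∩ L^{p,∞} ⊂ L^{q,1}` for `p < q`. -/
theorem lorentzNorm_one_le_of_weakTypeBound {p q W B : ℝ} {f : Space d → ℂ}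
    (h : WeakTypeBound p W (fun x => ‖f x‖ₑ)) (hp : 0 < p) (hpq : p < q) (hW : 0 < W) (hB : 0 < B)
    (hfB : ∀ᵐ x, ‖f x‖ₑ ≤ ENNReal.ofReal B) :
    lorentzNorm q 1 f ≤
      ENNReal.ofReal ((q + 1 / (1 / p - 1 / q)) * (W ^ (p / q) * B ^ (1 - p / q))) := by
  have hq : 0 < q := hp.trans hpq
  have hpq' : 0 < 1 / p - 1 / q := sub_pos.2 (one_div_lt_one_div_of_lt hp hpq)
  -- The bounds `B` and `W t^{-1/p}` for `f^*(t)` cross at `T`. The first is integrated on `(0, T]`,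
  -- where `1/q > 0` gives convergence, the second on `(T, ∞)`, where `1/q < 1/p` does.
  set T : ℝ := (W / B) ^ p with hT_def
  have hT : 0 < T := by positivity
  have e1 : lorentzNorm q 1 f = ∫⁻ t in Ioi (0 : ℝ),
      ENNReal.ofReal (t ^ (1 / q)) * decreasingRearrangement f (ENNReal.ofReal t)
        * ENNReal.ofReal t⁻¹ := by
    simp [lorentzNorm]
  have i1 : IntegrableOn (fun t : ℝ => B * t ^ (1 / q - 1)) (Ioc 0 T) := by
    have := (intervalIntegral.intervalIntegrable_rpow' (a := 0) (b := T) (r := 1 / q - 1)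
      (by have : 0 < 1 / q := by positivity
          linarith)).const_mul B
    rwa [intervalIntegrable_iff_integrableOn_Ioc_of_le hT.le] at this
  have hexp : -(1 / p) + 1 / q - 1 < -1 := by linarith
  have i2 : IntegrableOn (fun t : ℝ => W * t ^ (-(1 / p) + 1 / q - 1)) (Ioi T) :=
    (integrableOn_Ioi_rpow_of_lt hexp hT).const_mul W
  have b1 : ∫⁻ t in Ioc 0 T, ENNReal.ofReal (t ^ (1 / q)) *
      decreasingRearrangement f (ENNReal.ofReal t) * ENNReal.ofReal t⁻¹ ≤
      ENNReal.ofReal (B * (q * T ^ (1 / q))) := by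
    calc _ ≤ ∫⁻ t in Ioc 0 T, ENNReal.ofReal (B * t ^ (1 / q - 1)) := by
          refine setLIntegral_mono' measurableSet_Ioc fun t ht => ?_
          have ht0 : 0 < t := ht.1
          calc _ ≤ ENNReal.ofReal (t ^ (1 / q)) * ENNReal.ofReal B * ENNReal.ofReal t⁻¹ := by
                gcongr; exact decreasingRearrangement_le_of_ae_le hfB
            _ = _ := by
                rw [← ENNReal.ofReal_mul (by positivity), ← ENNReal.ofReal_mul (by positivity),
                  Real.rpow_sub ht0, Real.rpow_one]
                congr 1; ring
      _ = _ := by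
          rw [← ofReal_integral_eq_lintegral_ofReal i1 (ae_restrict_of_forall_mem measurableSet_Ioc
            fun t ht => by have := ht.1; positivity), ← intervalIntegral.integral_of_le hT.le,
            intervalIntegral.integral_const_mul, integral_rpow (Or.inl (by
              have : 0 < 1 / q := by positivity
              linarith))]
          congr 2
          rw [sub_add_cancel, Real.zero_rpow (by positivity)]
          field_simp
          simp
  have b2 : ∫⁻ t in Ioi T, ENNReal.ofReal (t ^ (1 / q)) *
      decreasingRearrangement f (ENNReal.ofReal t) * ENNReal.ofReal t⁻¹ ≤
      ENNReal.ofReal (W * (T ^ (1 / q - 1 / p) / (1 / p - 1 / q))) := by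
    calc _ ≤ ∫⁻ t in Ioi T, ENNReal.ofReal (W * t ^ (-(1 / p) + 1 / q - 1)) := by
          refine setLIntegral_mono' measurableSet_Ioi fun t ht => ?_
          have ht0 : 0 < t := hT.trans ht
          calc _ ≤ ENNReal.ofReal (t ^ (1 / q)) * ENNReal.ofReal (W * t ^ (-(1 / p)))
                * ENNReal.ofReal t⁻¹ := by
                gcongr; exact decreasingRearrangement_le_of_weakTypeBound h hp hW ht0
            _ = _ := by
                rw [← ENNReal.ofReal_mul (by positivity), ← ENNReal.ofReal_mul (by positivity),
                  Real.rpow_sub ht0, Real.rpow_one, Real.rpow_add ht0]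
                congr 1; ring
      _ = _ := by
          rw [← ofReal_integral_eq_lintegral_ofReal i2 (ae_restrict_of_forall_mem measurableSet_Ioi
            fun t ht => by have := hT.trans ht; positivity), integral_const_mul,
            integral_Ioi_rpow_of_lt hexp hT]
          congr 2
          rw [show -(1 / p) + 1 / q - 1 + 1 = -(1 / p - 1 / q) by ring, neg_div_neg_eq,
            show -(1 / p - 1 / q) = 1 / q - 1 / p by ring]
  rw [e1, ← Ioc_union_Ioi_eq_Ioi hT.le]
  refine (lintegral_union_le _ _ _).trans ((add_le_add b1 b2).trans ?_)
  rw [← ENNReal.ofReal_add (by positivity) (by positivity)]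
  refine ENNReal.ofReal_le_ofReal (le_of_eq ?_)
  have f1 : B * T ^ (1 / q) = W ^ (p / q) * B ^ (1 - p / q) := by
    rw [hT_def, ← Real.exp_log hB, ← Real.exp_log hW]
    simp only [← Real.exp_mul, ← Real.exp_add, ← Real.exp_sub]
    congr 1; field_simp; ring
  have f2 : W * T ^ (1 / q - 1 / p) = W ^ (p / q) * B ^ (1 - p / q) := by
    rw [hT_def, ← Real.exp_log hB, ← Real.exp_log hW]
    simp only [← Real.exp_mul, ← Real.exp_add, ← Real.exp_sub]
    congr 1; field_simp; ring
  rw [← mul_div_assoc, f2, show B * (q * T ^ (1 / q)) = q * (B * T ^ (1 / q)) by ring, f1]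
  ring

/-- `L^∞ ∩ L^{p,∞} ⊂ L^q` for `p < q`. -/
theorem eLpNorm_le_of_weakTypeBound {p q W B : ℝ} {f : Space d → ℂ}
    (hf : AEStronglyMeasurable f volume)
    (h : WeakTypeBound p W (fun x => ‖f x‖ₑ)) (hp : 0 < p) (hpq : p < q) (hW : 0 < W) (hB : 0 < B)
    (hfB : ∀ᵐ x, ‖f x‖ₑ ≤ ENNReal.ofReal B) :
    eLpNorm f (ENNReal.ofReal q) volume ≤
      ENNReal.ofReal ((q / (q - p)) ^ (1 / q) * (W ^ (p / q) * B ^ (1 - p / q))) := by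
  have hq : 0 < q := hp.trans hpq
  have hqp : 0 < q - p := by linarith
  have h1 : ∫⁻ x, ‖f x‖ₑ ^ q ≤ ENNReal.ofReal (q / (q - p) * (W ^ p * B ^ (q - p))) := by
    have e : ∫⁻ x, ‖f x‖ₑ ^ q = ∫⁻ x, ENNReal.ofReal (‖f x‖ ^ q) := by
      refine lintegral_congr fun x => ?_
      rw [← ofReal_norm, ENNReal.ofReal_rpow_of_nonneg (norm_nonneg _) hq.le]
    rw [e, lintegral_rpow_eq_lintegral_meas_lt_mul volume (ae_of_all _ fun x => norm_nonneg _)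
      hf.norm.aemeasurable hq]
    -- Levels above `B` contribute nothing, so the layer-cake integral stops at `B`. Near `0` the
    -- integrand is of order `t^{q-1-p}`, integrable because `p < q`.
    have hm : ∀ t ∈ Ioi (0 : ℝ), volume {x | t < ‖f x‖} * ENNReal.ofReal (t ^ (q - 1)) ≤
        (Ioc 0 B).indicator (fun t => ENNReal.ofReal (W ^ p * t ^ (q - 1 - p))) t := by
      intro t (ht : 0 < t)
      have es : {x | t < ‖f x‖} = {x | ENNReal.ofReal t < ‖f x‖ₑ} := by
        ext x; simp only [mem_ofPred_eq]
        rw [← ofReal_norm, ENNReal.ofReal_lt_ofReal_iff_of_nonneg ht.le]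
      by_cases htB : t ≤ B
      · rw [indicator_of_mem (show t ∈ Ioc 0 B from ⟨ht, htB⟩), es]
        refine (mul_le_mul_left (h t ht) _).trans (le_of_eq ?_)
        rw [← ENNReal.ofReal_mul (by positivity), Real.div_rpow hW.le ht.le, Real.rpow_sub ht _ p]
        congr 1; ring
      · have : volume {x | t < ‖f x‖} = 0 := by
          rw [es, ← nonpos_iff_eq_zero, ← ae_iff.1 hfB]
          refine measure_mono fun x (hx : _ < _) => not_le.2 (lt_of_le_of_lt ?_ hx)
          exact ENNReal.ofReal_le_ofReal (not_le.1 htB).le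
        rw [this, zero_mul]; exact zero_le
    have i1 : IntegrableOn (fun t : ℝ => W ^ p * t ^ (q - 1 - p)) (Ioc 0 B) := by
      have := (intervalIntegral.intervalIntegrable_rpow' (a := 0) (b := B) (r := q - 1 - p)
        (by linarith)).const_mul (W ^ p)
      rwa [intervalIntegrable_iff_integrableOn_Ioc_of_le hB.le] at this
    calc _ ≤ ENNReal.ofReal q * ∫⁻ t in Ioi (0 : ℝ),
          (Ioc 0 B).indicator (fun t => ENNReal.ofReal (W ^ p * t ^ (q - 1 - p))) t := by
          exact mul_le_mul_right (setLIntegral_mono' measurableSet_Ioi hm) _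
      _ ≤ ENNReal.ofReal q * ∫⁻ t in Ioc 0 B, ENNReal.ofReal (W ^ p * t ^ (q - 1 - p)) := by
          exact mul_le_mul_right ((setLIntegral_le_lintegral _ _).trans_eq
            (lintegral_indicator measurableSet_Ioc _)) _
      _ = _ := by
          rw [← ofReal_integral_eq_lintegral_ofReal i1 (ae_restrict_of_forall_mem measurableSet_Ioc
            fun t ht => by have := ht.1; positivity), ← intervalIntegral.integral_of_le hB.le,
            intervalIntegral.integral_const_mul, integral_rpow (Or.inl (by linarith)),
            ← ENNReal.ofReal_mul hq.le]
          congr 1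
          rw [show q - 1 - p + 1 = q - p by ring, Real.zero_rpow hqp.ne']
          field_simp
          ring
  rw [eLpNorm_eq_lintegral_rpow_enorm_toReal (by simpa using hq) ENNReal.ofReal_ne_top,
    ENNReal.toReal_ofReal hq.le]
  refine (ENNReal.rpow_le_rpow h1 (by positivity)).trans (le_of_eq ?_)
  rw [ENNReal.ofReal_rpow_of_nonneg (by positivity) (by positivity)]
  congr 1
  rw [Real.mul_rpow (by positivity) (by positivity), Real.mul_rpow (by positivity) (by positivity),
    ← Real.rpow_mul hW.le, ← Real.rpow_mul hB.le]
  congr 3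
  · ring
  · field_simp

/-- A function dominated by the convolution of an integrable bounded kernel with an element of
`L^{p,∞}` is in `L^{q,1}` and in `L^q`, for `p < q`. -/
theorem exists_lorentzNorm_eLpNorm_le_of_le_lconv {p q : ℝ} (hp : 1 < p) (hpq : p < q) :
    ∃ C : ℝ, 0 < C ∧ ∀ (f : Space d → ℂ) (K G : Space d → ℝ≥0∞) (W A B : ℝ),
      AEStronglyMeasurable f volume → WeakTypeBound p W G → AEMeasurable G volume → 0 < W →
      Measurable K → 0 < A → 0 < B →
      ∫⁻ x, K x ≤ ENNReal.ofReal A → (∀ x, K x ≤ ENNReal.ofReal B) →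
      (∀ x, ‖f x‖ₑ ≤ lconv K G x) →
      lorentzNorm q 1 f ≤
        ENNReal.ofReal (C * (W * A ^ (1 - (1 / p - 1 / q)) * B ^ (1 / p - 1 / q))) ∧
      eLpNorm f (ENNReal.ofReal q) volume ≤
        ENNReal.ofReal (C * (W * A ^ (1 - (1 / p - 1 / q)) * B ^ (1 / p - 1 / q))) := by
  have hp0 : 0 < p := by linarith
  have hq : 0 < q := hp0.trans hpq
  have hp1 : 0 < p - 1 := by linarith
  have hpq' : 0 < 1 / p - 1 / q := sub_pos.2 (one_div_lt_one_div_of_lt hp0 hpq)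
  have hqp : 0 < q - p := by linarith
  set c1 := q + 1 / (1 / p - 1 / q)
  set c2 := (q / (q - p)) ^ (1 / q)
  have hc1 : 0 < c1 := by positivity
  have hc2 : 0 < c2 := by positivity
  set k := p / (p - 1) with hk_def
  have hk : 0 < k := by positivity
  refine ⟨max c1 c2 * k, by positivity, ?_⟩
  intro f K G W A B hf hG hGm hW hK hA hB hKA hKB hfK
  have w1 : WeakTypeBound p (k * W * A) (fun x => ‖f x‖ₑ) :=
    (hG.lconv hGm hp hW hK hA hKA).mono_ae (ae_of_all _ hfK)
  have w2 : ∀ᵐ x, ‖f x‖ₑ ≤ ENNReal.ofReal (k * W * A ^ (1 - 1 / p) * B ^ (1 / p)) :=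
    ae_of_all _ fun x => (hfK x).trans (hG.lconv_le hGm hp hW hK hA hB hKA hKB x)
  -- The weak bound enters with weight `p/q` and the sup bound with weight `1 - p/q`. The exponent
  -- of `A` is then `p/q + (1 - 1/p)(1 - p/q) = 1 - (1/p - 1/q)`.
  have e : (k * W * A) ^ (p / q) * (k * W * A ^ (1 - 1 / p) * B ^ (1 / p)) ^ (1 - p / q) =
      k * (W * A ^ (1 - (1 / p - 1 / q)) * B ^ (1 / p - 1 / q)) := by
    rw [← Real.exp_log hA, ← Real.exp_log hB, ← Real.exp_log hW, ← Real.exp_log hk]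
    simp only [← Real.exp_mul, ← Real.exp_add]
    congr 1; field_simp; ring
  constructor
  · refine (lorentzNorm_one_le_of_weakTypeBound w1 hp0 hpq (by positivity) (by positivity)
      w2).trans (ENNReal.ofReal_le_ofReal ?_)
    rw [e, ← mul_assoc]
    gcongr
    exact le_max_left _ _
  · refine (eLpNorm_le_of_weakTypeBound hf w1 hp0 hpq (by positivity) (by positivity)
      w2).trans (ENNReal.ofReal_le_ofReal ?_)
    rw [e, ← mul_assoc]
    gcongr
    exact le_max_right _ _

/-! ### The Riesz kernel and the Hardy-Littlewood-Sobolev inequality. -/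

/-- The kernel `|x|^{s-d}` of the Riesz potential. -/
noncomputable def rieszKernel (s : ℝ) (x : Space d) : ℝ≥0∞ := ENNReal.ofReal (‖x‖ ^ (s - d))

theorem measurable_rieszKernel (s : ℝ) : Measurable (rieszKernel s : Space d → ℝ≥0∞) :=
  (measurable_norm.pow_const _).ennreal_ofReal

/-- The volume of the unit ball. -/
noncomputable def unitBallVolume (d : ℕ) : ℝ := (volume (Metric.ball (0 : Space d) 1)).toReal

theorem unitBallVolume_pos : 0 < unitBallVolume d :=
  ENNReal.toReal_pos (Metric.measure_ball_pos _ _ one_pos).ne' measure_ball_lt_top.ne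

theorem volume_ball_zero {R : ℝ} (hR : 0 < R) :
    volume (Metric.ball (0 : Space d) R) = ENNReal.ofReal (unitBallVolume d * R ^ (d : ℝ)) := by
  rw [Measure.addHaar_ball_of_pos _ _ hR, mul_comm, ENNReal.ofReal_mul unitBallVolume_pos.le,
    unitBallVolume, ENNReal.ofReal_toReal measure_ball_lt_top.ne]
  simp

/-- In polar coordinates the density is `y^{d-1} y^{s-d} = y^{s-1}`, integrable at `0` since `s >
0`. The assumption `1 ≤ d` makes the natural number `d - 1` agree with the real one. -/
theorem lintegral_ball_rieszKernel_le (hd : 1 ≤ d) {s : ℝ} (hs : 0 < s) :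
    ∃ c : ℝ, 0 < c ∧ ∀ R : ℝ, 0 < R →
      ∫⁻ x, (Metric.ball (0 : Space d) R).indicator (rieszKernel s) x ≤
        ENNReal.ofReal (c * R ^ s) := by
  have : Nontrivial (Space d) := by
    have : Nonempty (Fin d) := ⟨⟨0, hd⟩⟩
    infer_instance
  refine ⟨d * unitBallVolume d / s, by
    have := unitBallVolume_pos (d := d)
    have : (0 : ℝ) < d := by exact_mod_cast hd
    positivity, fun R hR => ?_⟩
  set f : ℝ → ℝ := (Iio R).indicator fun y => y ^ (s - d) with hf
  have e1 : ∀ x : Space d, (Metric.ball (0 : Space d) R).indicator (rieszKernel s) x =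
      ENNReal.ofReal (f ‖x‖) := by
    intro x
    by_cases hx : ‖x‖ < R <;> simp [hf, hx, rieszKernel]
  have fin : Module.finrank ℝ (Space d) = d := by simp
  have e2 : ∀ y ∈ Ioi (0 : ℝ), y ^ (Module.finrank ℝ (Space d) - 1) • f y =
      (Ioo 0 R).indicator (fun y => y ^ (s - 1)) y := by
    intro y (hy : 0 < y)
    by_cases hyR : y < R
    · simp only [fin, hf, smul_eq_mul]
      rw [indicator_of_mem (show y ∈ Iio R from hyR),
        indicator_of_mem (show y ∈ Ioo 0 R from ⟨hy, hyR⟩), ← Real.rpow_natCast, ← Real.rpow_add hy]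
      congr 1
      push_cast [hd]
      ring
    · simp [hf, hyR]
  have i0 : IntegrableOn (fun y : ℝ => y ^ (s - 1)) (Ioo 0 R) :=
    (intervalIntegral.integrableOn_Ioo_rpow_iff hR).2 (by linarith)
  have i1 : IntegrableOn ((Ioo 0 R).indicator (fun y => y ^ (s - 1))) (Ioi 0) :=
    (i0.integrable_indicator measurableSet_Ioo).integrableOn
  have i2 : Integrable (fun x : Space d => f ‖x‖) := by
    rw [integrable_fun_norm_addHaar]
    exact i1.congr_fun (fun y hy => (e2 y hy).symm) measurableSet_Ioi
  have hf0 : ∀ x : Space d, 0 ≤ f ‖x‖ := fun x =>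
    indicator_apply_nonneg fun _ => Real.rpow_nonneg (norm_nonneg _) _
  simp_rw [e1]
  rw [← ofReal_integral_eq_lintegral_ofReal i2 (ae_of_all _ hf0), integral_fun_norm_addHaar,
    setIntegral_congr_fun measurableSet_Ioi e2, setIntegral_indicator measurableSet_Ioo,
    inter_eq_self_of_subset_right Ioo_subset_Ioi_self, ← integral_Ioc_eq_integral_Ioo,
    ← intervalIntegral.integral_of_le hR.le, integral_rpow (Or.inl (by linarith)), fin]
  refine ENNReal.ofReal_le_ofReal (le_of_eq ?_)
  rw [sub_add_cancel, Real.zero_rpow hs.ne', nsmul_eq_mul, smul_eq_mul, unitBallVolume, Measure.real]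
  ring

/-- The identity `|z|^{s-d} = ∫_{|z|}^∞ (d-s) ρ^{s-d-1} dρ` turns the far part of the kernel into a
superposition of indicators of balls, to which the pairing estimate applies directly. -/
theorem rieszKernel_le_lintegral {s : ℝ} (hsd : s < d) {R : ℝ} (hR : 0 < R) (z : Space d) :
    (Metric.ball (0 : Space d) R)ᶜ.indicator (rieszKernel s) z ≤
      ∫⁻ ρ in Ioi R, ENNReal.ofReal (((d : ℝ) - s) * ρ ^ (s - d - 1)) *
        (if ‖z‖ < ρ then 1 else 0) := by
  by_cases hz : z ∈ (Metric.ball (0 : Space d) R)ᶜ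
  · have hz' : R ≤ ‖z‖ := by simpa using hz
    have hz0 : 0 < ‖z‖ := hR.trans_le hz'
    rw [indicator_of_mem hz, rieszKernel]
    have i1 : IntegrableOn (fun ρ : ℝ => ((d : ℝ) - s) * ρ ^ (s - d - 1)) (Ioi ‖z‖) :=
      (integrableOn_Ioi_rpow_of_lt (by linarith) hz0).const_mul _
    have e : ENNReal.ofReal (‖z‖ ^ (s - d)) =
        ∫⁻ ρ in Ioi ‖z‖, ENNReal.ofReal (((d : ℝ) - s) * ρ ^ (s - d - 1)) := by
      rw [← ofReal_integral_eq_lintegral_ofReal i1 (ae_restrict_of_forall_mem measurableSet_Ioi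
        fun t ht => by
          have : 0 < t := hz0.trans ht
          have : 0 < (d : ℝ) - s := by linarith
          positivity), integral_const_mul, integral_Ioi_rpow_of_lt (by linarith) hz0]
      congr 1
      have : (d : ℝ) - s ≠ 0 := by linarith
      rw [sub_add_cancel, show s - (d : ℝ) = -((d : ℝ) - s) by ring]
      field_simp
    rw [e]
    calc _ = ∫⁻ ρ in Ioi ‖z‖, ENNReal.ofReal (((d : ℝ) - s) * ρ ^ (s - d - 1)) *
          (if ‖z‖ < ρ then 1 else 0) := by
          refine setLIntegral_congr_fun measurableSet_Ioi fun ρ (hρ : ‖z‖ < ρ) => ?_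
          simp [hρ]
      _ ≤ _ := lintegral_mono_set (Ioi_subset_Ioi hz')
  · rw [indicator_of_notMem hz]; exact zero_le

/-- Each ball of radius `ρ` pairs with `F` to at most a multiple of `W ρ^{d(1-1/p)}`. What remains
is `∫_R^∞ ρ^{s-d/p-1} dρ`, finite because `s < d/p`. -/
theorem lconv_rieszKernel_far_le {s p : ℝ} (hp : 1 < p) (hsd : s < d)
    (hsp : s < d / p) :
    ∃ c : ℝ, 0 < c ∧ ∀ (F : Space d → ℝ≥0∞) (W R : ℝ), AEMeasurable F volume → 0 < W →
      WeakTypeBound p W F → 0 < R → ∀ x,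
      lconv ((Metric.ball (0 : Space d) R)ᶜ.indicator (rieszKernel s)) F x ≤
        ENNReal.ofReal (c * W * R ^ (s - d / p)) := by
  have hp1 : 0 < p - 1 := by linarith
  have hp0 : 0 < p := by linarith
  have hv := unitBallVolume_pos (d := d)
  have hds : 0 < (d : ℝ) - s := by linarith
  have hdp : 0 < (d : ℝ) / p - s := by linarith
  set v := unitBallVolume d
  set k : ℝ := p / (p - 1) with hk_def
  have hk : 0 < k := by positivity
  refine ⟨((d : ℝ) - s) * (k * v ^ (1 - 1 / p)) / (d / p - s), by positivity, ?_⟩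
  intro F W R hF hW h hR x
  rw [lconv_congr_ae hF.ae_eq_mk]
  have hG := h.mono_ae hF.ae_eq_mk.symm.le
  have hGm := hF.measurable_mk
  set G := hF.mk F
  have hite : Measurable fun z : Space d × ℝ => (if ‖x - z.1‖ < z.2 then (1 : ℝ≥0∞) else 0) :=
    Measurable.ite (measurableSet_lt (measurable_const.sub measurable_fst).norm measurable_snd)
      measurable_const measurable_const
  have hpw : Measurable fun ρ : ℝ => ENNReal.ofReal (((d : ℝ) - s) * ρ ^ (s - d - 1)) := by fun_prop
  have inner : ∀ ρ ∈ Ioi R, ∫⁻ y, (if ‖x - y‖ < ρ then 1 else 0) * G y ≤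
      ENNReal.ofReal (k * W * (v * ρ ^ (d : ℝ)) ^ (1 - 1 / p)) := by
    intro ρ (hρ : R < ρ)
    have hρ0 := hR.trans hρ
    have hm : Measurable fun z : Space d => (if ‖x - z‖ < ρ then (1 : ℝ≥0∞) else 0) :=
      Measurable.ite (measurableSet_lt (measurable_const.sub measurable_id).norm measurable_const)
        measurable_const measurable_const
    have hint : ∫⁻ y, (if ‖x - y‖ < ρ then (1 : ℝ≥0∞) else 0) ≤
        ENNReal.ofReal (v * ρ ^ (d : ℝ)) := by
      rw [lintegral_sub_left_eq_self (fun z : Space d => if ‖z‖ < ρ then (1 : ℝ≥0∞) else 0) x,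
        ← volume_ball_zero hρ0, ← lintegral_indicator_one measurableSet_ball]
      refine le_of_eq (lintegral_congr fun z => ?_)
      by_cases hz : ‖z‖ < ρ <;> simp [hz]
    have hle : ∀ y : Space d, (if ‖x - y‖ < ρ then (1 : ℝ≥0∞) else 0) ≤ ENNReal.ofReal 1 := by
      intro y; split_ifs <;> simp
    have := hG.lintegral_mul_le hGm.aemeasurable hp hW
      (K := fun y => if ‖x - y‖ < ρ then (1 : ℝ≥0∞) else 0) hm.aemeasurable
      (by positivity) one_pos hint hle
    rwa [Real.one_rpow, mul_one] at this
  calc lconv ((Metric.ball (0 : Space d) R)ᶜ.indicator (rieszKernel s)) G x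
      ≤ ∫⁻ y, ∫⁻ ρ in Ioi R, ENNReal.ofReal (((d : ℝ) - s) * ρ ^ (s - d - 1)) *
        (if ‖x - y‖ < ρ then 1 else 0) * G y := by
        refine lintegral_mono fun y => ?_
        have hm : Measurable fun ρ : ℝ => (if ‖x - y‖ < ρ then (1 : ℝ≥0∞) else 0) :=
          Measurable.ite measurableSet_Ioi measurable_const measurable_const
        refine le_trans ?_ (lintegral_mul_const _ (hpw.mul hm)).ge
        gcongr
        exact rieszKernel_le_lintegral hsd hR _
    _ = ∫⁻ ρ in Ioi R, ∫⁻ y, ENNReal.ofReal (((d : ℝ) - s) * ρ ^ (s - d - 1)) *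
        (if ‖x - y‖ < ρ then 1 else 0) * G y := by
        refine lintegral_lintegral_swap (Measurable.aemeasurable ?_)
        exact ((hpw.comp measurable_snd).mul hite).mul (hGm.comp measurable_fst)
    _ ≤ ∫⁻ ρ in Ioi R, ENNReal.ofReal (((d : ℝ) - s) * (k * W * v ^ (1 - 1 / p)) *
          ρ ^ (s - d / p - 1)) := by
        refine setLIntegral_mono' measurableSet_Ioi fun ρ hρ => ?_
        have hρ0 : 0 < ρ := hR.trans hρ
        simp_rw [mul_assoc (ENNReal.ofReal _)]
        have hm : Measurable fun z : Space d => (if ‖x - z‖ < ρ then (1 : ℝ≥0∞) else 0) :=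
          Measurable.ite (measurableSet_lt (measurable_const.sub measurable_id).norm
            measurable_const) measurable_const measurable_const
        refine (lintegral_const_mul _ (hm.mul hGm)).le.trans ?_
        refine (mul_le_mul_right (inner ρ hρ) _).trans (le_of_eq ?_)
        rw [← ENNReal.ofReal_mul (by positivity)]
        congr 1
        rw [Real.mul_rpow hv.le (by positivity), ← Real.rpow_mul hρ0.le]
        have : ρ ^ (s - d - 1) * ρ ^ ((d : ℝ) * (1 - 1 / p)) = ρ ^ (s - d / p - 1) := by
          rw [← Real.rpow_add hρ0]; congr 1; ring
        rw [← this]; ring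
    _ = _ := by
        have i1 : IntegrableOn (fun ρ : ℝ => ((d : ℝ) - s) * (k * W * v ^ (1 - 1 / p)) *
          ρ ^ (s - d / p - 1)) (Ioi R) :=
          (integrableOn_Ioi_rpow_of_lt (by linarith) hR).const_mul _
        rw [← ofReal_integral_eq_lintegral_ofReal i1 (ae_restrict_of_forall_mem measurableSet_Ioi
          fun t ht => by
            have : 0 < t := hR.trans ht
            positivity), integral_const_mul, integral_Ioi_rpow_of_lt (by linarith) hR]
        congr 1
        rw [sub_add_cancel, show s - (d : ℝ) / p = -((d : ℝ) / p - s) by ring, neg_div_neg_eq]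
        ring

/-- The Hardy-Littlewood-Sobolev inequality in `L^{p,∞}`. -/
theorem exists_weakTypeBound_lconv_rieszKernel (hd : 1 ≤ d) {s p r : ℝ} (hs : 0 < s) (hp : 1 < p)
    (hsp : s < d / p) (hr : r = d / (d / p - s)) :
    ∃ C : ℝ, 0 < C ∧ ∀ (F : Space d → ℝ≥0∞) (W : ℝ), AEMeasurable F volume → 0 < W →
      WeakTypeBound p W F → WeakTypeBound r (C * W) (lconv (rieszKernel s) F) := by
  have hd0 : (0 : ℝ) < d := by exact_mod_cast hd
  have hp0 : 0 < p := by linarith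
  have hp1 : 0 < p - 1 := by linarith
  have hsd : s < d := hsp.trans_le (div_le_self hd0.le hp.le)
  have hdp : 0 < (d : ℝ) / p - s := by linarith
  obtain ⟨c1, hc1, h1⟩ := lintegral_ball_rieszKernel_le hd hs
  obtain ⟨c2, hc2, h2⟩ := lconv_rieszKernel_far_le hp hsd hsp
  set k : ℝ := p / (p - 1) with hk_def
  have hk : 0 < k := by positivity
  set c := max (k * c1) c2 with hc_def
  have hc : 0 < c := lt_max_of_lt_right hc2
  refine ⟨2 * c, by positivity, fun F W hF hW h l hl => ?_⟩
  -- The radius is chosen so that the far part is at most `l/2` everywhere. The superlevel set at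
  -- `l` is then contained in that of the near part at `l/2`, and the near kernel has `L¹` norm of
  -- order `R^s`.
  set R : ℝ := (2 * c * W / l) ^ (1 / (d / p - s)) with hR_def
  have hR : 0 < R := by positivity
  have hRs : c * W * R ^ (s - d / p) = l / 2 := by
    rw [hR_def, ← Real.rpow_mul (by positivity),
      show 1 / ((d : ℝ) / p - s) * (s - d / p) = -1 by
        rw [show s - (d : ℝ) / p = -((d : ℝ) / p - s) by ring, mul_neg, one_div,
          inv_mul_cancel₀ hdp.ne'], Real.rpow_neg_one]
    field_simp
  have hsplit : ∀ x, lconv (rieszKernel s) F x ≤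
      lconv ((Metric.ball (0 : Space d) R).indicator (rieszKernel s)) F x + ENNReal.ofReal (l / 2) := by
    intro x
    calc lconv (rieszKernel s) F x
        = ∫⁻ y, ((Metric.ball (0 : Space d) R).indicator (rieszKernel s) (x - y) * F y +
          (Metric.ball (0 : Space d) R)ᶜ.indicator (rieszKernel s) (x - y) * F y) := by
          refine lintegral_congr fun y => ?_
          rw [← add_mul]
          congr 1
          exact (congrFun (indicator_self_add_compl (Metric.ball (0 : Space d) R)
            (rieszKernel s)) (x - y)).symm
      _ = lconv ((Metric.ball (0 : Space d) R).indicator (rieszKernel s)) F x +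
          lconv ((Metric.ball (0 : Space d) R)ᶜ.indicator (rieszKernel s)) F x := by
          refine lintegral_add_left' (AEMeasurable.mul ?_ hF) _
          exact (((measurable_rieszKernel s).indicator measurableSet_ball).comp
            (measurable_const.sub measurable_id)).aemeasurable
      _ ≤ _ := by
          gcongr
          refine (h2 F W R hF hW h hR x).trans (ENNReal.ofReal_le_ofReal ?_)
          rw [← hRs]
          gcongr
          exact le_max_right _ _
  have hnear := h.lconv hF hp hW ((measurable_rieszKernel s).indicator measurableSet_ball)
    (by positivity) (h1 R hR)
  have hsub : {x | ENNReal.ofReal l < lconv (rieszKernel s) F x} ⊆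
      {x | ENNReal.ofReal (l / 2) <
        lconv ((Metric.ball (0 : Space d) R).indicator (rieszKernel s)) F x} := by
    intro x (hx : ENNReal.ofReal l < _)
    by_contra hcon
    have hcon : lconv ((Metric.ball (0 : Space d) R).indicator (rieszKernel s)) F x ≤
      ENNReal.ofReal (l / 2) := not_lt.1 hcon
    refine absurd hx (not_lt.2 ((hsplit x).trans ((add_le_add_left hcon _).trans ?_)))
    rw [← ENNReal.ofReal_add (by positivity) (by positivity), add_halves]
  refine (measure_mono hsub).trans ((hnear (l / 2) (by positivity)).trans
    (ENNReal.ofReal_le_ofReal ?_))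
  set M : ℝ := 2 * c * W / l with hM_def
  have hM : 0 < M := by positivity
  calc (k * W * (c1 * R ^ s) / (l / 2)) ^ p ≤ (M * R ^ s) ^ p := by
        have : k * W * (c1 * R ^ s) / (l / 2) ≤ M * R ^ s := by
          rw [hM_def]
          have h3 : k * c1 ≤ c := le_max_left _ _
          have : k * W * (c1 * R ^ s) / (l / 2) = 2 * (k * c1) * W / l * R ^ s := by field_simp
          rw [this]
          gcongr
        gcongr
    -- With `δ = d/p - s` one has `R = M^{1/δ}`, so the exponent is `p (1 + s/δ) = d/δ = r`.
    _ = M ^ r := by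
        rw [hR_def, ← Real.rpow_mul hM.le, ← Real.rpow_one_add' hM.le, ← Real.rpow_mul hM.le]
        · congr 1
          rw [hr]
          have h4 : (d : ℝ) = p * ((d / p - s) + s) := by field_simp; ring
          generalize (d : ℝ) / p - s = δ at *
          rw [h4]
          field_simp
        · positivity

/-! ### From Lorentz norms to weak-type bounds. -/

theorem le_decreasingRearrangement {f : Space d → ℂ} {l t : ℝ≥0∞}
    (h : t < volume {x : Space d | l < ‖f x‖ₑ}) : l ≤ decreasingRearrangement f t := by
  refine le_sInf fun τ hτ => ?_
  by_contra! hlt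
  refine absurd h (not_lt.2 (le_trans (measure_mono fun x hx => ?_) hτ))
  exact hlt.trans hx

/-- Testing only finite `t` strictly below `v` covers the case `v = ∞` and matches the strict
inequality needed in `le_decreasingRearrangement`. -/
theorem le_ofReal_rpow_of_forall_lt {q a : ℝ} (hq : 0 < q) {v : ℝ≥0∞}
    (h : ∀ t : ℝ, 0 < t → ENNReal.ofReal t < v → t ^ (1 / q) ≤ a) : v ≤ ENNReal.ofReal (a ^ q) := by
  refine le_of_forall_lt fun t' ht' => ?_
  obtain ⟨t'', h1, h2⟩ := exists_between ht'
  have hfin : t'' ≠ ∞ := (h2.trans_le le_top).ne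
  have h0 : 0 < t''.toReal := ENNReal.toReal_pos (bot_le.trans_lt h1).ne' hfin
  refine h1.trans_le ?_
  rw [← ENNReal.ofReal_toReal hfin] at h2 ⊢
  refine ENNReal.ofReal_le_ofReal ?_
  have := h _ h0 h2
  calc t''.toReal = (t''.toReal ^ (1 / q)) ^ q := by
        rw [← Real.rpow_mul h0.le]; field_simp; simp
    _ ≤ _ := by gcongr

/-- The integrand in the definition of the Lorentz norm. -/
noncomputable def lorentzIntegrand (q ρ : ℝ) (f : Space d → ℂ) (t : ℝ) : ℝ≥0∞ :=
  (ENNReal.ofReal (t ^ (1 / q)) * decreasingRearrangement f (ENNReal.ofReal t)) ^ ρ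
    * ENNReal.ofReal t⁻¹

/-- The rearrangement is at least `l` on all of `(0, t]`, and `∫_0^t u^{ρ/q-1} du = (q/ρ) t^{ρ/q}`.
Integrating over `(0, t]` only is what allows the right side to be made small in
`exists_weakTypeBound_indicator`. -/
theorem le_setLIntegral_lorentzIntegrand {q ρ l t : ℝ} (hq : 0 < q) (hρ : 0 < ρ) (hl : 0 < l)
    (ht : 0 < t) {f : Space d → ℂ}
    (h : ENNReal.ofReal t < volume {x : Space d | ENNReal.ofReal l < ‖f x‖ₑ}) :
    ENNReal.ofReal (q / ρ * (l * t ^ (1 / q)) ^ ρ) ≤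
      ∫⁻ u in Ioc 0 t, lorentzIntegrand q ρ f u := by
  have hpos : 0 < ρ / q := by positivity
  have i1 : IntegrableOn (fun u : ℝ => l ^ ρ * u ^ (ρ / q - 1)) (Ioc 0 t) := by
    have := (intervalIntegral.intervalIntegrable_rpow' (a := 0) (b := t) (r := ρ / q - 1)
      (by linarith)).const_mul (l ^ ρ)
    rwa [intervalIntegrable_iff_integrableOn_Ioc_of_le ht.le] at this
  calc ENNReal.ofReal (q / ρ * (l * t ^ (1 / q)) ^ ρ)
      = ∫⁻ u in Ioc 0 t, ENNReal.ofReal (l ^ ρ * u ^ (ρ / q - 1)) := by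
        rw [← ofReal_integral_eq_lintegral_ofReal i1 (ae_restrict_of_forall_mem measurableSet_Ioc
          fun u hu => by have := hu.1; positivity), ← intervalIntegral.integral_of_le ht.le,
          intervalIntegral.integral_const_mul, integral_rpow (Or.inl (by linarith))]
        congr 1
        rw [sub_add_cancel, Real.zero_rpow hpos.ne', Real.mul_rpow hl.le (by positivity),
          ← Real.rpow_mul ht.le, show 1 / q * ρ = ρ / q by ring]
        field_simp
        ring
    _ ≤ _ := by
        refine setLIntegral_mono' measurableSet_Ioc fun u hu => ?_
        have hu0 : 0 < u := hu.1
        have hle : ENNReal.ofReal l ≤ decreasingRearrangement f (ENNReal.ofReal u) :=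
          le_decreasingRearrangement ((ENNReal.ofReal_le_ofReal hu.2).trans_lt h)
        calc ENNReal.ofReal (l ^ ρ * u ^ (ρ / q - 1))
            = (ENNReal.ofReal (u ^ (1 / q)) * ENNReal.ofReal l) ^ ρ * ENNReal.ofReal u⁻¹ := by
              rw [← ENNReal.ofReal_mul (by positivity), ENNReal.ofReal_rpow_of_nonneg
                (by positivity) hρ.le, ← ENNReal.ofReal_mul (by positivity),
                Real.mul_rpow (by positivity) hl.le, ← Real.rpow_mul hu0.le, Real.rpow_sub hu0,
                Real.rpow_one, show 1 / q * ρ = ρ / q by ring]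
              congr 1; ring
          _ ≤ _ := by
              unfold lorentzIntegrand
              gcongr

theorem setLIntegral_lorentzIntegrand_le {q W : ℝ} {r : ℝ≥0∞} (hr : 1 ≤ r) (hr' : r ≠ ∞)
    {f : Space d → ℂ} (hf : lorentzNorm q r f ≤ ENNReal.ofReal W) (hW : 0 ≤ W) :
    ∫⁻ u in Ioi 0, lorentzIntegrand q r.toReal f u ≤ ENNReal.ofReal (W ^ r.toReal) := by
  have hρ : 0 < r.toReal := ENNReal.toReal_pos (zero_lt_one.trans_le hr).ne' hr'
  rw [lorentzNorm, if_neg hr'] at hf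
  have := ENNReal.rpow_le_rpow hf hρ.le
  rwa [← ENNReal.rpow_mul, one_div_mul_cancel hρ.ne', ENNReal.rpow_one,
    ENNReal.ofReal_rpow_of_nonneg hW hρ.le] at this

/-- `L^{q,r} ⊂ L^{q,∞}`. -/
theorem exists_weakTypeBound_of_lorentzNorm_le {q : ℝ} {r : ℝ≥0∞} (hq : 0 < q) (hr : 1 ≤ r) :
    ∃ c : ℝ, 0 < c ∧ ∀ (f : Space d → ℂ) (W : ℝ), 0 < W → lorentzNorm q r f ≤ ENNReal.ofReal W →
      WeakTypeBound q (c * W) (fun x => ‖f x‖ₑ) := by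
  by_cases hr' : r = ∞
  · refine ⟨1, one_pos, fun f W hW hf l hl => ?_⟩
    refine le_ofReal_rpow_of_forall_lt hq fun t ht h => ?_
    rw [lorentzNorm, if_pos hr'] at hf
    have h1 : ENNReal.ofReal (t ^ (1 / q)) * ENNReal.ofReal l ≤ ENNReal.ofReal W := by
      refine le_trans ?_ ((le_iSup₂ (f := fun (t : ℝ) (_ : t ∈ Ioi (0 : ℝ)) =>
        ENNReal.ofReal (t ^ (1 / q)) * decreasingRearrangement f (ENNReal.ofReal t)) t ht).trans hf)
      gcongr
      exact le_decreasingRearrangement h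
    rw [← ENNReal.ofReal_mul (by positivity), ENNReal.ofReal_le_ofReal_iff hW.le] at h1
    rwa [one_mul, le_div_iff₀ hl]
  · have hρ : 0 < r.toReal := ENNReal.toReal_pos (zero_lt_one.trans_le hr).ne' hr'
    set ρ := r.toReal
    refine ⟨(ρ / q) ^ (1 / ρ), by positivity, fun f W hW hf l hl => ?_⟩
    refine le_ofReal_rpow_of_forall_lt hq fun t ht h => ?_
    have h1 := (le_setLIntegral_lorentzIntegrand hq hρ hl ht h).trans
      ((lintegral_mono_set Ioc_subset_Ioi_self).trans
        (setLIntegral_lorentzIntegrand_le hr hr' hf hW.le))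
    rw [ENNReal.ofReal_le_ofReal_iff (by positivity)] at h1
    have h2 : (l * t ^ (1 / q)) ^ ρ ≤ ((ρ / q) ^ (1 / ρ) * W) ^ ρ := by
      rw [Real.mul_rpow (by positivity) hW.le, ← Real.rpow_mul (by positivity),
        one_div_mul_cancel hρ.ne', Real.rpow_one]
      calc _ = ρ / q * (q / ρ * (l * t ^ (1 / q)) ^ ρ) := by field_simp
        _ ≤ _ := by gcongr
    have h3 := (Real.rpow_le_rpow_iff (by positivity) (by positivity) hρ).1 h2
    rw [le_div_iff₀ hl]
    linarith

/-- For `r < ∞`, an element of `L^{q,r}` is the sum of a bounded function and of a function with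
small `L^{q,∞}` quasinorm. -/
theorem exists_weakTypeBound_indicator {q : ℝ} {r : ℝ≥0∞} (hq : 0 < q) (hr : 1 ≤ r) (hr' : r ≠ ∞)
    {f : Space d → ℂ} (hf : lorentzNorm q r f < ∞) {ε : ℝ} (hε : 0 < ε) :
    ∃ M : ℝ, 0 < M ∧ WeakTypeBound q ε
      ({x | ENNReal.ofReal M < ‖f x‖ₑ}.indicator fun x => ‖f x‖ₑ) := by
  have hρ : 0 < r.toReal := ENNReal.toReal_pos (zero_lt_one.trans_le hr).ne' hr'
  obtain ⟨c, hc, hcw⟩ := exists_weakTypeBound_of_lorentzNorm_le (d := d) hq hr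
  set W := (lorentzNorm q r f).toReal + 1 with hW_def
  have hW : 0 < W := by positivity
  have hfW : lorentzNorm q r f ≤ ENNReal.ofReal W := by
    rw [← ENNReal.ofReal_toReal hf.ne]
    exact ENNReal.ofReal_le_ofReal (by simp [hW_def])
  have hwk := hcw f W hW hfW
  have hint := setLIntegral_lorentzIntegrand_le hr hr' hfW hW.le
  set ρ := r.toReal
  -- Absolute continuity of the convergent Lorentz integral; this is where `r < ∞` matters.
  have hlim : Tendsto (fun δ : ℝ => ∫⁻ u in Ioc 0 δ, lorentzIntegrand q ρ f u ∂(volume.restrict (Ioi 0)))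
      (𝓝[>] 0) (𝓝 0) := by
    refine tendsto_setLIntegral_zero (hint.trans_lt ENNReal.ofReal_lt_top).ne ?_
    refine tendsto_of_tendsto_of_tendsto_of_le_of_le tendsto_const_nhds
      (h := fun δ : ℝ => ENNReal.ofReal δ) ?_ (fun _ => zero_le) fun δ => ?_
    · have : Tendsto (fun δ : ℝ => ENNReal.ofReal δ) (𝓝 0) (𝓝 (ENNReal.ofReal 0)) :=
        ENNReal.continuous_ofReal.tendsto 0
      rw [ENNReal.ofReal_zero] at this
      exact this.mono_left nhdsWithin_le_nhds
    · refine (Measure.restrict_apply_le _ _).trans ?_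
      simp
  have hpos : 0 < ENNReal.ofReal (q / ρ * ε ^ ρ) := by
    rw [ENNReal.ofReal_pos]; positivity
  obtain ⟨δ, hδlt, hδ⟩ := ((hlim.eventually_lt_const hpos).and self_mem_nhdsWithin).exists
  have hδ : 0 < δ := hδ
  rw [Measure.restrict_restrict measurableSet_Ioc,
    inter_eq_self_of_subset_left Ioc_subset_Ioi_self] at hδlt
  -- By the weak bound, `{|f| > M}` has measure at most `δ`. For levels `l ≥ M` only `t ≤ δ` has to
  -- be tested, and there the Lorentz integral is already small.
  set M := c * W * δ ^ (-(1 / q)) with hM_def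
  have hM : 0 < M := by positivity
  have hMδ : volume {x | ENNReal.ofReal M < ‖f x‖ₑ} ≤ ENNReal.ofReal δ := by
    refine (hwk M hM).trans (ENNReal.ofReal_le_ofReal (le_of_eq ?_))
    have : c * W ≠ 0 := by positivity
    rw [hM_def, div_mul_eq_div_div, div_self this, Real.rpow_neg hδ.le, one_div, inv_inv,
      ← Real.rpow_mul hδ.le]
    field_simp
    simp
  have hlarge : ∀ l, M ≤ l → volume {x | ENNReal.ofReal l < ‖f x‖ₑ} ≤
      ENNReal.ofReal ((ε / l) ^ q) := by
    intro l hl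
    have hl0 := hM.trans_le hl
    refine le_ofReal_rpow_of_forall_lt hq fun t ht h => ?_
    have hmono : volume {x | ENNReal.ofReal l < ‖f x‖ₑ} ≤ volume {x | ENNReal.ofReal M < ‖f x‖ₑ} :=
      measure_mono fun x hx => (ENNReal.ofReal_le_ofReal hl).trans_lt hx
    have htδ : t ≤ δ := ((ENNReal.ofReal_lt_ofReal_iff hδ).1
      (h.trans_le (hmono.trans hMδ))).le
    have h1 := (le_setLIntegral_lorentzIntegrand hq hρ hl0 ht h).trans
      ((lintegral_mono_set (Ioc_subset_Ioc_right htδ)).trans hδlt.le)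
    rw [ENNReal.ofReal_le_ofReal_iff (by positivity)] at h1
    have h2 : (l * t ^ (1 / q)) ^ ρ ≤ ε ^ ρ := le_of_mul_le_mul_left h1 (by positivity)
    have h3 := (Real.rpow_le_rpow_iff (by positivity) (by positivity) hρ).1 h2
    rw [le_div_iff₀ hl0]
    linarith
  refine ⟨M, hM, fun l hl => ?_⟩
  have hsub : {x | ENNReal.ofReal l < {x | ENNReal.ofReal M < ‖f x‖ₑ}.indicator (fun x => ‖f x‖ₑ) x}
      ⊆ {x | ENNReal.ofReal (max l M) < ‖f x‖ₑ} := by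
    intro x (hx : ENNReal.ofReal l < _)
    by_cases hxM : ENNReal.ofReal M < ‖f x‖ₑ
    · rw [indicator_of_mem (by exact hxM)] at hx
      change ENNReal.ofReal (max l M) < ‖f x‖ₑ
      rcases max_cases l M with h | h <;> rw [h.1] <;> assumption
    · rw [indicator_of_notMem (by exact hxM)] at hx
      simp at hx
  refine (measure_mono hsub).trans ((hlarge _ (le_max_right _ _)).trans
    (ENNReal.ofReal_le_ofReal ?_))
  -- For `l < M` the superlevel set of the truncated function is contained in the one at level `M`,
  -- whose bound `(ε/M)^q` is below `(ε/l)^q`.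
  have : l ≤ max l M := le_max_left _ _
  gcongr

/-! ### Weak-type functions as tempered distributions. -/

theorem Represents.congr_ae {f g : Space d → ℂ} {u : 𝓢'(Space d, ℂ)} (h : Represents f u)
    (hfg : f =ᵐ[volume] g) : Represents g u := by
  refine ⟨h.1.congr hfg, fun φ => ?_⟩
  have e : (fun x => φ x * f x) =ᵐ[volume] fun x => φ x * g x :=
    hfg.mono fun x hx => by simp only [hx]
  exact ⟨(h.2 φ).1.congr e, (h.2 φ).2.trans (integral_congr_ae e)⟩

theorem Represents.unique {f : Space d → ℂ} {u v : 𝓢'(Space d, ℂ)} (hu : Represents f u)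
    (hv : Represents f v) : u = v := by
  ext φ
  rw [(hu.2 φ).2, (hv.2 φ).2]

theorem Represents.const_mul {f : Space d → ℂ} {u : 𝓢'(Space d, ℂ)} (h : Represents f u) (c : ℂ) :
    Represents (fun x => c * f x) (c • u) := by
  refine ⟨h.1.const_mul c, fun φ => ⟨?_, ?_⟩⟩
  · exact ((h.2 φ).1.const_mul c).congr (ae_of_all _ fun x => by ring)
  · change c • u φ = _
    rw [(h.2 φ).2, smul_eq_mul, ← integral_const_mul]
    exact integral_congr_ae (ae_of_all _ fun x => by ring)

theorem WeakTypeBound.integrable_mul {p W B : ℝ} {f K : Space d → ℂ}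
    (h : WeakTypeBound p W (fun x => ‖f x‖ₑ)) (hf : AEStronglyMeasurable f volume) (hp : 1 < p)
    (hW : 0 < W) (hK : Integrable K volume) (hKB : ∀ x, ‖K x‖ ≤ B) :
    Integrable (fun x => K x * f x) volume := by
  refine ⟨hK.1.mul hf, ?_⟩
  rw [hasFiniteIntegral_iff_enorm]
  simp_rw [enorm_mul]
  have hfin : ∫⁻ x, ‖K x‖ₑ < ∞ := hasFiniteIntegral_iff_enorm.1 hK.2
  refine (h.lintegral_mul_le hf.enorm hp hW hK.1.enorm
    (A := (∫⁻ x, ‖K x‖ₑ).toReal + 1) (B := max B 1) (by positivity) (by positivity) ?_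
    fun x => ?_).trans_lt ENNReal.ofReal_lt_top
  · refine (ENNReal.ofReal_toReal hfin.ne).ge.trans (ENNReal.ofReal_le_ofReal (by linarith))
  · rw [← ofReal_norm]
    exact ENNReal.ofReal_le_ofReal ((hKB x).trans (le_max_left _ _))

theorem exists_norm_le_schwartz (φ : 𝓢(Space d, ℂ)) : ∃ B, ∀ x, ‖φ x‖ ≤ B := by
  obtain ⟨C, -, hC⟩ := φ.decay 0 0
  exact ⟨C, fun x => by simpa using hC x⟩

/-- Functions in `L^{p,∞}`, `p > 1`, are tempered distributions. -/
theorem WeakTypeBound.exists_represents {p W : ℝ} {f : Space d → ℂ}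
    (h : WeakTypeBound p W (fun x => ‖f x‖ₑ)) (hf : AEStronglyMeasurable f volume) (hp : 1 < p)
    (hW : 0 < W) : ∃ u : 𝓢'(Space d, ℂ), Represents f u := by
  set g := hf.mk f with hg_def
  have hg : StronglyMeasurable g := hf.stronglyMeasurable_mk
  have hfg : f =ᵐ[volume] g := hf.ae_eq_mk
  have hgw : WeakTypeBound p W (fun x => ‖g x‖ₑ) :=
    h.mono_ae (hfg.mono fun x hx => by simp only [hx]; exact le_rfl)
  set S : Set (Space d) := {x | 1 < ‖g x‖ₑ} with hS_def
  have hS : MeasurableSet S := measurableSet_lt measurable_const hg.enorm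
  have h1 : MemLp (S.indicator g) 1 volume := by
    refine ⟨(hg.indicator hS).aestronglyMeasurable, ?_⟩
    rw [eLpNorm_one_eq_lintegral_enorm]
    -- For `y ≥ 1` one has `y ≤ 2(y - 1/2)`, so the large part is integrable by `lintegral_sub_le`
    -- at height `1/2`. Splitting at height `1` thus places `g` in `L¹ + L^∞`.
    have hle : ∀ x, ‖S.indicator g x‖ₑ ≤ 2 * (‖g x‖ₑ - ENNReal.ofReal (1 / 2)) := by
      intro x
      by_cases hx : x ∈ S
      · rw [indicator_of_mem hx]
        have hx1 : 1 ≤ ‖g x‖ := by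
          have : (1 : ℝ≥0∞) < ‖g x‖ₑ := hx
          rw [← ofReal_norm, ← ENNReal.ofReal_one,
            ENNReal.ofReal_lt_ofReal_iff_of_nonneg zero_le_one] at this
          exact this.le
        rw [← ofReal_norm, ← ENNReal.ofReal_sub _ (by norm_num),
          show (2 : ℝ≥0∞) = ENNReal.ofReal 2 by simp, ← ENNReal.ofReal_mul (by norm_num)]
        exact ENNReal.ofReal_le_ofReal (by linarith)
      · rw [indicator_of_notMem hx]; simp
    calc _ ≤ ∫⁻ x, 2 * (‖g x‖ₑ - ENNReal.ofReal (1 / 2)) := lintegral_mono hle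
      _ = 2 * ∫⁻ x, (‖g x‖ₑ - ENNReal.ofReal (1 / 2)) :=
          lintegral_const_mul' _ _ (by simp)
      _ < ∞ := ENNReal.mul_lt_top (by simp)
          ((hgw.lintegral_sub_le hg.enorm.aemeasurable hp hW (by norm_num)).trans_lt
            ENNReal.ofReal_lt_top)
  have h0 : MemLp (Sᶜ.indicator g) ∞ volume := by
    refine memLp_top_of_bound (hg.indicator hS.compl).aestronglyMeasurable 1 (ae_of_all _ fun x => ?_)
    by_cases hx : x ∈ Sᶜ
    · rw [indicator_of_mem hx]
      have : ‖g x‖ₑ ≤ 1 := not_lt.1 hx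
      rwa [← ofReal_norm, ENNReal.ofReal_le_one] at this
    · rw [indicator_of_notMem hx]; simp
  have hind : ∀ T : Set (Space d), WeakTypeBound p W (fun x => ‖T.indicator g x‖ₑ) := fun T =>
    hgw.mono_ae (ae_of_all _ fun x => by
      by_cases hx : x ∈ T <;> simp [hx])
  refine ⟨Lp.toTemperedDistribution (h1.toLp _) + Lp.toTemperedDistribution (h0.toLp _), ?_⟩
  refine Represents.congr_ae ⟨hg.aestronglyMeasurable, fun φ => ?_⟩ hfg.symm
  obtain ⟨B, hB⟩ := exists_norm_le_schwartz φ
  refine ⟨hgw.integrable_mul hg.aestronglyMeasurable hp hW φ.integrable hB, ?_⟩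
  change Lp.toTemperedDistribution (h1.toLp _) φ + Lp.toTemperedDistribution (h0.toLp _) φ = _
  rw [Lp.toTemperedDistribution_apply, Lp.toTemperedDistribution_apply]
  have e1 : ∫ x, φ x • (h1.toLp _ : Space d → ℂ) x = ∫ x, φ x * S.indicator g x :=
    integral_congr_ae (h1.coeFn_toLp.mono fun x hx => by simp only [hx, smul_eq_mul])
  have e0 : ∫ x, φ x • (h0.toLp _ : Space d → ℂ) x = ∫ x, φ x * Sᶜ.indicator g x :=
    integral_congr_ae (h0.coeFn_toLp.mono fun x hx => by simp only [hx, smul_eq_mul])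
  rw [e1, e0, ← integral_add
    ((hind S).integrable_mul (hg.indicator hS).aestronglyMeasurable hp hW φ.integrable hB)
    ((hind Sᶜ).integrable_mul (hg.indicator hS.compl).aestronglyMeasurable hp hW φ.integrable hB)]
  refine integral_congr_ae (ae_of_all _ fun x => ?_)
  simp only
  rw [← mul_add]
  exact congrArg (φ x * ·) (congrFun (indicator_self_add_compl S g) x)

/-! ### Fourier multipliers acting by convolution. -/

open Real in
/-- The Fourier transform is self-adjoint. -/
theorem integral_fourier_mul_eq_of_integrable {f g : Space d → ℂ} (hf : Integrable f volume)
    (hg : Integrable g volume) : ∫ ξ, 𝓕 f ξ * g ξ = ∫ x, f x * 𝓕 g x := by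
  simpa using! VectorFourier.integral_bilin_fourierIntegral_eq_flip (.mul ℂ ℂ)
    (L := innerₗ (Space d)) continuous_fourierChar continuous_inner hf hg

-- This is the transpose of the multiplier acting on a test function. Moving the Fourier transform
-- from `K` onto the modulated function `e^{-2πi ξ·y} 𝓕⁻ φ` gives `φ(· + y)`. The integration
-- variable is `x`, the first slot of `K(x - y)`, so a swap of integrals then moves the convolution
-- onto `f`.
open Real in
theorem fourier_smulLeft_fourierInv_apply {m K : Space d → ℂ} (hm : m.HasTemperateGrowth)
    (hK : Integrable K volume) (hKm : 𝓕 K = m) (φ : 𝓢(Space d, ℂ)) (y : Space d) :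
    𝓕 (SchwartzMap.smulLeftCLM ℂ m (𝓕⁻ φ)) y = ∫ x, K (x - y) * φ x := by
  set ψ : 𝓢(Space d, ℂ) := 𝓕⁻ φ with hψ
  have hφ : ∀ x, φ x = 𝓕 (ψ : Space d → ℂ) x := by
    intro x
    rw [← SchwartzMap.fourier_coe, hψ, FourierTransform.fourier_fourierInv_eq]
  rw [SchwartzMap.fourier_coe, SchwartzMap.smulLeftCLM_apply hm]
  set g : Space d → ℂ := fun ξ => 𝐞 (-(inner ℝ ξ y)) • ψ ξ with hg_def
  have hg : Integrable g volume := (fourierIntegral_convergent_iff y).2 ψ.integrable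
  have e1 : 𝓕 (fun ξ => m ξ • ψ ξ) y = ∫ ξ, 𝓕 K ξ * g ξ := by
    rw [fourier_eq, hKm]
    refine integral_congr_ae (ae_of_all _ fun ξ => ?_)
    simp only [hg_def, Circle.smul_def, smul_eq_mul]
    ring
  have e2 : ∀ z, 𝓕 g z = φ (z + y) := by
    intro z
    rw [hφ, fourier_eq, fourier_eq]
    refine integral_congr_ae (ae_of_all _ fun ξ => ?_)
    simp only [hg_def]
    rw [smul_smul, ← AddChar.map_add_eq_mul, inner_add_right]
    congr 2; ring
  rw [e1, integral_fourier_mul_eq_of_integrable hK hg]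
  simp_rw [e2]
  rw [← integral_sub_right_eq_self (fun z => K z * φ (z + y)) y]
  simp

/-- The convolution of a kernel and a function. -/
noncomputable def conv (K f : Space d → ℂ) (x : Space d) : ℂ := ∫ y, K (x - y) * f y

theorem enorm_conv_le (K f : Space d → ℂ) (x : Space d) :
    ‖conv K f x‖ₑ ≤ lconv (fun z => ‖K z‖ₑ) (fun z => ‖f z‖ₑ) x := by
  refine (enorm_integral_le_lintegral_enorm _).trans (le_of_eq ?_)
  simp_rw [enorm_mul]
  rfl

theorem conv_congr_ae {K f g : Space d → ℂ} (h : f =ᵐ[volume] g) : conv K f = conv K g := by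
  funext x
  exact integral_congr_ae (h.mono fun y hy => by simp only [hy])

theorem aestronglyMeasurable_conv {K f : Space d → ℂ} (hK : Measurable K)
    (hf : AEStronglyMeasurable f volume) : AEStronglyMeasurable (conv K f) volume := by
  rw [conv_congr_ae hf.ae_eq_mk]
  have : Measurable fun z : Space d × Space d => K (z.1 - z.2) * hf.mk f z.2 :=
    (hK.comp (measurable_fst.sub measurable_snd)).mul
      (hf.stronglyMeasurable_mk.measurable.comp measurable_snd)
  exact this.aestronglyMeasurable.integral_prod_right'

/-- A Fourier multiplier with an integrable and bounded kernel acts on `L^{p,∞}`, `p > 1`, by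
convolution. -/
theorem Represents.conv {p W B : ℝ} {f K m : Space d → ℂ} {u : 𝓢'(Space d, ℂ)}
    (hu : Represents f u) (h : WeakTypeBound p W (fun x => ‖f x‖ₑ)) (hp : 1 < p) (hW : 0 < W)
    (hm : m.HasTemperateGrowth) (hKm : Measurable K) (hK : Integrable K volume)
    (hKB : ∀ x, ‖K x‖ ≤ B) (hKF : 𝓕 K = m) :
    Represents (conv K f) (TemperedDistribution.fourierMultiplierCLM ℂ m u) := by
  have hf := hu.1
  refine ⟨aestronglyMeasurable_conv hKm hf, fun φ => ?_⟩
  have hfin : ∫⁻ x, ‖K x‖ₑ < ∞ := hasFiniteIntegral_iff_enorm.1 hK.2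
  set A := (∫⁻ x, ‖K x‖ₑ).toReal + 1 with hA_def
  have hKA : ∫⁻ x, ‖K x‖ₑ ≤ ENNReal.ofReal A :=
    (ENNReal.ofReal_toReal hfin.ne).ge.trans (ENNReal.ofReal_le_ofReal (by linarith))
  have hsup := h.lconv_le hf.enorm hp hW hKm.enorm (A := A) (B := max B 1) (by positivity)
    (by positivity) hKA (fun x => by
      rw [← ofReal_norm]
      exact ENNReal.ofReal_le_ofReal ((hKB x).trans (le_max_left _ _)))
  set M := ENNReal.ofReal (p / (p - 1) * W * A ^ (1 - 1 / p) * max B 1 ^ (1 / p))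
  -- `|K| * |f|` is bounded by the constant `M` and `φ` is integrable, so the double integral
  -- converges absolutely and Fubini applies.
  have hprod : Integrable (fun z : Space d × Space d => φ z.1 * (K (z.1 - z.2) * f z.2))
      (volume.prod volume) := by
    have hmeas : AEStronglyMeasurable
        (fun z : Space d × Space d => φ z.1 * (K (z.1 - z.2) * f z.2)) (volume.prod volume) :=
      (φ.continuous.comp continuous_fst).aestronglyMeasurable.mul
        ((hKm.comp (measurable_fst.sub measurable_snd)).aestronglyMeasurable.mul hf.comp_snd)
    refine ⟨hmeas, ?_⟩
    rw [hasFiniteIntegral_iff_enorm, lintegral_prod _ hmeas.enorm]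
    calc _ ≤ ∫⁻ x, ‖φ x‖ₑ * M := by
          refine lintegral_mono fun x => ?_
          simp_rw [enorm_mul]
          rw [lintegral_const_mul' _ _ enorm_ne_top]
          gcongr
          exact hsup x
      _ = (∫⁻ x, ‖φ x‖ₑ) * M := lintegral_mul_const' _ _ ENNReal.ofReal_ne_top
      _ < ∞ := ENNReal.mul_lt_top (hasFiniteIntegral_iff_enorm.1 φ.integrable.2)
          ENNReal.ofReal_lt_top
  constructor
  · refine hprod.integral_prod_left.congr (ae_of_all _ fun x => ?_)
    exact integral_const_mul (φ x) fun y => K (x - y) * f y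
  · rw [TemperedDistribution.fourierMultiplierCLM_apply_apply, (hu.2 _).2]
    simp_rw [fourier_smulLeft_fourierInv_apply hm hK hKF φ, SobolevLorentz.conv,
      ← integral_mul_const, ← integral_const_mul]
    refine Eq.trans ?_ (integral_integral_swap
      (f := fun x y => φ x * (K (x - y) * f y)) hprod).symm
    congr 1
    funext y
    congr 1
    funext x
    ring

theorem fourier_fourierMultiplierCLM (m : Space d → ℂ) (u : 𝓢'(Space d, ℂ)) :
    𝓕 (TemperedDistribution.fourierMultiplierCLM ℂ m u) =
      TemperedDistribution.smulLeftCLM ℂ m (𝓕 u) := by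
  rw [TemperedDistribution.fourierMultiplierCLM_apply, FourierTransform.fourier_fourierInv_eq]

/-- Fourier multipliers commute with `Λ^s`. -/
theorem IsFracLaplacian.fourierMultiplierCLM {s : ℝ} {u v : 𝓢'(Space d, ℂ)}
    (h : IsFracLaplacian s u v) {m : Space d → ℂ} (hm : m.HasTemperateGrowth) :
    IsFracLaplacian s (TemperedDistribution.fourierMultiplierCLM ℂ m u)
      (TemperedDistribution.fourierMultiplierCLM ℂ m v) := by
  intro φ ψ hφ hψ
  rw [fourier_fourierMultiplierCLM, fourier_fourierMultiplierCLM,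
    TemperedDistribution.smulLeftCLM_apply_apply, TemperedDistribution.smulLeftCLM_apply_apply]
  -- Multiplication by `m` does not enlarge the support of the test function and commutes with
  -- multiplication by `(2π|ξ|)^s`, so `(mφ, mψ)` is again an admissible pair.
  refine h _ _ (fun h0 => hφ ?_) fun ξ => ?_
  · rw [SchwartzMap.smulLeftCLM_apply hm] at h0
    exact tsupport_smul_subset_right _ _ h0
  · rw [SchwartzMap.smulLeftCLM_apply_apply hm, SchwartzMap.smulLeftCLM_apply_apply hm, hψ]
    simp only [smul_eq_mul]; ring

/-! ### The heat kernel -/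

/-- The heat kernel. -/
noncomputable def heatKernel (t : ℝ) (z : Space d) : ℂ :=
  (((4 * Real.pi * t) ^ (-(d : ℝ) / 2) * Real.exp (-‖z‖ ^ 2 / (4 * t)) : ℝ) : ℂ)

/-- The Fourier transform of the heat kernel. -/
noncomputable def heatSymbol (t : ℝ) (ξ : Space d) : ℂ :=
  ((Real.exp (-(4 * Real.pi ^ 2 * t) * ‖ξ‖ ^ 2) : ℝ) : ℂ)

theorem heatSemigroup_eq_conv (t : ℝ) (f : Space d → ℂ) :
    heatSemigroup t f = conv (heatKernel t) f := rfl

theorem measurable_heatKernel (t : ℝ) : Measurable (heatKernel t : Space d → ℂ) := by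
  unfold heatKernel; fun_prop

theorem norm_heatKernel {t : ℝ} (ht : 0 < t) (z : Space d) : ‖heatKernel t z‖ =
    (4 * Real.pi * t) ^ (-(d : ℝ) / 2) * Real.exp (-‖z‖ ^ 2 / (4 * t)) := by
  rw [heatKernel, Complex.norm_real, Real.norm_of_nonneg (by positivity)]

theorem norm_heatKernel_le {t : ℝ} (ht : 0 < t) (z : Space d) :
    ‖heatKernel t z‖ ≤ (4 * Real.pi * t) ^ (-(d : ℝ) / 2) := by
  rw [norm_heatKernel ht]
  refine mul_le_of_le_one_right (by positivity) (Real.exp_le_one_iff.2 ?_)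
  rw [neg_div]
  exact neg_nonpos.2 (by positivity)

theorem integral_gaussian_space {b : ℝ} (hb : 0 < b) :
    ∫ v : Space d, Real.exp (-b * ‖v‖ ^ 2) = (Real.pi / b) ^ ((d : ℝ) / 2) := by
  have := GaussianFourier.integral_rexp_neg_mul_sq_norm (V := Space d) hb
  simpa using this

theorem integrable_gaussian_space {b : ℝ} (hb : 0 < b) :
    Integrable (fun v : Space d => Real.exp (-b * ‖v‖ ^ 2)) volume := by
  -- A non-integrable function has integral `0` by convention, so the positive value of the Gaussian
  -- integral already forces integrability.
  by_contra h
  have h1 := integral_gaussian_space (d := d) hb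
  rw [integral_undef h] at h1
  have : 0 < (Real.pi / b) ^ ((d : ℝ) / 2) := by positivity
  linarith

theorem norm_heatKernel_eq {t : ℝ} (ht : 0 < t) : (fun z : Space d => ‖heatKernel t z‖) = fun z =>
    (4 * Real.pi * t) ^ (-(d : ℝ) / 2) * Real.exp (-(1 / (4 * t)) * ‖z‖ ^ 2) := by
  funext z
  rw [norm_heatKernel ht]
  congr 2
  ring

theorem integrable_heatKernel {t : ℝ} (ht : 0 < t) :
    Integrable (heatKernel t : Space d → ℂ) volume := by
  refine (integrable_norm_iff (measurable_heatKernel t).aestronglyMeasurable).1 ?_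
  rw [norm_heatKernel_eq ht]
  exact (integrable_gaussian_space (by positivity)).const_mul _

theorem lintegral_enorm_heatKernel {t : ℝ} (ht : 0 < t) :
    ∫⁻ z : Space d, ‖heatKernel t z‖ₑ ≤ ENNReal.ofReal 1 := by
  rw [← ofReal_integral_norm_eq_lintegral_enorm (integrable_heatKernel ht), norm_heatKernel_eq ht,
    integral_const_mul, integral_gaussian_space (by positivity)]
  refine ENNReal.ofReal_le_ofReal (le_of_eq ?_)
  rw [show Real.pi / (1 / (4 * t)) = 4 * Real.pi * t by field_simp, ← Real.rpow_add (by positivity)]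
  ring_nf
  simp

theorem fourier_heatKernel {t : ℝ} (ht : 0 < t) :
    𝓕 (heatKernel t : Space d → ℂ) = heatSymbol t := by
  funext ξ
  have hb : 0 < ((1 / (4 * t) : ℝ) : ℂ).re := by
    rw [Complex.ofReal_re]; positivity
  have h1 := fourier_gaussian_innerProductSpace (V := Space d) hb ξ
  have e : (heatKernel t : Space d → ℂ) = fun v =>
      (((4 * Real.pi * t) ^ (-(d : ℝ) / 2) : ℝ) : ℂ) •
        Complex.exp (-((1 / (4 * t) : ℝ) : ℂ) * (‖v‖ : ℂ) ^ 2) := by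
    funext v
    rw [heatKernel]
    push_cast
    rw [smul_eq_mul]
    congr 2
    ring
  have h2 : 𝓕 (fun v : Space d => (((4 * Real.pi * t) ^ (-(d : ℝ) / 2) : ℝ) : ℂ) •
        Complex.exp (-((1 / (4 * t) : ℝ) : ℂ) * (‖v‖ : ℂ) ^ 2)) ξ =
      (((4 * Real.pi * t) ^ (-(d : ℝ) / 2) : ℝ) : ℂ) •
        𝓕 (fun v : Space d => Complex.exp (-((1 / (4 * t) : ℝ) : ℂ) * (‖v‖ : ℂ) ^ 2)) ξ :=
    congrFun (VectorFourier.fourierIntegral_const_smul _ _ _ _ _) ξ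
  rw [e, h2, h1, heatSymbol]
  have h3 : ((Real.pi : ℂ) / ((1 / (4 * t) : ℝ) : ℂ)) ^ ((Module.finrank ℝ (Space d) : ℂ) / 2) =
      (((4 * Real.pi * t) ^ ((d : ℝ) / 2) : ℝ) : ℂ) := by
    rw [Complex.ofReal_cpow (by positivity)]
    congr 1
    · push_cast; field_simp
    · simp
  rw [h3, smul_eq_mul, ← mul_assoc, ← Complex.ofReal_mul, ← Real.rpow_add (by positivity),
    show -(d : ℝ) / 2 + d / 2 = 0 by ring, Real.rpow_zero]
  push_cast
  rw [one_mul]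
  congr 1
  field_simp

/-- The symbol is `y ↦ e^{cy}`, `c ≤ 0`, composed with `|ξ|²`. The exponential need not have
temperate growth on the whole line, but its derivatives are bounded on the open half-line `(-1, ∞)`,
which contains the range of `|ξ|²`. -/
theorem hasTemperateGrowth_heatSymbol {t : ℝ} (ht : 0 < t) :
    (heatSymbol t : Space d → ℂ).HasTemperateGrowth := by
  set c : ℝ := -(4 * Real.pi ^ 2 * t) with hc_def
  have hc : c ≤ 0 := by rw [hc_def]; exact neg_nonpos.2 (by positivity)
  have key : ((fun y : ℝ => Real.exp (c * y)) ∘ fun ξ : Space d => ‖ξ‖ ^ 2).HasTemperateGrowth := by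
    refine Function.HasTemperateGrowth.comp' (t := Ioi (-1)) ?_ isOpen_Ioi.uniqueDiffOn
      (by fun_prop) ?_ (by fun_prop)
    · rintro _ ⟨x, rfl⟩
      exact lt_of_lt_of_le (by norm_num) (by positivity : (0 : ℝ) ≤ ‖x‖ ^ 2)
    · intro N
      refine ⟨0, (max 1 |c|) ^ N * Real.exp (-c), by positivity, fun n hn x (hx : -1 < x) => ?_⟩
      rw [iteratedFDerivWithin_of_isOpen n isOpen_Ioi hx, norm_iteratedFDeriv_eq_norm_iteratedDeriv,
        iteratedDeriv_exp_const_mul, pow_zero, mul_one]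
      simp only [norm_mul, norm_pow, Real.norm_eq_abs, Real.abs_exp]
      have h1 : |c| ^ n ≤ max 1 |c| ^ N :=
        (pow_le_pow_left₀ (abs_nonneg _) (le_max_right _ _) n).trans
          (pow_le_pow_right₀ (le_max_left _ _) hn)
      have h2 : Real.exp (c * x) ≤ Real.exp (-c) := Real.exp_le_exp.2 (by nlinarith)
      gcongr
  exact Function.HasTemperateGrowth.comp (g := Complex.ofReal)
    Function.Complex.hasTemperateGrowth_ofReal key

/-! ### Commuting convolutions -/

/-- After Tonelli, the reflection `y ↦ x + z - y` of the intermediate point exchanges the arguments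
of the two kernels. -/
theorem lconv_lconv_comm_of_measurable {K L F : Space d → ℝ≥0∞} (hK : Measurable K)
    (hL : Measurable L) (hF : Measurable F) (x : Space d) :
    ∫⁻ y, ∫⁻ z, K (x - y) * (L (y - z) * F z) = ∫⁻ y, ∫⁻ z, L (x - y) * (K (y - z) * F z) := by
  have hm : ∀ {K L : Space d → ℝ≥0∞}, Measurable K → Measurable L →
      Measurable fun w : Space d × Space d => K (x - w.1) * (L (w.1 - w.2) * F w.2) :=
    fun hK hL => (hK.comp (measurable_const.sub measurable_fst)).mul
      ((hL.comp (measurable_fst.sub measurable_snd)).mul (hF.comp measurable_snd))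
  rw [lintegral_lintegral_swap (hm hK hL).aemeasurable,
    lintegral_lintegral_swap (f := fun y z => L (x - y) * (K (y - z) * F z))
      (hm hL hK).aemeasurable]
  refine lintegral_congr fun z => ?_
  rw [← lintegral_sub_left_eq_self (fun y => L (x - y) * (K (y - z) * F z)) (x + z)]
  refine lintegral_congr fun y => ?_
  rw [show x - (x + z - y) = y - z by abel, show x + z - y - z = x - y by abel]
  ring

/-- One finite iterated integral of absolute values suffices: the nonnegative version shows that the
other order is finite too, and then Fubini and the same reflection apply. -/
theorem conv_conv_comm {K L f : Space d → ℂ} (hK : Measurable K) (hL : Measurable L)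
    (hf : AEStronglyMeasurable f volume) (x : Space d)
    (hfin : lconv (fun z => ‖K z‖ₑ) (lconv (fun z => ‖L z‖ₑ) fun z => ‖f z‖ₑ) x < ∞) :
    conv K (conv L f) x = conv L (conv K f) x := by
  set g := hf.mk f with hg_def
  have hg : Measurable g := hf.stronglyMeasurable_mk.measurable
  have hfg : f =ᵐ[volume] g := hf.ae_eq_mk
  have hfge : (fun z => ‖f z‖ₑ) =ᵐ[volume] fun z => ‖g z‖ₑ :=
    hfg.mono fun z hz => by simp only [hz]
  rw [conv_congr_ae hfg, conv_congr_ae (K := K) hfg]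
  rw [lconv_congr_ae hfge] at hfin
  have hm : ∀ {K L : Space d → ℂ}, Measurable K → Measurable L →
      Measurable fun w : Space d × Space d => K (x - w.1) * (L (w.1 - w.2) * g w.2) :=
    fun hK hL => (hK.comp (measurable_const.sub measurable_fst)).mul
      ((hL.comp (measurable_fst.sub measurable_snd)).mul (hg.comp measurable_snd))
  have hfin1 : ∫⁻ y, ∫⁻ z, ‖K (x - y)‖ₑ * (‖L (y - z)‖ₑ * ‖g z‖ₑ) < ∞ := by
    refine lt_of_eq_of_lt (lintegral_congr fun y => ?_) hfin
    exact lintegral_const_mul' _ _ enorm_ne_top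
  have hfin2 : ∫⁻ y, ∫⁻ z, ‖L (x - y)‖ₑ * (‖K (y - z)‖ₑ * ‖g z‖ₑ) < ∞ := by
    rwa [← lconv_lconv_comm_of_measurable hK.enorm hL.enorm hg.enorm]
  have hint : ∀ {K L : Space d → ℂ}, Measurable K → Measurable L →
      ∫⁻ y, ∫⁻ z, ‖K (x - y)‖ₑ * (‖L (y - z)‖ₑ * ‖g z‖ₑ) < ∞ →
      Integrable (fun w : Space d × Space d => K (x - w.1) * (L (w.1 - w.2) * g w.2))
        (volume.prod volume) := by
    intro K L hK hL h
    refine ⟨(hm hK hL).aestronglyMeasurable, ?_⟩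
    rw [hasFiniteIntegral_iff_enorm, lintegral_prod _ (hm hK hL).enorm.aemeasurable]
    simpa only [enorm_mul] using h
  have hswap : ∀ {K L : Space d → ℂ}, Measurable K → Measurable L →
      ∫⁻ y, ∫⁻ z, ‖K (x - y)‖ₑ * (‖L (y - z)‖ₑ * ‖g z‖ₑ) < ∞ →
      conv K (conv L g) x = ∫ z, ∫ y, K (x - y) * (L (y - z) * g z) := by
    intro K L hK hL h
    refine Eq.trans ?_ (integral_integral_swap (hint hK hL h))
    refine integral_congr_ae (ae_of_all _ fun y => ?_)
    exact (integral_const_mul _ _).symm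
  rw [hswap hK hL hfin1, hswap hL hK hfin2]
  congr 1
  funext z
  rw [← integral_sub_left_eq_self (fun y => L (x - y) * (K (y - z) * g z)) volume (x + z)]
  congr 1
  funext y
  rw [show x - (x + z - y) = y - z by abel, show x + z - y - z = x - y by abel]
  ring

/-! ### The Fourier transform of the Riesz kernel -/

theorem integral_rpow_mul_exp_Ioi {a b : ℝ} (ha : 0 < a) (hb : 0 < b) :
    IntegrableOn (fun τ : ℝ => τ ^ (a - 1) * Real.exp (-(b * τ))) (Ioi 0) ∧
      ∫ τ in Ioi (0 : ℝ), τ ^ (a - 1) * Real.exp (-(b * τ)) = Real.Gamma a * b ^ (-a) := by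
  have h1 := Real.integral_rpow_mul_exp_neg_mul_Ioi ha hb
  have h2 : (1 / b) ^ a * Real.Gamma a = Real.Gamma a * b ^ (-a) := by
    rw [one_div, Real.inv_rpow hb.le, Real.rpow_neg hb.le, mul_comm]
  refine ⟨?_, h1.trans h2⟩
  by_contra h
  rw [integral_undef h, h2] at h1
  have := Real.Gamma_pos_of_pos ha
  have : 0 < Real.Gamma a * b ^ (-a) := by positivity
  linarith

/-- The substitution `τ ↦ 1/τ` reduces this to the Gamma integral. -/
theorem integral_rpow_mul_exp_inv_Ioi {a b : ℝ} (ha : 0 < a) (hb : 0 < b) :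
    IntegrableOn (fun τ : ℝ => τ ^ (-a - 1) * Real.exp (-(b / τ))) (Ioi 0) ∧
      ∫ τ in Ioi (0 : ℝ), τ ^ (-a - 1) * Real.exp (-(b / τ)) = Real.Gamma a * b ^ (-a) := by
  have h0 := (integral_rpow_mul_exp_Ioi ha hb).2
  have h1 := integral_comp_rpow_Ioi (fun τ : ℝ => τ ^ (a - 1) * Real.exp (-(b * τ)))
    (p := -1) (by norm_num)
  rw [h0] at h1
  have h2 : ∫ τ in Ioi (0 : ℝ), τ ^ (-a - 1) * Real.exp (-(b / τ)) = Real.Gamma a * b ^ (-a) := by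
    rw [← h1]
    refine setIntegral_congr_fun measurableSet_Ioi fun τ (hτ : 0 < τ) => ?_
    simp only [abs_neg, abs_one, one_mul, smul_eq_mul]
    rw [← mul_assoc, ← Real.rpow_mul hτ.le, ← Real.rpow_add hτ, Real.rpow_neg_one]
    congr 2
    ring
  refine ⟨?_, h2⟩
  by_contra h
  rw [integral_undef h] at h2
  have := Real.Gamma_pos_of_pos ha
  have : 0 < Real.Gamma a * b ^ (-a) := by positivity
  linarith

/-- Fubini for a weight written as a superposition of nonnegative kernels: positivity makes
integrability of `w h` enough for joint integrability. It is applied to both `|x - y|^{s-d}` and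
`|ξ|^{-s}`. -/
theorem integral_mul_eq_integral_integral {k : Space d → ℝ → ℝ} {w : Space d → ℝ} {h : Space d → ℂ}
    (hk : Measurable fun z : Space d × ℝ => k z.1 z.2) (hk0 : ∀ y, ∀ τ > 0, 0 ≤ k y τ)
    (hw : ∀ᵐ y, IntegrableOn (k y) (Ioi 0) ∧ ∫ τ in Ioi (0 : ℝ), k y τ = w y)
    (hh : AEStronglyMeasurable h volume) (hint : Integrable (fun y => (w y : ℂ) * h y) volume) :
    ∫ y, (w y : ℂ) * h y = ∫ τ in Ioi (0 : ℝ), ∫ y, (k y τ : ℂ) * h y := by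
  have hmeas : AEStronglyMeasurable (fun z : Space d × ℝ => (k z.1 z.2 : ℂ) * h z.1)
      (volume.prod (volume.restrict (Ioi (0 : ℝ)))) :=
    (Complex.measurable_ofReal.comp hk).aestronglyMeasurable.mul hh.comp_fst
  have hprod : Integrable (fun z : Space d × ℝ => (k z.1 z.2 : ℂ) * h z.1)
      (volume.prod (volume.restrict (Ioi (0 : ℝ)))) := by
    refine (integrable_prod_iff hmeas).2 ⟨?_, ?_⟩
    · filter_upwards [hw] with y hy
      exact (hy.1.ofReal (𝕜 := ℂ)).mul_const (h y)
    · refine hint.norm.congr ?_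
      filter_upwards [hw] with y hy
      have hwy : 0 ≤ w y := by
        rw [← hy.2]; exact setIntegral_nonneg measurableSet_Ioi fun τ hτ => hk0 y τ hτ
      rw [norm_mul, Complex.norm_real, Real.norm_of_nonneg hwy, ← hy.2, ← integral_mul_const]
      refine setIntegral_congr_fun measurableSet_Ioi fun τ hτ => ?_
      rw [norm_mul, Complex.norm_real, Real.norm_of_nonneg (hk0 y τ hτ)]
  rw [← integral_integral_swap (f := fun y τ => (k y τ : ℂ) * h y) hprod]
  refine integral_congr_ae ?_
  filter_upwards [hw] with y hy
  rw [integral_mul_const, ← hy.2]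
  congr 1
  exact integral_ofReal.symm

-- Self-adjointness of the Fourier transform against `e^{-π|v|²/τ + 2πi x·v}`, whose transform is a
-- Gaussian centred at `x`. The double transform of `ψ` is its reflection, undone by `v ↦ -v`.
open Real in
theorem integral_fourier_mul_gaussian (ψ : 𝓢(Space d, ℂ)) (x : Space d) {τ : ℝ} (hτ : 0 < τ) :
    ∫ y, ((Real.exp (-(Real.pi * ‖x - y‖ ^ 2 * τ)) : ℝ) : ℂ) * 𝓕 ψ y =
      ((τ ^ (-(d : ℝ) / 2) : ℝ) : ℂ) *
        ∫ ξ, ((Real.exp (-(Real.pi * ‖ξ‖ ^ 2 / τ)) : ℝ) : ℂ) * (𝐞 (-(inner ℝ ξ x)) • ψ ξ) := by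
  set b : ℝ := Real.pi / τ with hb_def
  have hb : 0 < b := by positivity
  have hbre : 0 < (b : ℂ).re := by rwa [Complex.ofReal_re]
  set h : Space d → ℂ := fun v =>
    Complex.exp (-(b : ℂ) * (‖v‖ : ℂ) ^ 2 + 2 * Real.pi * Complex.I * (inner ℝ x v : ℝ)) with hh_def
  have hF : ∀ y, 𝓕 h y = ((τ ^ ((d : ℝ) / 2) : ℝ) : ℂ) *
      ((Real.exp (-(Real.pi * ‖x - y‖ ^ 2 * τ)) : ℝ) : ℂ) := by
    intro y
    have h3 : ((Real.pi : ℂ) / (b : ℂ)) ^ ((Module.finrank ℝ (Space d) : ℂ) / 2) =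
        ((τ ^ ((d : ℝ) / 2) : ℝ) : ℂ) := by
      rw [Complex.ofReal_cpow hτ.le, hb_def]
      congr 1
      · push_cast; field_simp
      · simp
    rw [hh_def, fourier_gaussian_innerProductSpace' hbre x y, h3]
    congr 1
    rw [hb_def]
    push_cast
    congr 1
    have : (Real.pi : ℂ) ≠ 0 := by exact_mod_cast Real.pi_ne_zero
    have : (τ : ℂ) ≠ 0 := by exact_mod_cast hτ.ne'
    field_simp
  have hnorm : ∀ v, ‖h v‖ = Real.exp (-b * ‖v‖ ^ 2) := by
    intro v
    rw [hh_def, Complex.norm_exp]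
    congr 1
    simp [← Complex.ofReal_pow]
  have hhm : Continuous h := by
    rw [hh_def]; fun_prop
  have hh : Integrable h volume := by
    refine (integrable_norm_iff hhm.aestronglyMeasurable).1 ?_
    simp_rw [hnorm]
    exact integrable_gaussian_space hb
  have hFF : ∀ v, 𝓕 (⇑(𝓕 ψ : 𝓢(Space d, ℂ))) v = ψ (-v) := by
    intro v
    have h1 : 𝓕⁻ (𝓕 ψ : 𝓢(Space d, ℂ)) (-v) = ψ (-v) := by
      rw [FourierTransform.fourierInv_fourier_eq]
    rw [SchwartzMap.fourierInv_coe, Real.fourierInv_eq_fourier_neg, neg_neg] at h1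
    exact h1
  have key := integral_fourier_mul_eq_of_integrable (𝓕 ψ).integrable hh
  simp_rw [hFF, hF] at key
  have e1 : ∫ v, ψ (-v) * h v =
      ∫ ξ, ((Real.exp (-(Real.pi * ‖ξ‖ ^ 2 / τ)) : ℝ) : ℂ) * (𝐞 (-(inner ℝ ξ x)) • ψ ξ) := by
    rw [← integral_neg_eq_self (fun v => ψ (-v) * h v)]
    refine integral_congr_ae (ae_of_all _ fun ξ => ?_)
    simp only [neg_neg]
    rw [Circle.smul_def, Real.fourierChar_apply, smul_eq_mul, ← mul_assoc, mul_comm, hh_def]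
    congr 1
    push_cast
    rw [← Complex.exp_add]
    congr 1
    rw [norm_neg, inner_neg_right, real_inner_comm, hb_def]
    push_cast
    ring
  rw [e1] at key
  rw [key, ← integral_const_mul]
  refine integral_congr_ae (ae_of_all _ fun y => ?_)
  simp only
  have : ((τ ^ (-(d : ℝ) / 2) : ℝ) : ℂ) * ((τ ^ ((d : ℝ) / 2) : ℝ) : ℂ) = 1 := by
    rw [← Complex.ofReal_mul, ← Real.rpow_add hτ, show -(d : ℝ) / 2 + d / 2 = 0 by ring,
      Real.rpow_zero, Complex.ofReal_one]
  calc _ = (((τ ^ (-(d : ℝ) / 2) : ℝ) : ℂ) * ((τ ^ ((d : ℝ) / 2) : ℝ) : ℂ)) *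
        (((Real.exp (-(Real.pi * ‖x - y‖ ^ 2 * τ)) : ℝ) : ℂ) * 𝓕 ψ y) := by rw [this, one_mul]
    _ = _ := by ring

/-- The kernel of the Riesz potential, as a complex valued function. -/
noncomputable def rieszKernelC (s : ℝ) (z : Space d) : ℂ := ((‖z‖ ^ (s - d) : ℝ) : ℂ)

theorem measurable_rieszKernelC (s : ℝ) : Measurable (rieszKernelC s : Space d → ℂ) := by
  unfold rieszKernelC; fun_prop

theorem enorm_rieszKernelC (s : ℝ) (z : Space d) : ‖rieszKernelC s z‖ₑ = rieszKernel s z := by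
  rw [← ofReal_norm, rieszKernelC, Complex.norm_real, Real.norm_of_nonneg (by positivity),
    rieszKernel]

theorem rieszPotential_eq_conv {s : ℝ} (hs : s ≠ 0) (f : Space d → ℂ) :
    rieszPotential s f = conv (rieszKernelC s) f := by
  rw [rieszPotential, if_neg hs]
  funext x
  refine integral_congr_ae (ae_of_all _ fun y => ?_)
  simp only
  rw [rieszKernelC, show s - (d : ℝ) = -((d : ℝ) - s) by ring, Real.rpow_neg (norm_nonneg _),
    Complex.ofReal_inv, div_eq_mul_inv, mul_comm]

theorem integrable_rieszKernelC_mul (hd : 1 ≤ d) {s : ℝ} (hs : 0 < s) (hsd : s < d)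
    (ψ : 𝓢(Space d, ℂ)) (x : Space d) :
    Integrable (fun y => rieszKernelC s (x - y) * ψ y) volume := by
  refine ⟨(((measurable_rieszKernelC s).comp
    (measurable_const.sub measurable_id)).aestronglyMeasurable).mul
    ψ.continuous.aestronglyMeasurable, ?_⟩
  rw [hasFiniteIntegral_iff_enorm]
  obtain ⟨c, hc, h⟩ := lintegral_ball_rieszKernel_le hd hs
  obtain ⟨B, hB⟩ := exists_norm_le_schwartz ψ
  have hle : ∀ y, ‖rieszKernelC s (x - y) * ψ y‖ₑ ≤
      (Metric.ball (0 : Space d) 1).indicator (rieszKernel s) (x - y) * ENNReal.ofReal B +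
        ‖ψ y‖ₑ := by
    intro y
    rw [enorm_mul, enorm_rieszKernelC]
    by_cases hy : x - y ∈ Metric.ball (0 : Space d) 1
    · rw [indicator_of_mem hy]
      refine le_add_right ?_
      gcongr
      rw [← ofReal_norm]
      exact ENNReal.ofReal_le_ofReal (hB y)
    · rw [indicator_of_notMem hy, zero_mul, zero_add]
      refine mul_le_of_le_one_left' ?_
      rw [rieszKernel, ENNReal.ofReal_le_one]
      have : 1 ≤ ‖x - y‖ := by simpa using hy
      exact Real.rpow_le_one_of_one_le_of_nonpos this (by linarith)
  have hm : Measurable fun y => (Metric.ball (0 : Space d) 1).indicator (rieszKernel s) (x - y) :=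
    ((measurable_rieszKernel s).indicator measurableSet_ball).comp
      (measurable_const.sub measurable_id)
  calc _ ≤ _ := lintegral_mono hle
    _ = (∫⁻ y, (Metric.ball (0 : Space d) 1).indicator (rieszKernel s) (x - y)) *
        ENNReal.ofReal B + ∫⁻ y, ‖ψ y‖ₑ := by
        rw [lintegral_add_right _ ψ.continuous.measurable.enorm, lintegral_mul_const _ hm]
    _ < ∞ := by
        rw [lintegral_sub_left_eq_self]
        exact ENNReal.add_lt_top.2 ⟨ENNReal.mul_lt_top ((h 1 one_pos).trans_lt
          ENNReal.ofReal_lt_top) ENNReal.ofReal_lt_top, hasFiniteIntegral_iff_enorm.1 ψ.integrable.2⟩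

/-- The constant `c` in `Λ^s I_s g = c g`. -/
noncomputable def rieszConst (d : ℕ) (s : ℝ) : ℝ :=
  Real.Gamma (s / 2) * Real.pi ^ (-(s / 2)) * (2 * Real.pi) ^ s /
    (Real.Gamma (((d : ℝ) - s) / 2) * Real.pi ^ (-(((d : ℝ) - s) / 2)))

-- With `a = (d-s)/2`, both `Γ(a) π^{-a} |z|^{s-d}` and `Γ(s/2) π^{-s/2} |ξ|^{-s}` are integrals of
-- Gaussians over the scale `τ`. At each `τ` the Gaussian identity matches the two integrands,
-- because `a - 1 - d/2 = -s/2 - 1`. The quotient of the normalisations, with the factor `(2π)^s`,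
-- is `rieszConst`.
open Real in
theorem conv_rieszKernelC_fourier (hd : 1 ≤ d) {s : ℝ} (hs : 0 < s) (hsd : s < d)
    {φ ψ : 𝓢(Space d, ℂ)}
    (hψ : ∀ ξ, ψ ξ = (((2 * Real.pi * ‖ξ‖) ^ s : ℝ) : ℂ) * φ ξ) (x : Space d) :
    conv (rieszKernelC s) (𝓕 ψ : 𝓢(Space d, ℂ)) x = (rieszConst d s : ℂ) * 𝓕 φ x := by
  have : Nontrivial (Space d) := by
    have : Nonempty (Fin d) := ⟨⟨0, hd⟩⟩
    infer_instance
  set a : ℝ := ((d : ℝ) - s) / 2 with ha_def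
  have ha : 0 < a := by rw [ha_def]; linarith
  have hs2 : 0 < s / 2 := by linarith
  set C1 : ℝ := Real.Gamma a * Real.pi ^ (-a) with hC1
  set C2 : ℝ := Real.Gamma (s / 2) * Real.pi ^ (-(s / 2)) with hC2
  have hC1pos : 0 < C1 := mul_pos (Real.Gamma_pos_of_pos ha) (by positivity)
  have F1 : ∫ y, ((C1 * ‖x - y‖ ^ (s - d) : ℝ) : ℂ) * 𝓕 ψ y = ∫ τ in Ioi (0 : ℝ),
      ∫ y, ((τ ^ (a - 1) * Real.exp (-(Real.pi * ‖x - y‖ ^ 2 * τ)) : ℝ) : ℂ) * 𝓕 ψ y := by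
    refine integral_mul_eq_integral_integral
      (k := fun y τ => τ ^ (a - 1) * Real.exp (-(Real.pi * ‖x - y‖ ^ 2 * τ)))
      (w := fun y => C1 * ‖x - y‖ ^ (s - d))
      (by fun_prop) (fun y τ hτ => by positivity) ?_
      (𝓕 ψ).continuous.aestronglyMeasurable ?_
    · filter_upwards [Measure.ae_ne volume x] with y hy
      have hxy : 0 < ‖x - y‖ := norm_pos_iff.2 (sub_ne_zero.2 hy.symm)
      have hb : 0 < Real.pi * ‖x - y‖ ^ 2 := by positivity
      obtain ⟨i1, i2⟩ := integral_rpow_mul_exp_Ioi ha hb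
      refine ⟨i1, i2.trans ?_⟩
      rw [Real.mul_rpow (by positivity) (by positivity), ← Real.rpow_natCast, ← Real.rpow_mul hxy.le,
        hC1, ha_def, mul_assoc]
      congr 3
      push_cast; ring
    · refine ((integrable_rieszKernelC_mul hd hs hsd (𝓕 ψ) x).const_mul (C1 : ℂ)).congr
        (ae_of_all _ fun y => ?_)
      simp only [rieszKernelC]
      push_cast; ring
  have hchar : Integrable (fun ξ => (𝐞 (-(inner ℝ ξ x)) • φ ξ : ℂ)) volume :=
    (fourierIntegral_convergent_iff x).2 φ.integrable
  -- Off the origin the factor `|ξ|^s` in `ψ` cancels the singularity, so the integrability required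
  -- for Fubini comes from `φ` alone.
  have hval : ∀ᵐ ξ : Space d, ((C2 * ‖ξ‖ ^ (-s) : ℝ) : ℂ) * (𝐞 (-(inner ℝ ξ x)) • ψ ξ) =
      ((C2 * (2 * Real.pi) ^ s : ℝ) : ℂ) * (𝐞 (-(inner ℝ ξ x)) • φ ξ) := by
    filter_upwards [Measure.ae_ne volume (0 : Space d)] with ξ hξ
    have hξ0 : 0 < ‖ξ‖ := norm_pos_iff.2 hξ
    have e : C2 * (2 * Real.pi) ^ s = C2 * ‖ξ‖ ^ (-s) * (2 * Real.pi * ‖ξ‖) ^ s := by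
      rw [Real.mul_rpow (by positivity) hξ0.le, Real.rpow_neg hξ0.le]
      have : ‖ξ‖ ^ s ≠ 0 := by positivity
      field_simp
    rw [hψ, e, Circle.smul_def, Circle.smul_def, smul_eq_mul, smul_eq_mul,
      Complex.ofReal_mul (C2 * _)]
    ring
  have F2 : ∫ ξ, ((C2 * ‖ξ‖ ^ (-s) : ℝ) : ℂ) * (𝐞 (-(inner ℝ ξ x)) • ψ ξ) = ∫ τ in Ioi (0 : ℝ),
      ∫ ξ, ((τ ^ (-(s / 2) - 1) * Real.exp (-(Real.pi * ‖ξ‖ ^ 2 / τ)) : ℝ) : ℂ) *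
        (𝐞 (-(inner ℝ ξ x)) • ψ ξ) := by
    refine integral_mul_eq_integral_integral
      (k := fun ξ τ => τ ^ (-(s / 2) - 1) * Real.exp (-(Real.pi * ‖ξ‖ ^ 2 / τ)))
      (w := fun ξ => C2 * ‖ξ‖ ^ (-s))
      (by fun_prop) (fun y τ hτ => by positivity) ?_
      ((fourierIntegral_convergent_iff x).2 ψ.integrable).1 ?_
    · filter_upwards [Measure.ae_ne volume (0 : Space d)] with ξ hξ
      have hξ0 : 0 < ‖ξ‖ := norm_pos_iff.2 hξ
      have hb : 0 < Real.pi * ‖ξ‖ ^ 2 := by positivity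
      obtain ⟨i1, i2⟩ := integral_rpow_mul_exp_inv_Ioi hs2 hb
      refine ⟨i1, i2.trans ?_⟩
      rw [Real.mul_rpow (by positivity) (by positivity), ← Real.rpow_natCast, ← Real.rpow_mul hξ0.le,
        hC2, mul_assoc]
      congr 3
      push_cast; ring
    · exact (hchar.const_mul _).congr (hval.mono fun ξ hξ => hξ.symm)
  have e1 : ∫ y, ((C1 * ‖x - y‖ ^ (s - d) : ℝ) : ℂ) * 𝓕 ψ y =
      (C1 : ℂ) * conv (rieszKernelC s) (𝓕 ψ : 𝓢(Space d, ℂ)) x := by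
    rw [conv, ← integral_const_mul]
    refine integral_congr_ae (ae_of_all _ fun y => ?_)
    simp only [rieszKernelC]
    push_cast; ring
  have e2 : ∫ ξ, ((C2 * ‖ξ‖ ^ (-s) : ℝ) : ℂ) * (𝐞 (-(inner ℝ ξ x)) • ψ ξ) =
      ((C2 * (2 * Real.pi) ^ s : ℝ) : ℂ) * 𝓕 φ x := by
    rw [integral_congr_ae hval, integral_const_mul, SchwartzMap.fourier_coe, fourier_eq]
  have e3 : ∀ τ ∈ Ioi (0 : ℝ),
      ∫ y, ((τ ^ (a - 1) * Real.exp (-(Real.pi * ‖x - y‖ ^ 2 * τ)) : ℝ) : ℂ) * 𝓕 ψ y =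
      ∫ ξ, ((τ ^ (-(s / 2) - 1) * Real.exp (-(Real.pi * ‖ξ‖ ^ 2 / τ)) : ℝ) : ℂ) *
        (𝐞 (-(inner ℝ ξ x)) • ψ ξ) := by
    intro τ (hτ : 0 < τ)
    have h := integral_fourier_mul_gaussian ψ x hτ
    have l : ∫ y, ((τ ^ (a - 1) * Real.exp (-(Real.pi * ‖x - y‖ ^ 2 * τ)) : ℝ) : ℂ) * 𝓕 ψ y =
        ((τ ^ (a - 1) : ℝ) : ℂ) *
          ∫ y, ((Real.exp (-(Real.pi * ‖x - y‖ ^ 2 * τ)) : ℝ) : ℂ) * 𝓕 ψ y := by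
      rw [← integral_const_mul]
      refine integral_congr_ae (ae_of_all _ fun y => ?_)
      simp only
      rw [Complex.ofReal_mul, mul_assoc]
    rw [l, h, ← mul_assoc, ← Complex.ofReal_mul, ← Real.rpow_add hτ,
      show a - 1 + -(d : ℝ) / 2 = -(s / 2) - 1 by rw [ha_def]; ring, ← integral_const_mul]
    refine integral_congr_ae (ae_of_all _ fun y => ?_)
    simp only
    rw [Complex.ofReal_mul, mul_assoc]
  have key : (C1 : ℂ) * conv (rieszKernelC s) (𝓕 ψ : 𝓢(Space d, ℂ)) x =
      ((C2 * (2 * Real.pi) ^ s : ℝ) : ℂ) * 𝓕 φ x := by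
    rw [← e1, F1, setIntegral_congr_fun measurableSet_Ioi e3, ← F2, e2]
  have hC1c : (C1 : ℂ) ≠ 0 := by exact_mod_cast hC1pos.ne'
  rw [rieszConst, Complex.ofReal_div, div_mul_eq_mul_div, eq_div_iff hC1c, mul_comm, key]

/-- `Λ^s I_s g = c g` for `g` in `L^{p,∞}`. -/
theorem isFracLaplacian_rieszPotential (hd : 1 ≤ d) {s p W : ℝ} (hs : 0 < s) (hp : 1 < p)
    (hsp : s < d / p) (hW : 0 < W) {g : Space d → ℂ} (hg : AEStronglyMeasurable g volume)
    (hgw : WeakTypeBound p W (fun x => ‖g x‖ₑ)) {u v : 𝓢'(Space d, ℂ)}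
    (hu : Represents (conv (rieszKernelC s) g) u)
    (hv : Represents (fun x => (rieszConst d s : ℂ) * g x) v) : IsFracLaplacian s u v := by
  have hd0 : (0 : ℝ) < d := by exact_mod_cast hd
  have hp0 : 0 < p := by linarith
  have hsd : s < d := hsp.trans_le (div_le_self hd0.le hp.le)
  obtain ⟨C, hC, hHLS⟩ := exists_weakTypeBound_lconv_rieszKernel hd hs hp hsp rfl
  have hw := hHLS _ W hg.enorm hW hgw
  have hdp : 0 < (d : ℝ) / p - s := by linarith
  have hr : 1 < d / ((d : ℝ) / p - s) := by
    rw [one_lt_div hdp]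
    have := div_lt_self hd0 hp
    linarith
  intro φ ψ _ hψ
  change v (𝓕 φ) = u (𝓕 ψ)
  rw [(hu.2 _).2, (hv.2 _).2]
  obtain ⟨B, hB⟩ := exists_norm_le_schwartz (𝓕 ψ)
  have hfin : ∫⁻ x, ‖𝓕 ψ x‖ₑ < ∞ := hasFiniteIntegral_iff_enorm.1 (𝓕 ψ).integrable.2
  have hmeas : AEStronglyMeasurable
      (fun z : Space d × Space d => 𝓕 ψ z.1 * (rieszKernelC s (z.1 - z.2) * g z.2))
      (volume.prod volume) :=
    ((𝓕 ψ).continuous.comp continuous_fst).aestronglyMeasurable.mul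
      (((measurable_rieszKernelC s).comp
        (measurable_fst.sub measurable_snd)).aestronglyMeasurable.mul hg.comp_snd)
  -- `I_s |g|` is of weak type with an exponent larger than `1`, so its pairing with the Schwartz
  -- function `𝓕 ψ` is finite. Fubini then moves the Riesz kernel onto `𝓕 ψ`.
  have hprod : Integrable
      (fun z : Space d × Space d => 𝓕 ψ z.1 * (rieszKernelC s (z.1 - z.2) * g z.2))
      (volume.prod volume) := by
    refine ⟨hmeas, ?_⟩
    rw [hasFiniteIntegral_iff_enorm, lintegral_prod _ hmeas.enorm]
    have e : ∀ x, ∫⁻ y, ‖𝓕 ψ x * (rieszKernelC s (x - y) * g y)‖ₑ =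
        ‖𝓕 ψ x‖ₑ * lconv (rieszKernel s) (fun y => ‖g y‖ₑ) x := by
      intro x
      simp_rw [enorm_mul, enorm_rieszKernelC]
      exact lintegral_const_mul' _ _ enorm_ne_top
    simp_rw [e]
    refine (hw.lintegral_mul_le (measurable_lconv (measurable_rieszKernel s) hg.enorm).aemeasurable
      hr (by positivity) (𝓕 ψ).continuous.measurable.enorm.aemeasurable
      (A := (∫⁻ x, ‖𝓕 ψ x‖ₑ).toReal + 1) (B := max B 1) (by positivity) (by positivity) ?_
      fun x => ?_).trans_lt ENNReal.ofReal_lt_top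
    · refine (ENNReal.ofReal_toReal hfin.ne).ge.trans (ENNReal.ofReal_le_ofReal (by linarith))
    · rw [← ofReal_norm]
      exact ENNReal.ofReal_le_ofReal ((hB x).trans (le_max_left _ _))
  have e1 : ∫ x, 𝓕 ψ x * conv (rieszKernelC s) g x =
      ∫ x, ∫ y, 𝓕 ψ x * (rieszKernelC s (x - y) * g y) :=
    integral_congr_ae (ae_of_all _ fun x => (integral_const_mul _ _).symm)
  rw [e1, integral_integral_swap
    (f := fun x y => 𝓕 ψ x * (rieszKernelC s (x - y) * g y)) hprod]
  refine integral_congr_ae (ae_of_all _ fun y => ?_)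
  simp only
  have h := conv_rieszKernelC_fourier hd hs hsd hψ y
  calc 𝓕 φ y * ((rieszConst d s : ℂ) * g y) = conv (rieszKernelC s) (𝓕 ψ : 𝓢(Space d, ℂ)) y * g y := by rw [h]; ring
    _ = _ := by
      rw [conv, ← integral_mul_const]
      refine integral_congr_ae (ae_of_all _ fun x => ?_)
      simp only [rieszKernelC, norm_sub_rev y x]
      ring

/-! ### Dilations of kernels -/

/-- The `L^1`-normalised dilation `a^d K(a x)`. -/
noncomputable def dilate (a : ℝ) (K : Space d → ℂ) (x : Space d) : ℂ :=
  ((a ^ (d : ℝ) : ℝ) : ℂ) * K (a • x)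

theorem measurable_dilate {a : ℝ} {K : Space d → ℂ} (hK : Measurable K) :
    Measurable (dilate a K) :=
  (hK.comp (measurable_id.const_smul a)).const_mul _

theorem integrable_dilate {a : ℝ} (ha : 0 < a) {K : Space d → ℂ} (hK : Integrable K volume) :
    Integrable (dilate a K) volume :=
  (hK.comp_smul ha.ne').const_mul _

theorem norm_dilate_le {a B : ℝ} (ha : 0 < a) {K : Space d → ℂ} (hK : ∀ x, ‖K x‖ ≤ B)
    (x : Space d) : ‖dilate a K x‖ ≤ a ^ (d : ℝ) * B := by
  rw [dilate, norm_mul, Complex.norm_real, Real.norm_of_nonneg (by positivity)]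
  gcongr
  exact hK _

theorem integral_norm_dilate {a : ℝ} (ha : 0 < a) (K : Space d → ℂ) :
    ∫ x, ‖dilate a K x‖ = ∫ x, ‖K x‖ := by
  simp_rw [dilate, norm_mul, Complex.norm_real, Real.norm_of_nonneg (Real.rpow_nonneg ha.le _)]
  rw [integral_const_mul, Measure.integral_comp_smul volume (fun x => ‖K x‖) a, smul_eq_mul,
    ← mul_assoc, abs_of_nonneg (by positivity)]
  simp only [finrank_euclideanSpace, Fintype.card_fin, Real.rpow_natCast]
  rw [mul_inv_cancel₀ (by positivity), one_mul]

theorem fourier_dilate {a : ℝ} (ha : 0 < a) (K : Space d → ℂ) (ξ : Space d) :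
    𝓕 (dilate a K) ξ = 𝓕 K (a⁻¹ • ξ) := by
  rw [Real.fourier_eq, Real.fourier_eq]
  have e : ∀ v : Space d, Real.fourierChar (-(inner ℝ v ξ)) • dilate a K v =
      ((a ^ (d : ℝ) : ℝ) : ℂ) • (fun w : Space d =>
        Real.fourierChar (-(inner ℝ w (a⁻¹ • ξ))) • K w) (a • v) := by
    intro v
    have h1 : (inner ℝ (a • v) (a⁻¹ • ξ) : ℝ) = inner ℝ v ξ := by
      rw [real_inner_smul_left, real_inner_smul_right, mul_inv_cancel_left₀ ha.ne']
    simp only [h1]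
    rw [dilate, Circle.smul_def, Circle.smul_def, smul_eq_mul, smul_eq_mul, smul_eq_mul]
    ring
  rw [integral_congr_ae (ae_of_all _ e), integral_smul, Measure.integral_comp_smul volume
    (fun w : Space d => Real.fourierChar (-(inner ℝ w (a⁻¹ • ξ))) • K w) a, smul_eq_mul,
    Complex.real_smul, ← mul_assoc, abs_of_nonneg (by positivity), ← Complex.ofReal_mul]
  simp only [finrank_euclideanSpace, Fintype.card_fin, Real.rpow_natCast]
  rw [mul_inv_cancel₀ (by positivity), Complex.ofReal_one, one_mul]

/-! ### Littlewood-Paley symbols -/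

theorem hasCompactSupport_of_eq_zero {E : Type*} [Zero E] {f : Space d → E} {R : ℝ}
    (h : ∀ ξ, R ≤ ‖ξ‖ → f ξ = 0) : HasCompactSupport f := by
  refine HasCompactSupport.intro (isCompact_closedBall (0 : Space d) R) fun ξ hξ => h ξ ?_
  have : R < ‖ξ‖ := by simpa using hξ
  exact this.le

theorem exists_schwartz_fourier_eq {m : Space d → ℂ} {R : ℝ} (hm : ContDiff ℝ (⊤ : ℕ∞) m)
    (h : ∀ ξ, R ≤ ‖ξ‖ → m ξ = 0) : ∃ K : 𝓢(Space d, ℂ), 𝓕 (K : Space d → ℂ) = m := by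
  have hc : HasCompactSupport m := hasCompactSupport_of_eq_zero h
  refine ⟨𝓕⁻ (hc.toSchwartzMap hm), ?_⟩
  rw [← SchwartzMap.fourier_coe, FourierTransform.fourier_fourierInv_eq]
  rfl

/-- The symbol `(2π|ξ|)^{-s} (χ(ξ/2) - χ(ξ))`. -/
noncomputable def dyadicSymbol (s : ℝ) (χ : Space d → ℝ) (ξ : Space d) : ℂ :=
  (((2 * Real.pi * ‖ξ‖) ^ (-s) * (χ ((2 : ℝ)⁻¹ • ξ) - χ ξ) : ℝ) : ℂ)

namespace IsLittlewoodPaleyCutoff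

variable {χ : Space d → ℝ}

theorem dyadicSymbol_eq_zero_of_le (hχ : IsLittlewoodPaleyCutoff χ) (s : ℝ) {ξ : Space d}
    (h : ‖ξ‖ ≤ 1) : dyadicSymbol s χ ξ = 0 := by
  rw [dyadicSymbol, hχ.eq_one ξ h, hχ.eq_one ((2 : ℝ)⁻¹ • ξ) (by
    rw [norm_smul, Real.norm_of_nonneg (by norm_num)]; linarith [norm_nonneg ξ])]
  simp

theorem dyadicSymbol_eq_zero_of_ge (hχ : IsLittlewoodPaleyCutoff χ) (s : ℝ) (ξ : Space d)
    (h : 4 ≤ ‖ξ‖) : dyadicSymbol s χ ξ = 0 := by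
  rw [dyadicSymbol, hχ.eq_zero ξ (by linarith), hχ.eq_zero ((2 : ℝ)⁻¹ • ξ) (by
    rw [norm_smul, Real.norm_of_nonneg (by norm_num)]; linarith)]
  simp

/-- The difference of cutoffs vanishes on the unit ball, which hides the singularity of `|ξ|^{-s}`;
away from the origin the norm is smooth. -/
theorem contDiff_dyadicSymbol (hχ : IsLittlewoodPaleyCutoff χ) (s : ℝ) :
    ContDiff ℝ (⊤ : ℕ∞) (dyadicSymbol s χ) := by
  rw [contDiff_iff_contDiffAt]
  intro ξ
  rcases lt_or_ge ‖ξ‖ 1 with h | h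
  · have : dyadicSymbol s χ =ᶠ[𝓝 ξ] fun _ => 0 := by
      filter_upwards [(isOpen_lt continuous_norm continuous_const).mem_nhds h] with y hy
      exact hχ.dyadicSymbol_eq_zero_of_le s (le_of_lt hy)
    exact contDiffAt_const.congr_of_eventuallyEq this
  · have hξ : ξ ≠ 0 := by
      rintro rfl
      simp at h
      linarith
    have h1 : ContDiffAt ℝ (⊤ : ℕ∞) (fun ξ : Space d => (2 * Real.pi * ‖ξ‖) ^ (-s)) ξ := by
      refine ContDiffAt.rpow_const_of_ne (contDiffAt_const.mul (contDiffAt_norm ℝ hξ)) ?_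
      have := norm_pos_iff.2 hξ
      positivity
    have h2 : ContDiffAt ℝ (⊤ : ℕ∞) (fun ξ : Space d => χ ((2 : ℝ)⁻¹ • ξ) - χ ξ) ξ :=
      ((hχ.smooth.comp (contDiff_const_smul _)).sub hχ.smooth).contDiffAt
    exact Complex.ofRealCLM.contDiff.contDiffAt.comp ξ (h1.mul h2)

theorem contDiff_ofReal (hχ : IsLittlewoodPaleyCutoff χ) :
    ContDiff ℝ (⊤ : ℕ∞) (fun ξ => ((χ ξ : ℝ) : ℂ)) :=
  Complex.ofRealCLM.contDiff.comp hχ.smooth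

theorem ofReal_eq_zero (hχ : IsLittlewoodPaleyCutoff χ) (ξ : Space d) (h : 2 ≤ ‖ξ‖) :
    ((χ ξ : ℝ) : ℂ) = 0 := by
  rw [hχ.eq_zero ξ h, Complex.ofReal_zero]

end IsLittlewoodPaleyCutoff

theorem hasTemperateGrowth_comp_smul {m : Space d → ℂ} {R : ℝ} (hm : ContDiff ℝ (⊤ : ℕ∞) m)
    (h : ∀ ξ, R ≤ ‖ξ‖ → m ξ = 0) (a : ℝ) :
    (fun ξ => m (a • ξ)).HasTemperateGrowth := by
  have h1 : m.HasTemperateGrowth := (hasCompactSupport_of_eq_zero h).hasTemperateGrowth hm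
  exact h1.comp (a • ContinuousLinearMap.id ℝ (Space d)).hasTemperateGrowth

/-- `Δ_j u` is a multiplier transformation of `Λ^s u`. -/
theorem IsFracLaplacian.dyadicBlock_eq {s : ℝ} {u v : 𝓢'(Space d, ℂ)} (h : IsFracLaplacian s u v)
    {χ : Space d → ℝ} (hχ : IsLittlewoodPaleyCutoff χ) (j : ℤ) :
    dyadicBlock χ j u = TemperedDistribution.fourierMultiplierCLM ℂ
      (fun ξ => ((((2 : ℝ) ^ j) ^ (-s) : ℝ) : ℂ) * dyadicSymbol s χ (((2 : ℝ) ^ j)⁻¹ • ξ)) v := by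
  set a : ℝ := (2 : ℝ) ^ j with ha_def
  have ha : 0 < a := by positivity
  have e0 : (2 : ℝ) ^ (-j) = a⁻¹ := by rw [zpow_neg]
  have e1 : (2 : ℝ) ^ (-(j + 1)) = 2⁻¹ * a⁻¹ := by
    rw [zpow_neg, zpow_add₀ (by norm_num), zpow_one, mul_inv, mul_comm]
  have t0 := hasTemperateGrowth_comp_smul hχ.contDiff_ofReal hχ.ofReal_eq_zero ((2 : ℝ) ^ (-j))
  have t1 := hasTemperateGrowth_comp_smul hχ.contDiff_ofReal hχ.ofReal_eq_zero
    ((2 : ℝ) ^ (-(j + 1)))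
  have t2 : (fun ξ => (((a ^ (-s) : ℝ) : ℂ)) * dyadicSymbol s χ (a⁻¹ • ξ)).HasTemperateGrowth :=
    (Function.HasTemperateGrowth.const _).mul (hasTemperateGrowth_comp_smul
      (hχ.contDiff_dyadicSymbol s) (hχ.dyadicSymbol_eq_zero_of_ge s) a⁻¹)
  ext φ
  set θ : 𝓢(Space d, ℂ) := 𝓕⁻ φ with hθ
  change (𝓕 u) (SchwartzMap.smulLeftCLM ℂ _ θ) - (𝓕 u) (SchwartzMap.smulLeftCLM ℂ _ θ) =
    (𝓕 v) (SchwartzMap.smulLeftCLM ℂ _ θ)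
  rw [← map_sub]
  symm
  -- The defining identity of `Λ^s` is applied to the rescaled dyadic symbol times `θ`, which
  -- vanishes on the ball of radius `2^j`, with `ψ` the difference of the two cutoffs times `θ`.
  refine h _ _ ?_ fun ξ => ?_
  · rw [SchwartzMap.smulLeftCLM_apply t2, notMem_tsupport_iff_eventuallyEq]
    have hball : {ξ : Space d | ‖ξ‖ < a} ∈ 𝓝 (0 : Space d) :=
      (isOpen_lt continuous_norm continuous_const).mem_nhds (by simpa using ha)
    filter_upwards [hball] with ξ hξ
    have hξ : ‖ξ‖ < a := hξ
    rw [hχ.dyadicSymbol_eq_zero_of_le s, mul_zero, zero_smul]; · rfl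
    rw [norm_smul, norm_inv, Real.norm_of_nonneg ha.le, inv_mul_le_iff₀ ha]
    linarith
  · rw [SchwartzMap.smulLeftCLM_apply_apply t2]
    change SchwartzMap.smulLeftCLM ℂ _ θ ξ - SchwartzMap.smulLeftCLM ℂ _ θ ξ = _
    rw [SchwartzMap.smulLeftCLM_apply_apply t0, SchwartzMap.smulLeftCLM_apply_apply t1, e0, e1,
      mul_smul, smul_eq_mul, smul_eq_mul, smul_eq_mul, ← sub_mul, ← mul_assoc]
    congr 1
    rw [dyadicSymbol, ← Complex.ofReal_sub, ← Complex.ofReal_mul, ← Complex.ofReal_mul,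
      Complex.ofReal_inj]
    rcases eq_or_ne ξ 0 with rfl | hξ
    · simp
    · have hξ0 := norm_pos_iff.2 hξ
      rw [norm_smul, norm_inv, Real.norm_of_nonneg ha.le,
        Real.rpow_neg ha.le, Real.rpow_neg (by positivity)]
      have h1 : (2 * Real.pi * ‖ξ‖) ^ s = a ^ s * (2 * Real.pi * (a⁻¹ * ‖ξ‖)) ^ s := by
        rw [← Real.mul_rpow ha.le (by positivity)]
        congr 1
        field_simp
      have h2 : a ^ s ≠ 0 := by positivity
      have h3 : (2 * Real.pi * (a⁻¹ * ‖ξ‖)) ^ s ≠ 0 := by positivity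
      rw [h1]
      field_simp

/-! ### Scalar multiples in Lorentz spaces -/

theorem decreasingRearrangement_const_mul_le {c : ℂ} (hc : c ≠ 0) (f : Space d → ℂ) (t : ℝ≥0∞) :
    decreasingRearrangement (fun x => c * f x) t ≤ ‖c‖ₑ * decreasingRearrangement f t := by
  have hc0 : ‖c‖ₑ ≠ 0 := enorm_ne_zero.2 hc
  rw [← ENNReal.div_le_iff' hc0 enorm_ne_top]
  refine le_sInf fun τ (hτ : volume {x | τ < ‖f x‖ₑ} ≤ t) => ?_
  rw [ENNReal.div_le_iff' hc0 enorm_ne_top]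
  refine sInf_le (le_trans (measure_mono fun x (hx : ‖c‖ₑ * τ < ‖c * f x‖ₑ) => ?_) hτ)
  rw [enorm_mul] at hx
  exact lt_of_mul_lt_mul_left' hx

theorem lorentzNorm_const_mul_lt_top {q : ℝ} {r : ℝ≥0∞} {c : ℂ} (hc : c ≠ 0) {f : Space d → ℂ}
    (hr : 1 ≤ r) (hf : lorentzNorm q r f < ∞) : lorentzNorm q r (fun x => c * f x) < ∞ := by
  by_cases hr' : r = ∞
  · rw [lorentzNorm, if_pos hr'] at hf ⊢
    refine lt_of_le_of_lt ?_ (ENNReal.mul_lt_top (enorm_lt_top (x := c)) hf)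
    refine iSup₂_le fun t ht => ?_
    calc _ ≤ ENNReal.ofReal (t ^ (1 / q)) *
          (‖c‖ₑ * decreasingRearrangement f (ENNReal.ofReal t)) := by
          gcongr; exact decreasingRearrangement_const_mul_le hc _ _
      _ = ‖c‖ₑ * (ENNReal.ofReal (t ^ (1 / q)) *
          decreasingRearrangement f (ENNReal.ofReal t)) := mul_left_comm _ _ _
      _ ≤ _ := by
          gcongr
          exact le_iSup₂ (f := fun (t : ℝ) (_ : t ∈ Ioi (0 : ℝ)) =>
            ENNReal.ofReal (t ^ (1 / q)) * decreasingRearrangement f (ENNReal.ofReal t)) t ht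
  · have hρ : 0 < r.toReal := ENNReal.toReal_pos (zero_lt_one.trans_le hr).ne' hr'
    rw [lorentzNorm, if_neg hr'] at hf ⊢
    rw [ENNReal.rpow_lt_top_iff_of_pos (by positivity)] at hf ⊢
    have hfin : ‖c‖ₑ ^ r.toReal < ∞ := ENNReal.rpow_lt_top_of_nonneg hρ.le enorm_ne_top
    refine lt_of_le_of_lt ?_ (ENNReal.mul_lt_top hfin hf)
    rw [← lintegral_const_mul' _ _ hfin.ne]
    refine lintegral_mono fun t => ?_
    rw [← mul_assoc, ← ENNReal.mul_rpow_of_nonneg _ _ hρ.le]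
    refine mul_le_mul_left (ENNReal.rpow_le_rpow ?_ hρ.le) _
    rw [mul_left_comm]
    gcongr
    exact decreasingRearrangement_const_mul_le hc _ _

theorem MemLorentz.exists_weakTypeBound {q : ℝ} {r : ℝ≥0∞} (hq : 0 < q) (hr : 1 ≤ r)
    {f : Space d → ℂ} (hf : MemLorentz q r f) :
    ∃ W : ℝ, 0 < W ∧ WeakTypeBound q W (fun x => ‖f x‖ₑ) := by
  obtain ⟨c, hc, h⟩ := exists_weakTypeBound_of_lorentzNorm_le (d := d) hq hr
  refine ⟨c * ((lorentzNorm q r f).toReal + 1), by positivity, h f _ (by positivity) ?_⟩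
  rw [ENNReal.le_ofReal_iff_toReal_le hf.2.ne (by positivity)]
  linarith

/-! ### Elements of the homogeneous Sobolev-Lorentz space -/

theorem rieszConst_pos {s : ℝ} (hs : 0 < s) (hsd : s < d) : 0 < rieszConst d s := by
  have h1 := Real.Gamma_pos_of_pos (show 0 < s / 2 by linarith)
  have h2 := Real.Gamma_pos_of_pos (show 0 < ((d : ℝ) - s) / 2 by linarith)
  unfold rieszConst
  positivity

/-- This treats `s = 0` (exponent `q`) and `s > 0` (exponent `d/(d/q - s)`) together. The bound on
`lconv` is restricted to `0 < s`, since at `s = 0` the kernel `|x|^{-d}` does not represent the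
identity. -/
theorem exists_weakTypeBound_rieszPotential (hd : 1 ≤ d) {s q W : ℝ} (hs : 0 ≤ s) (hq : 1 < q)
    (hsq : s < d / q) {g : Space d → ℂ} (hg : AEStronglyMeasurable g volume) (hW : 0 < W)
    (hgW : WeakTypeBound q W (fun x => ‖g x‖ₑ)) :
    ∃ p W' : ℝ, 1 < p ∧ 0 < W' ∧
      AEMeasurable (lconv (rieszKernel s) fun x => ‖g x‖ₑ) volume ∧
      (0 < s → WeakTypeBound p W' (lconv (rieszKernel s) fun x => ‖g x‖ₑ)) ∧
      WeakTypeBound p W' (fun x => ‖rieszPotential s g x‖ₑ) := by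
  have hm : AEMeasurable (lconv (rieszKernel s) fun x => ‖g x‖ₑ) volume :=
    (measurable_lconv (measurable_rieszKernel s) hg.enorm).aemeasurable
  rcases hs.eq_or_lt with rfl | hs
  · exact ⟨q, W, hq, hW, hm, fun h => absurd h (lt_irrefl _), by simpa [rieszPotential] using hgW⟩
  · have hd0 : (0 : ℝ) < d := by exact_mod_cast hd
    obtain ⟨C, hC, h⟩ := exists_weakTypeBound_lconv_rieszKernel hd hs hq hsq rfl
    have hdq : 0 < (d : ℝ) / q - s := by linarith
    refine ⟨d / (d / q - s), C * W, ?_, by positivity, hm, fun _ => h _ W hg.enorm hW hgW,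
      (h _ W hg.enorm hW hgW).mono_ae (ae_of_all _ fun x => ?_)⟩
    · rw [one_lt_div hdq]
      have := div_lt_self hd0 hq
      linarith
    · rw [rieszPotential_eq_conv hs.ne']
      refine (enorm_conv_le _ _ x).trans (le_of_eq ?_)
      simp_rw [enorm_rieszKernelC]

theorem aestronglyMeasurable_rieszPotential {s : ℝ} {g : Space d → ℂ}
    (hg : AEStronglyMeasurable g volume) : AEStronglyMeasurable (rieszPotential s g) volume := by
  by_cases hs : s = 0
  · simpa [rieszPotential, hs] using hg
  · rw [rieszPotential_eq_conv hs]
    exact aestronglyMeasurable_conv (measurable_rieszKernelC s) hg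

/-- The bridge between membership through `I_s` and the norm through `Λ^s`: the preimage times
`rieszConst` is an admissible `Λ^s f`, so the infimum defining the norm is finite. The weak-type
bound on `f` itself lets the multipliers act on it by convolution. -/
theorem MemSobolevLorentz.exists_fracLaplacian (hd : 1 ≤ d) {s q : ℝ} {r : ℝ≥0∞} (hs : 0 ≤ s)
    (hq : 1 < q) (hr : 1 ≤ r) (hsq : s < d / q) {f : Space d → ℂ} (hf : MemSobolevLorentz s q r f) :
    (∃ p W : ℝ, 1 < p ∧ 0 < W ∧ WeakTypeBound p W (fun x => ‖f x‖ₑ)) ∧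
      ∃ g : Space d → ℂ, MemLorentz q r g ∧
        ∃ u v : 𝓢'(Space d, ℂ), Represents f u ∧ Represents g v ∧ IsFracLaplacian s u v := by
  have hd0 : (0 : ℝ) < d := by exact_mod_cast hd
  have hq0 : 0 < q := by linarith
  obtain ⟨g, hg, hfg⟩ := hf
  obtain ⟨W, hW, hgW⟩ := hg.exists_weakTypeBound hq0 hr
  obtain ⟨p, W', hp, hW', -, -, hw⟩ := exists_weakTypeBound_rieszPotential hd hs hq hsq hg.1 hW hgW
  have hfm : AEStronglyMeasurable f volume :=
    (aestronglyMeasurable_rieszPotential hg.1).congr hfg.symm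
  have hfw : WeakTypeBound p W' (fun x => ‖f x‖ₑ) :=
    hw.mono_ae (hfg.mono fun x hx => by simp only [hx]; exact le_rfl)
  refine ⟨⟨p, W', hp, hW', hfw⟩, ?_⟩
  obtain ⟨u, hu⟩ := hfw.exists_represents hfm hp hW'
  obtain ⟨v, hv⟩ := hgW.exists_represents hg.1 hq hW
  rcases hs.eq_or_lt with rfl | hs
  · have hfg' : f =ᵐ[volume] g := by simpa [rieszPotential] using hfg
    refine ⟨g, hg, u, v, hu, hv, ?_⟩
    rw [hu.unique (hv.congr_ae hfg'.symm)]
    intro φ ψ _ h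
    congr 1
    ext ξ
    simp [h ξ]
  · have hsd : s < d := hsq.trans_le (div_le_self hd0.le hq.le)
    have hc := rieszConst_pos hs hsd
    have hc0 : (rieszConst d s : ℂ) ≠ 0 := by exact_mod_cast hc.ne'
    refine ⟨fun x => (rieszConst d s : ℂ) * g x, ⟨hg.1.const_mul _,
      lorentzNorm_const_mul_lt_top hc0 hr hg.2⟩, u, _, hu, hv.const_mul _, ?_⟩
    rw [rieszPotential_eq_conv hs.ne'] at hfg
    exact isFracLaplacian_rieszPotential hd hs hq hsq hW hg.1 hgW (hu.congr_ae hfg) (hv.const_mul _)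

/-- The weak-type estimates need `W > 0`, while the norm `N` may vanish; letting `W` decrease to `N`
covers that case. -/
theorem le_mul_of_forall_le_ofReal {C : ℝ} (hC : 0 < C) {X N : ℝ≥0∞} (hN : N ≠ ∞)
    (h : ∀ W : ℝ, 0 < W → N ≤ ENNReal.ofReal W → X ≤ ENNReal.ofReal (C * W)) :
    X ≤ ENNReal.ofReal C * N := by
  have lim : Tendsto (fun δ : ℝ => ENNReal.ofReal (C * (N.toReal + δ))) (𝓝[>] 0)
      (𝓝 (ENNReal.ofReal (C * (N.toReal + 0)))) := by
    refine ((ENNReal.continuous_ofReal.comp (by fun_prop :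
      Continuous fun δ : ℝ => C * (N.toReal + δ))).tendsto 0).mono_left nhdsWithin_le_nhds
  rw [add_zero, ENNReal.ofReal_mul hC.le, ENNReal.ofReal_toReal hN] at lim
  refine ge_of_tendsto lim ?_
  filter_upwards [self_mem_nhdsWithin] with δ hδ
  have hδ : 0 < δ := hδ
  refine h _ (by positivity) ?_
  rw [ENNReal.le_ofReal_iff_toReal_le hN (by positivity)]
  linarith

/-- The estimate is required for every admissible `g`, so uniqueness of `Λ^s f` in the Lorentz space
never has to be proved. -/
theorem le_mul_sobolevLorentzNorm {C s q : ℝ} (hC : 0 < C) {r X : ℝ≥0∞} {f : Space d → ℂ}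
    (h : ∀ (g : Space d → ℂ) (u v : 𝓢'(Space d, ℂ)), MemLorentz q r g → Represents f u →
      Represents g v → IsFracLaplacian s u v →
      ∀ W : ℝ, 0 < W → lorentzNorm q r g ≤ ENNReal.ofReal W → X ≤ ENNReal.ofReal (C * W)) :
    X ≤ (C.toNNReal : ℝ≥0∞) * sobolevLorentzNorm s q r f := by
  change X ≤ ENNReal.ofReal C * _
  have hC0 : ENNReal.ofReal C ≠ 0 := (ENNReal.ofReal_pos.2 hC).ne'
  rw [← ENNReal.div_le_iff' hC0 ENNReal.ofReal_ne_top]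
  refine le_iInf fun g => le_iInf fun hg => le_iInf fun ⟨u, v, hu, hv, huv⟩ => ?_
  rw [ENNReal.div_le_iff' hC0 ENNReal.ofReal_ne_top]
  exact le_mul_of_forall_le_ofReal hC hg.2.ne (h g u v hg hu hv huv)

theorem sobolevLorentzNorm_le {s q : ℝ} {r : ℝ≥0∞} {f g : Space d → ℂ} {u v : 𝓢'(Space d, ℂ)}
    (hg : MemLorentz q r g) (hu : Represents f u) (hv : Represents g v)
    (huv : IsFracLaplacian s u v) : sobolevLorentzNorm s q r f ≤ lorentzNorm q r g :=
  iInf_le_of_le g (iInf_le_of_le hg (iInf_le_of_le ⟨u, v, hu, hv, huv⟩ le_rfl))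

/-! ### The heat semigroup on Lorentz spaces -/

theorem Represents.heatSemigroup {p W t : ℝ} {f : Space d → ℂ} {u : 𝓢'(Space d, ℂ)}
    (hu : Represents f u) (h : WeakTypeBound p W (fun x => ‖f x‖ₑ)) (hp : 1 < p) (hW : 0 < W)
    (ht : 0 < t) : Represents (heatSemigroup t f)
      (TemperedDistribution.fourierMultiplierCLM ℂ (heatSymbol t) u) :=
  hu.conv h hp hW (hasTemperateGrowth_heatSymbol ht) (measurable_heatKernel t)
    (integrable_heatKernel ht) (norm_heatKernel_le ht) (fourier_heatKernel ht)

theorem enorm_heatKernel_le {t : ℝ} (ht : 0 < t) (z : Space d) :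
    ‖heatKernel t z‖ₑ ≤ ENNReal.ofReal ((4 * Real.pi * t) ^ (-(d : ℝ) / 2)) := by
  rw [← ofReal_norm]
  exact ENNReal.ofReal_le_ofReal (norm_heatKernel_le ht z)

/-- The smoothing estimate `L^{q,r} → L^{q',1}` for the heat semigroup. -/
theorem exists_lorentzNorm_heatSemigroup_le {q q' : ℝ} {r : ℝ≥0∞} (hq : 1 < q) (hqq' : q < q')
    (hr : 1 ≤ r) : ∃ C : ℝ, 0 < C ∧ ∀ (g : Space d → ℂ) (W t : ℝ), MemLorentz q r g → 0 < W →
      lorentzNorm q r g ≤ ENNReal.ofReal W → 0 < t →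
      lorentzNorm q' 1 (heatSemigroup t g) ≤
        ENNReal.ofReal (C * W * t ^ (-(katoExponent d q q' / 2))) := by
  have hq0 : 0 < q := by linarith
  obtain ⟨c, hc, h1⟩ := exists_weakTypeBound_of_lorentzNorm_le (d := d) hq0 hr
  obtain ⟨C, hC, h2⟩ := exists_lorentzNorm_eLpNorm_le_of_le_lconv (d := d) hq hqq'
  refine ⟨C * c * (4 * Real.pi) ^ (-(katoExponent d q q' / 2)), by positivity, ?_⟩
  intro g W t hg hW hgW ht
  -- Taking `A = 1` and `B = (4πt)^{-d/2}`, the factor `B^{1/q-1/q'}` is `(4πt)^{-α/2}`.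
  refine (h2 (heatSemigroup t g) _ _ (c * W) 1 ((4 * Real.pi * t) ^ (-(d : ℝ) / 2))
    (aestronglyMeasurable_conv (measurable_heatKernel t) hg.1) (h1 g W hW hgW) hg.1.enorm
    (by positivity) (measurable_heatKernel t).enorm one_pos (by positivity)
    (lintegral_enorm_heatKernel ht) (enorm_heatKernel_le ht)
    (enorm_conv_le _ _)).1.trans (ENNReal.ofReal_le_ofReal (le_of_eq ?_))
  rw [Real.one_rpow, mul_one, ← Real.rpow_mul (by positivity),
    show -(d : ℝ) / 2 * (1 / q - 1 / q') = -(katoExponent d q q' / 2) by rw [katoExponent]; ring,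
    Real.mul_rpow (by positivity) ht.le]
  ring

theorem ofReal_rpow_mul_ofReal_rpow_neg {t : ℝ} (ht : 0 < t) (a C : ℝ) :
    ENNReal.ofReal (t ^ a) * ENNReal.ofReal (C * t ^ (-a)) = ENNReal.ofReal C := by
  rw [← ENNReal.ofReal_mul (by positivity)]
  congr 1
  rw [mul_left_comm, ← Real.rpow_add ht, add_neg_cancel, Real.rpow_zero, mul_one]

/-- Write `g` as a part bounded by `M` plus a part of weak size `η`. The heat semigroup bounds the
first by `M` and the second by a multiple of `η t^{-d/(2q)}`. Only the sup bound has to improve: it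
enters `L^{q',1}` with the positive power `1 - q/q'`, while the weak `L^q` bound stays fixed. -/
theorem tendsto_lorentzNorm_heatSemigroup (hd : 1 ≤ d) {q q' : ℝ} {r : ℝ≥0∞} (hq : 1 < q) (hqq' : q < q')
    (hr : 1 ≤ r) (hr' : r ≠ ∞) {g : Space d → ℂ} (hg : MemLorentz q r g) :
    Tendsto (fun t => ENNReal.ofReal (t ^ (katoExponent d q q' / 2)) *
      lorentzNorm q' 1 (heatSemigroup t g)) (𝓝[>] 0) (𝓝 0) := by
  have hq0 : 0 < q := by linarith
  have hq'0 : 0 < q' := by linarith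
  have hq1 : 0 < q - 1 := by linarith
  obtain ⟨W, hW, hgW⟩ := hg.exists_weakTypeBound hq0 hr
  set k := q / (q - 1) with hk
  have hk0 : 0 < k := by positivity
  have hθ : 0 < 1 - q / q' := by
    have := (div_lt_one hq'0).2 hqq'
    linarith
  have hqq'' : 0 < 1 / q - 1 / q' := sub_pos.2 (one_div_lt_one_div_of_lt hq0 hqq')
  set c : ℝ := (q' + 1 / (1 / q - 1 / q')) * (k * W * 1) ^ (q / q') with hc
  have hc0 : 0 < c := by positivity
  set e : ℝ := (d : ℝ) / (2 * q) with he
  have hd0 : (0 : ℝ) < d := by exact_mod_cast hd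
  have he0 : 0 < e := by positivity
  have bound : ∀ η : ℝ, 0 < η → ∃ M : ℝ, 0 < M ∧ ∀ t : ℝ, 0 < t →
      ENNReal.ofReal (t ^ (katoExponent d q q' / 2)) * lorentzNorm q' 1 (heatSemigroup t g) ≤
        ENNReal.ofReal (c * (M * t ^ e + k * η * (4 * Real.pi) ^ (-e)) ^ (1 - q / q')) := by
    intro η hη
    obtain ⟨M, hM, hMw⟩ := exists_weakTypeBound_indicator hq0 hr hr' hg.2 hη
    refine ⟨M, hM, fun t ht => ?_⟩
    set S := {x | ENNReal.ofReal M < ‖g x‖ₑ} with hS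
    have hSm : NullMeasurableSet S volume := nullMeasurableSet_lt aemeasurable_const hg.1.enorm
    have hKm : Measurable fun z : Space d => ‖heatKernel t z‖ₑ := (measurable_heatKernel t).enorm
    have hIm : AEMeasurable (S.indicator fun x => ‖g x‖ₑ) volume := hg.1.enorm.indicator₀ hSm
    have hB0 : 0 < (4 * Real.pi * t) ^ (-(d : ℝ) / 2) := by positivity
    have hsup : ∀ x, ‖heatSemigroup t g x‖ₑ ≤
        ENNReal.ofReal (M + k * η * (4 * Real.pi * t) ^ (-e)) := by
      intro x
      have hpt : ∀ y, ‖g y‖ₑ ≤ ENNReal.ofReal M + S.indicator (fun x => ‖g x‖ₑ) y := by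
        intro y
        by_cases hy : y ∈ S
        · rw [indicator_of_mem hy]; exact le_add_left le_rfl
        · exact le_add_right (not_lt.1 hy)
      calc ‖heatSemigroup t g x‖ₑ
          ≤ ∫⁻ y, ‖heatKernel t (x - y)‖ₑ * ‖g y‖ₑ := enorm_conv_le (heatKernel t) g x
        _ ≤ ∫⁻ y, (‖heatKernel t (x - y)‖ₑ * ENNReal.ofReal M +
              ‖heatKernel t (x - y)‖ₑ * S.indicator (fun x => ‖g x‖ₑ) y) := by
            refine lintegral_mono fun y => ?_
            rw [← mul_add]
            gcongr
            exact hpt y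
        _ = (∫⁻ y, ‖heatKernel t (x - y)‖ₑ) * ENNReal.ofReal M +
              lconv (fun z => ‖heatKernel t z‖ₑ) (S.indicator fun x => ‖g x‖ₑ) x := by
            have hKx : Measurable fun y => ‖heatKernel t (x - y)‖ₑ :=
              hKm.comp (measurable_const.sub measurable_id)
            rw [lintegral_add_left (hKx.mul_const _), lintegral_mul_const _ hKx]
            rfl
        _ ≤ ENNReal.ofReal 1 * ENNReal.ofReal M + ENNReal.ofReal (q / (q - 1) * η *
              1 ^ (1 - 1 / q) * ((4 * Real.pi * t) ^ (-(d : ℝ) / 2)) ^ (1 / q)) := by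
            gcongr
            · rw [lintegral_sub_left_eq_self (fun z => ‖heatKernel t z‖ₑ)]
              exact lintegral_enorm_heatKernel ht
            · exact hMw.lconv_le hIm hq hη hKm one_pos hB0 (lintegral_enorm_heatKernel ht)
                (enorm_heatKernel_le ht) x
        _ = _ := by
            rw [ENNReal.ofReal_one, one_mul, ← ENNReal.ofReal_add hM.le (by positivity),
              Real.one_rpow, mul_one, ← Real.rpow_mul (by positivity),
              show -(d : ℝ) / 2 * (1 / q) = -e by rw [he]; field_simp]
    have hweak : WeakTypeBound q (k * W * 1) (fun x => ‖heatSemigroup t g x‖ₑ) :=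
      (hgW.lconv hg.1.enorm hq hW hKm one_pos (lintegral_enorm_heatKernel ht)).mono_ae
        (ae_of_all _ (enorm_conv_le (heatKernel t) g))
    have hl := lorentzNorm_one_le_of_weakTypeBound hweak hq0 hqq' (by positivity)
      (by positivity) (ae_of_all _ hsup)
    refine (mul_le_mul_right hl _).trans (le_of_eq ?_)
    rw [← ENNReal.ofReal_mul (by positivity)]
    congr 1
    have h1 : t ^ (katoExponent d q q' / 2) = (t ^ e) ^ (1 - q / q') := by
      rw [← Real.rpow_mul ht.le, katoExponent, he]
      congr 1
      field_simp
    have h2 : M * t ^ e + k * η * (4 * Real.pi) ^ (-e) =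
        t ^ e * (M + k * η * (4 * Real.pi * t) ^ (-e)) := by
      have : t ^ e * t ^ (-e) = 1 := by rw [← Real.rpow_add ht, add_neg_cancel, Real.rpow_zero]
      rw [Real.mul_rpow (by positivity) ht.le]
      linear_combination (-(k * η * (4 * Real.pi) ^ (-e))) * this
    rw [h1, h2, Real.mul_rpow (x := t ^ e) (by positivity) (by positivity), hc]
    ring
  rw [ENNReal.tendsto_nhds_zero]
  intro ε hε
  -- The minimum with `1` gives a finite real threshold even when `ε = ∞`.
  set ε' : ℝ := (min ε 1).toReal with hε'
  have hmin : min ε 1 ≠ ∞ := ne_top_of_le_ne_top ENNReal.one_ne_top (min_le_right _ _)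
  have hε'0 : 0 < ε' := ENNReal.toReal_pos (lt_min hε zero_lt_one).ne' hmin
  have hε'ε : ENNReal.ofReal ε' ≤ ε := by
    rw [hε', ENNReal.ofReal_toReal hmin]; exact min_le_left _ _
  have lim1 : Tendsto (fun η : ℝ => c * (k * η * (4 * Real.pi) ^ (-e)) ^ (1 - q / q')) (𝓝[>] 0)
      (𝓝 0) := by
    have : Continuous fun η : ℝ => c * (k * η * (4 * Real.pi) ^ (-e)) ^ (1 - q / q') :=
      continuous_const.mul (Continuous.rpow_const (by fun_prop) fun _ => Or.inr hθ.le)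
    have h := this.tendsto 0
    rw [mul_zero, zero_mul, Real.zero_rpow hθ.ne', mul_zero] at h
    exact h.mono_left nhdsWithin_le_nhds
  -- Order of choices: `η` makes the value at `t = 0` small and thereby fixes `M`; only afterwards
  -- is `t` taken small enough to absorb `M t^e`.
  obtain ⟨η, hηε, hη⟩ := ((lim1.eventually_lt_const hε'0).and self_mem_nhdsWithin).exists
  obtain ⟨M, hM, hMb⟩ := bound η hη
  have lim2 : Tendsto (fun t : ℝ => c * (M * t ^ e + k * η * (4 * Real.pi) ^ (-e)) ^ (1 - q / q'))
      (𝓝[>] 0) (𝓝 (c * (k * η * (4 * Real.pi) ^ (-e)) ^ (1 - q / q'))) := by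
    have : Continuous fun t : ℝ => c * (M * t ^ e + k * η * (4 * Real.pi) ^ (-e)) ^ (1 - q / q') :=
      continuous_const.mul (Continuous.rpow_const ((continuous_const.mul
        (Real.continuous_rpow_const he0.le)).add continuous_const) fun _ => Or.inr hθ.le)
    have h := this.tendsto 0
    rw [Real.zero_rpow he0.ne', mul_zero, zero_add] at h
    exact h.mono_left nhdsWithin_le_nhds
  filter_upwards [lim2.eventually_lt_const hηε, self_mem_nhdsWithin] with t ht ht0
  exact (hMb t ht0).trans ((ENNReal.ofReal_le_ofReal ht.le).trans hε'ε)

theorem MemLorentz.heatSemigroup {q q' t : ℝ} {r : ℝ≥0∞} (hq : 1 < q) (hqq' : q < q') (hr : 1 ≤ r)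
    {g : Space d → ℂ} (hg : MemLorentz q r g) (ht : 0 < t) :
    MemLorentz q' 1 (heatSemigroup t g) := by
  obtain ⟨C, -, h⟩ := exists_lorentzNorm_heatSemigroup_le (d := d) hq hqq' hr
  refine ⟨aestronglyMeasurable_conv (measurable_heatKernel t) hg.1,
    (h g ((lorentzNorm q r g).toReal + 1) t hg (by positivity) ?_ ht).trans_lt
      ENNReal.ofReal_lt_top⟩
  rw [ENNReal.le_ofReal_iff_toReal_le hg.2.ne (by positivity)]
  linarith

/-- This gives membership of `e^{tΔ} I_s g` in the image of `I_s`. The convolutions commute because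
the heat kernel applied to `I_s |g|`, a weak-type function, is finite at every point. -/
theorem heatSemigroup_rieszPotential (hd : 1 ≤ d) {s q W t : ℝ} (hs : 0 ≤ s) (hq : 1 < q)
    (hsq : s < d / q) {g : Space d → ℂ} (hg : AEStronglyMeasurable g volume) (hW : 0 < W)
    (hgW : WeakTypeBound q W (fun x => ‖g x‖ₑ)) (ht : 0 < t) :
    heatSemigroup t (rieszPotential s g) = rieszPotential s (heatSemigroup t g) := by
  rcases hs.eq_or_lt with rfl | hs
  · simp [rieszPotential]
  obtain ⟨p, W', hp, hW', hm, hw, -⟩ :=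
    exists_weakTypeBound_rieszPotential hd hs.le hq hsq hg hW hgW
  rw [rieszPotential_eq_conv hs.ne', rieszPotential_eq_conv hs.ne', heatSemigroup_eq_conv,
    heatSemigroup_eq_conv]
  funext x
  refine conv_conv_comm (measurable_heatKernel t) (measurable_rieszKernelC s) hg x ?_
  simp_rw [enorm_rieszKernelC]
  exact ((hw hs).lconv_le hm hp hW' (measurable_heatKernel t).enorm one_pos (by positivity)
    (lintegral_enorm_heatKernel ht) (enorm_heatKernel_le ht) x).trans_lt ENNReal.ofReal_lt_top

theorem MemSobolevLorentz.heatSemigroup (hd : 1 ≤ d) {s q q' t : ℝ} {r : ℝ≥0∞} (hs : 0 ≤ s)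
    (hq : 1 < q) (hqq' : q < q') (hr : 1 ≤ r) (hsq : s < d / q) {f : Space d → ℂ}
    (hf : MemSobolevLorentz s q r f) (ht : 0 < t) :
    MemSobolevLorentz s q' 1 (heatSemigroup t f) := by
  obtain ⟨g, hg, hfg⟩ := hf
  obtain ⟨W, hW, hgW⟩ := hg.exists_weakTypeBound (by linarith) hr
  refine ⟨SobolevLorentz.heatSemigroup t g, hg.heatSemigroup hq hqq' hr ht, ?_⟩
  rw [← heatSemigroup_rieszPotential hd hs hq hsq hg.1 hW hgW ht, heatSemigroup_eq_conv,
    conv_congr_ae hfg]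
  rfl

/-- Fourier multipliers commute with `Λ^s`, so `e^{tΔ} g` is a competitor in the infimum for `e^{tΔ}
f`, for any admissible `g`. -/
theorem sobolevLorentzNorm_heatSemigroup_le {s p q q' t W : ℝ} {r : ℝ≥0∞} (hq : 1 < q)
    (hqq' : q < q') (hr : 1 ≤ r) {f g : Space d → ℂ} (hp : 1 < p) (hW : 0 < W)
    (hfw : WeakTypeBound p W (fun x => ‖f x‖ₑ)) (hg : MemLorentz q r g) {u v : 𝓢'(Space d, ℂ)}
    (hu : Represents f u) (hv : Represents g v) (huv : IsFracLaplacian s u v) (ht : 0 < t) :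
    sobolevLorentzNorm s q' 1 (heatSemigroup t f) ≤ lorentzNorm q' 1 (heatSemigroup t g) := by
  obtain ⟨W', hW', hgW⟩ := hg.exists_weakTypeBound (by linarith) hr
  exact sobolevLorentzNorm_le (hg.heatSemigroup hq hqq' hr ht)
    (hu.heatSemigroup hfw hp hW ht) (hv.heatSemigroup hgW hq hW' ht)
    (huv.fourierMultiplierCLM (hasTemperateGrowth_heatSymbol ht))

theorem exists_katoNorm_heatSemigroup_le (hd : 1 ≤ d) {s q q' : ℝ} {r : ℝ≥0∞} (hs : 0 ≤ s)
    (hq : 1 < q) (hqq' : q < q') (hr : 1 ≤ r) (hsq : s < d / q) :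
    ∃ C : ℝ≥0, ∀ f : Space d → ℂ, MemSobolevLorentz s q r f →
      katoNorm s q q' 1 ∞ (fun t => heatSemigroup t f) < ∞ ∧
      katoNorm s q q' 1 ∞ (fun t => heatSemigroup t f) ≤ C * sobolevLorentzNorm s q r f := by
  obtain ⟨C, hC, h⟩ := exists_lorentzNorm_heatSemigroup_le (d := d) hq hqq' hr
  refine ⟨C.toNNReal, fun f hf => ?_⟩
  obtain ⟨⟨p, W, hp, hW, hfw⟩, g, hg, u, v, hu, hv, huv⟩ := hf.exists_fracLaplacian hd hs hq hr hsq
  have key : katoNorm s q q' 1 ∞ (fun t => heatSemigroup t f) ≤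
      (C.toNNReal : ℝ≥0∞) * sobolevLorentzNorm s q r f := by
    refine le_mul_sobolevLorentzNorm hC fun g u v hg hu hv huv W' hW' hgW => ?_
    refine iSup_le fun t => iSup_le fun ht => iSup_le fun _ => ?_
    rw [← ofReal_rpow_mul_ofReal_rpow_neg ht (katoExponent d q q' / 2) (C * W'), katoWeightedNorm]
    gcongr
    exact (sobolevLorentzNorm_heatSemigroup_le hq hqq' hr hp hW hfw hg hu hv huv ht).trans
      (h g W' t hg hW' hgW ht)
  exact ⟨key.trans_lt (ENNReal.mul_lt_top ENNReal.coe_lt_top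
    ((sobolevLorentzNorm_le hg hu hv huv).trans_lt hg.2)), key⟩

theorem tendsto_katoWeightedNorm_heatSemigroup (hd : 1 ≤ d) {s q q' : ℝ} {r : ℝ≥0∞} (hs : 0 ≤ s)
    (hq : 1 < q) (hqq' : q < q') (hr : 1 ≤ r) (hr' : r ≠ ∞) (hsq : s < d / q) {f : Space d → ℂ}
    (hf : MemSobolevLorentz s q r f) :
    Tendsto (katoWeightedNorm s q q' 1 (fun t => heatSemigroup t f)) (𝓝[>] 0) (𝓝 0) := by
  obtain ⟨⟨p, W, hp, hW, hfw⟩, g, hg, u, v, hu, hv, huv⟩ := hf.exists_fracLaplacian hd hs hq hr hsq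
  refine tendsto_of_tendsto_of_tendsto_of_le_of_le' tendsto_const_nhds
    (tendsto_lorentzNorm_heatSemigroup hd hq hqq' hr hr' hg) (Eventually.of_forall fun _ => zero_le)
    ?_
  filter_upwards [self_mem_nhdsWithin] with t ht
  exact mul_le_mul_right
    (sobolevLorentzNorm_heatSemigroup_le hq hqq' hr hp hW hfw hg hu hv huv ht) _

/-! ### The Besov embedding -/

theorem distLpNorm_le {p : ℝ≥0∞} {f : Space d → ℂ} {u : 𝓢'(Space d, ℂ)} (h : Represents f u) :
    distLpNorm p u ≤ eLpNorm f p volume :=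
  iInf_le_of_le f (iInf_le_of_le h le_rfl)

theorem exists_norm_le_pos_schwartz (K : 𝓢(Space d, ℂ)) : ∃ B, 0 < B ∧ ∀ x, ‖K x‖ ≤ B := by
  obtain ⟨B, hB⟩ := exists_norm_le_schwartz K
  exact ⟨max B 1, by positivity, fun x => (hB x).trans (le_max_left _ _)⟩

theorem lintegral_enorm_dilate_le {a A : ℝ} (ha : 0 < a) {K : Space d → ℂ}
    (hK : Integrable K volume) (hA : ∫ x, ‖K x‖ ≤ A) :
    ∫⁻ x, ‖dilate a K x‖ₑ ≤ ENNReal.ofReal A := by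
  rw [← ofReal_integral_norm_eq_lintegral_enorm (integrable_dilate ha hK), integral_norm_dilate ha]
  exact ENNReal.ofReal_le_ofReal hA

theorem enorm_dilate_le {a B : ℝ} (ha : 0 < a) {K : Space d → ℂ} (hK : ∀ x, ‖K x‖ ≤ B)
    (x : Space d) : ‖dilate a K x‖ₑ ≤ ENNReal.ofReal (a ^ (d : ℝ) * B) := by
  rw [← ofReal_norm]
  exact ENNReal.ofReal_le_ofReal (norm_dilate_le ha hK x)

/-- The kernel of `S_j` has fixed `L¹` norm and sup norm of order `2^{jd}`, so `‖S_j u‖_∞` is of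
order `2^{jd/p}`. The weak bound used is that of `f`, not of `Λ^s f`: the cutoff does not vanish
near the origin, where `IsFracLaplacian` gives no information. -/
theorem tendsto_distLpNorm_lowFrequency (hd : 1 ≤ d) {p W : ℝ} {f : Space d → ℂ}
    {u : 𝓢'(Space d, ℂ)} (hu : Represents f u) (hp : 1 < p) (hW : 0 < W)
    (h : WeakTypeBound p W (fun x => ‖f x‖ₑ)) {χ : Space d → ℝ} (hχ : IsLittlewoodPaleyCutoff χ) :
    Tendsto (fun j : ℤ => distLpNorm ∞ (lowFrequency χ j u)) atBot (𝓝 0) := by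
  have hp0 : 0 < p := by linarith
  have hd0 : (0 : ℝ) < d := by exact_mod_cast hd
  obtain ⟨K, hK⟩ := exists_schwartz_fourier_eq hχ.contDiff_ofReal hχ.ofReal_eq_zero
  obtain ⟨B, hB0, hB⟩ := exists_norm_le_pos_schwartz K
  set A := (∫ x, ‖K x‖) + 1 with hA
  have hA0 : 0 < A := by
    have : 0 ≤ ∫ x, ‖K x‖ := integral_nonneg fun x => norm_nonneg _
    positivity
  set k := p / (p - 1) * W * A ^ (1 - 1 / p) with hk
  have bound : ∀ j : ℤ, distLpNorm ∞ (lowFrequency χ j u) ≤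
      ENNReal.ofReal (k * (((2 : ℝ) ^ j) ^ (d : ℝ) * B) ^ (1 / p)) := by
    intro j
    set a : ℝ := (2 : ℝ) ^ j
    have ha : 0 < a := by positivity
    have hF : 𝓕 (dilate a K) = fun ξ => ((χ ((2 : ℝ) ^ (-j) • ξ) : ℝ) : ℂ) := by
      funext ξ
      rw [fourier_dilate ha, hK, zpow_neg]
    have hrep : Represents (conv (dilate a K) f) (lowFrequency χ j u) :=
      hu.conv h hp hW (hasTemperateGrowth_comp_smul hχ.contDiff_ofReal hχ.ofReal_eq_zero _)
        (measurable_dilate K.continuous.measurable) (integrable_dilate ha K.integrable)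
        (norm_dilate_le ha hB) hF
    refine (distLpNorm_le hrep).trans ?_
    rw [eLpNorm_exponent_top]
    refine eLpNormEssSup_le_of_ae_enorm_bound (ae_of_all _ fun x => ?_)
    exact (enorm_conv_le _ _ x).trans (h.lconv_le hu.1.enorm hp hW
      (measurable_dilate K.continuous.measurable).enorm hA0 (by positivity)
      (lintegral_enorm_dilate_le ha K.integrable (by linarith)) (enorm_dilate_le ha hB) x)
  refine tendsto_of_tendsto_of_tendsto_of_le_of_le tendsto_const_nhds ?_ (fun _ => zero_le) bound
  have hcont : Continuous fun a : ℝ => ENNReal.ofReal (k * (a ^ (d : ℝ) * B) ^ (1 / p)) :=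
    ENNReal.continuous_ofReal.comp (continuous_const.mul (Continuous.rpow_const
      ((Real.continuous_rpow_const hd0.le).mul continuous_const) fun _ => Or.inr (by positivity)))
  have h0 := hcont.tendsto 0
  rw [Real.zero_rpow hd0.ne', zero_mul, Real.zero_rpow (by positivity), mul_zero,
    ENNReal.ofReal_zero] at h0
  refine h0.comp ?_
  have : Tendsto (fun j : ℤ => Real.exp (Real.log 2 * j)) atBot (𝓝 0) :=
    Real.tendsto_exp_atBot.comp
      ((tendsto_intCast_atBot_iff.2 tendsto_id).const_mul_atBot (Real.log_pos one_lt_two))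
  refine this.congr fun j => ?_
  rw [← Real.rpow_def_of_pos two_pos, Real.rpow_intCast]

/-- With `a = 2^j`, the kernel `a^{-s} a^d K(a ·)` has `A` of order `a^{-s}` and `B` of order
`a^{d-s}`. Hence `A^{1-θ} B^θ` is of order `a^{-(s - dθ)}`, exactly cancelling the Besov weight. -/
theorem exists_distLpNorm_dyadicBlock_le {s q q' : ℝ} {r : ℝ≥0∞} (hq : 1 < q) (hqq' : q < q')
    (hr : 1 ≤ r) {χ : Space d → ℝ} (hχ : IsLittlewoodPaleyCutoff χ) :
    ∃ C : ℝ, 0 < C ∧ ∀ (g : Space d → ℂ) (u v : 𝓢'(Space d, ℂ)) (W : ℝ) (j : ℤ), 0 < W →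
      lorentzNorm q r g ≤ ENNReal.ofReal W → Represents g v → IsFracLaplacian s u v →
      ENNReal.ofReal ((2 : ℝ) ^ ((j : ℝ) * (s - (d / q - d / q')))) *
        distLpNorm (ENNReal.ofReal q') (dyadicBlock χ j u) ≤ ENNReal.ofReal (C * W) := by
  have hq0 : 0 < q := by linarith
  obtain ⟨c, hc, h1⟩ := exists_weakTypeBound_of_lorentzNorm_le (d := d) hq0 hr
  obtain ⟨C, hC, h2⟩ := exists_lorentzNorm_eLpNorm_le_of_le_lconv (d := d) hq hqq'
  obtain ⟨K, hK⟩ := exists_schwartz_fourier_eq (hχ.contDiff_dyadicSymbol s)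
    (hχ.dyadicSymbol_eq_zero_of_ge s)
  obtain ⟨B, hB0, hB⟩ := exists_norm_le_pos_schwartz K
  set A := (∫ x, ‖K x‖) + 1 with hA
  have hA0 : 0 < A := by
    have : 0 ≤ ∫ x, ‖K x‖ := integral_nonneg fun x => norm_nonneg _
    positivity
  set θ := 1 / q - 1 / q' with hθ
  refine ⟨C * c * (A ^ (1 - θ) * B ^ θ), by positivity, ?_⟩
  intro g u v W j hW hgW hv huv
  set a : ℝ := (2 : ℝ) ^ j with ha_def
  have ha : 0 < a := by positivity
  set κ : ℂ := ((a ^ (-s) : ℝ) : ℂ) with hκ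
  have hκn : ‖κ‖ = a ^ (-s) := by
    rw [hκ, Complex.norm_real, Real.norm_of_nonneg (by positivity)]
  have hκe : ‖κ‖ₑ = ENNReal.ofReal (a ^ (-s)) := by rw [← ofReal_norm, hκn]
  set L : Space d → ℂ := fun x => κ * dilate a K x with hL
  have hLm : Measurable L := (measurable_dilate K.continuous.measurable).const_mul κ
  have hLi : Integrable L volume := (integrable_dilate ha K.integrable).const_mul κ
  have hLB : ∀ x, ‖L x‖ ≤ a ^ (-s) * (a ^ (d : ℝ) * B) := by
    intro x
    rw [hL, norm_mul, hκn]
    gcongr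
    exact norm_dilate_le ha hB x
  have hLA : ∫⁻ x, ‖L x‖ₑ ≤ ENNReal.ofReal (a ^ (-s) * A) := by
    simp_rw [hL, enorm_mul]
    rw [lintegral_const_mul' _ _ enorm_ne_top, hκe, ENNReal.ofReal_mul (by positivity)]
    gcongr
    exact lintegral_enorm_dilate_le ha K.integrable (by linarith)
  have hLF : 𝓕 L = fun ξ => κ * dyadicSymbol s χ (a⁻¹ • ξ) := by
    funext ξ
    have : 𝓕 L ξ = κ • 𝓕 (dilate a K) ξ :=
      congrFun (VectorFourier.fourierIntegral_const_smul _ _ _ _ _) ξ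
    rw [this, fourier_dilate ha, hK, smul_eq_mul]
  have hgw := h1 g W hW hgW
  have hrep : Represents (conv L g) (dyadicBlock χ j u) := by
    rw [huv.dyadicBlock_eq hχ j]
    exact hv.conv hgw hq (by positivity) ((Function.HasTemperateGrowth.const _).mul
      (hasTemperateGrowth_comp_smul (hχ.contDiff_dyadicSymbol s)
        (hχ.dyadicSymbol_eq_zero_of_ge s) _)) hLm hLi hLB hLF
  have hb := (h2 (conv L g) _ _ (c * W) (a ^ (-s) * A) (a ^ (-s) * (a ^ (d : ℝ) * B))
    hrep.1 hgw hv.1.enorm (by positivity) hLm.enorm (by positivity) (by positivity) hLA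
    (fun x => by rw [← ofReal_norm]; exact ENNReal.ofReal_le_ofReal (hLB x))
    (enorm_conv_le _ _)).2
  refine (mul_le_mul_right ((distLpNorm_le hrep).trans hb) _).trans (le_of_eq ?_)
  rw [← ENNReal.ofReal_mul (by positivity)]
  congr 1
  have e1 : (2 : ℝ) ^ ((j : ℝ) * (s - (d / q - d / q'))) = a ^ (s - d * θ) := by
    rw [Real.rpow_mul (by norm_num), Real.rpow_intCast, hθ]
    congr 1; ring
  have e2 : a ^ (s - d * θ) * ((a ^ (-s) * A) ^ (1 - θ) * (a ^ (-s) * (a ^ (d : ℝ) * B)) ^ θ) =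
      A ^ (1 - θ) * B ^ θ := by
    rw [← Real.exp_log ha, ← Real.exp_log hA0, ← Real.exp_log hB0]
    simp only [← Real.exp_mul, ← Real.exp_add]
    congr 1; ring
  rw [e1]
  linear_combination (C * c * W) * e2

theorem exists_besovNorm_le (hd : 1 ≤ d) {s q q' : ℝ} {r : ℝ≥0∞} (hs : 0 ≤ s) (hq : 1 < q)
    (hqq' : q < q') (hr : 1 ≤ r) (hsq : s < d / q) {χ : Space d → ℝ}
    (hχ : IsLittlewoodPaleyCutoff χ) :
    ∃ C : ℝ≥0, ∀ f : Space d → ℂ, MemSobolevLorentz s q r f →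
      ∃ u : 𝓢'(Space d, ℂ), Represents f u ∧
        MemBesov χ (s - (d / q - d / q')) (ENNReal.ofReal q') u ∧
        besovNorm χ (s - (d / q - d / q')) (ENNReal.ofReal q') u ≤
          C * sobolevLorentzNorm s q r f := by
  obtain ⟨C, hC, h⟩ := exists_distLpNorm_dyadicBlock_le (s := s) hq hqq' hr hχ
  refine ⟨C.toNNReal, fun f hf => ?_⟩
  obtain ⟨⟨p, W, hp, hW, hfw⟩, g, hg, u, v, hu, hv, huv⟩ := hf.exists_fracLaplacian hd hs hq hr hsq
  have key : besovNorm χ (s - (d / q - d / q')) (ENNReal.ofReal q') u ≤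
      (C.toNNReal : ℝ≥0∞) * sobolevLorentzNorm s q r f := by
    refine le_mul_sobolevLorentzNorm hC fun g' u' v' hg' hu' hv' huv' W' hW' hgW' => ?_
    refine iSup_le fun j => ?_
    -- The distribution is determined by `f`, so every competitor in the infimum estimates the same
    -- Besov norm.
    rw [hu.unique hu']
    exact h g' u' v' W' j hW' hgW' hv' huv'
  exact ⟨u, hu, ⟨tendsto_distLpNorm_lowFrequency hd hu hp hW hfw hχ,
    key.trans_lt (ENNReal.mul_lt_top ENNReal.coe_lt_top
      ((sobolevLorentzNorm_le hg hu hv huv).trans_lt hg.2))⟩, key⟩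

end SobolevLorentz

theorem mainTheorem5 (d : ℕ) (hd : 1 ≤ d) (s q q' : ℝ) (r : ℝ≥0∞)
    (hq : 1 < q) (hr : 1 ≤ r) (hs : 0 ≤ s)
    (hsq : s / d < 1 / q) (hqs : 1 / q ≤ (s + 1) / d)
    (hsq' : s / d < 1 / q') (hq'q : 1 / q' < 1 / q) :
    (∃ C : ℝ≥0, ∀ u₀ : SobolevLorentz.Space d → ℂ,
      SobolevLorentz.MemSobolevLorentz s q r u₀ →
        (∀ t : ℝ, 0 < t →
          SobolevLorentz.MemSobolevLorentz s q' 1 (SobolevLorentz.heatSemigroup t u₀)) ∧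
        SobolevLorentz.katoNorm s q q' 1 ∞ (fun t => SobolevLorentz.heatSemigroup t u₀) < ∞ ∧
        SobolevLorentz.katoNorm s q q' 1 ∞ (fun t => SobolevLorentz.heatSemigroup t u₀)
          ≤ C * SobolevLorentz.sobolevLorentzNorm s q r u₀) ∧
    (r ≠ ∞ → ∀ u₀ : SobolevLorentz.Space d → ℂ,
      SobolevLorentz.MemSobolevLorentz s q r u₀ →
        SobolevLorentz.MemKato s q q' 1 ∞ (fun t => SobolevLorentz.heatSemigroup t u₀)) ∧
    (∀ χ : SobolevLorentz.Space d → ℝ, SobolevLorentz.IsLittlewoodPaleyCutoff χ →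
      ∃ C : ℝ≥0, ∀ u₀ : SobolevLorentz.Space d → ℂ,
        SobolevLorentz.MemSobolevLorentz s q r u₀ →
          ∃ u : 𝓢'(SobolevLorentz.Space d, ℂ), SobolevLorentz.Represents u₀ u ∧
            SobolevLorentz.MemBesov χ (s - (d / q - d / q')) (ENNReal.ofReal q') u ∧
            SobolevLorentz.besovNorm χ (s - (d / q - d / q')) (ENNReal.ofReal q') u
              ≤ C * SobolevLorentz.sobolevLorentzNorm s q r u₀) := by
  have hd0 : (0 : ℝ) < d := by exact_mod_cast hd
  have hq0 : 0 < q := by linarith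
  have hq'0 : 0 < q' := by
    have : 0 ≤ s / d := by positivity
    exact one_div_pos.1 (this.trans_lt hsq')
  have hqq' : q < q' := (one_div_lt_one_div hq'0 hq0).1 hq'q
  have hsq0 : s < d / q := by
    rw [div_lt_div_iff₀ hd0 hq0] at hsq
    rw [lt_div_iff₀ hq0]
    linarith
  obtain ⟨C, hC⟩ := SobolevLorentz.exists_katoNorm_heatSemigroup_le hd hs hq hqq' hr hsq0
  refine ⟨⟨C, fun u₀ hu₀ => ⟨fun t ht => hu₀.heatSemigroup hd hs hq hqq' hr hsq0 ht, hC u₀ hu₀⟩⟩,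
    fun hr' u₀ hu₀ => ⟨fun t ht _ => hu₀.heatSemigroup hd hs hq hqq' hr hsq0 ht, (hC u₀ hu₀).1,
      SobolevLorentz.tendsto_katoWeightedNorm_heatSemigroup hd hs hq hqq' hr hr' hsq0 hu₀⟩,
    fun χ hχ => SobolevLorentz.exists_besovNorm_le hd hs hq hqq' hr hsq0 hχ⟩
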